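/- Let $k$ be a field of characteristic zero and let $A$ be a finitely generated $k$-algebra that is an integral domain, integrally closed in its field of fractions. Let $\partial$ be a nonzero locally nilpotent $k$-derivation of $A$ (every element of $A$ is killed by some power of $\partial$). Put $F_n=\ker \partial^{n+1}$ for $n\ge 0$, $A_0=F_0=\ker\partial$, and let $$R(A,\partial)=\bigoplus_{n\ge 0}F_n\upsilon^n\subseteq A[\upsilon]$$ be the Rees algebra, graded by the degree in $\upsilon$. Assume that $R(A,\partial)$ is a finitely generated $k$-algebra. Let $Y_0=\operatorname{Spec}(A_0)$ and $Y=\operatorname{Proj}(R(A,\partial))$, with structure morphism $\pi:Y\to Y_0$. A $k$-variety is an integral separated scheme of finite type over $k$. Then: 1) $Y_0$ and $Y$ are normal $k$-varieties. 2) $\pi:Y\to Y_0$ is a $\mathbb{P}^1$-fibration, that is, a surjective projective morphism of finite type whose fiber $Y_\eta$ over the generic point $\eta$ of $Y_0$ is isomorphic to $\mathbb{P}^1_{k(Y_0)}$ over the function field $k(Y_0)$ of $Y_0$. 3) Let $B=V_+(\upsilon)$ be the effective Weil divisor on $Y$ defined by $\upsilon\in F_1\upsilon$ (each prime divisor is counted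 with the multiplicity of the closed subscheme $V_+(\upsilon)$ along it). Then $B$ is ample, in the sense that for some $n\ge 1$ the sheaf $\mathcal{O}_Y(nB)$ is invertible and ample. Moreover there is an isomorphism $Y_\eta\cong\mathbb{P}^1_{k(Y_0)}$ over $k(Y_0)$ under which the restriction of $\mathcal{O}_Y(B)=\{f \mid f=0\text{ or }\operatorname{div}(f)+B\ge 0\}$ to $Y_\eta$ is isomorphic to $\mathcal{O}_{\mathbb{P}^1_{k(Y_0)}}(1)$. -/

import Mathlib

open CategoryTheory AlgebraicGeometry TopologicalSpace Opposite

universe u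

namespace ReesFibration

noncomputable section

section Pred
variable {X : Scheme.{u}} {T : X → Type u} [∀ x, AddCommGroup (T x)]
  [∀ x, Module (X.presheaf.stalk x) (T x)]

/-- Families `(s x)`, `x ∈ U`, with `s x` in an `𝒪_{X,x}`-module `T x`, form a `Γ(X, U)`-module:
the function `r` acts at `x` through its germ at `x`. -/
@[reducible] def sectionModule (U : X.Opens) : Module Γ(X, U) (∀ x : U, T x) where
  smul r s x := X.presheaf.germ U x.1 x.2 r • s x
  one_smul s := by funext x; change X.presheaf.germ U x.1 x.2 1 • s x = s x; simp
  mul_smul a b s := by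
    funext x
    change X.presheaf.germ U x.1 x.2 (a * b) • s x = X.presheaf.germ U x.1 x.2 a • X.presheaf.germ U x.1 x.2 b • s x
    rw [map_mul, mul_smul]
  smul_zero a := by funext x; exact smul_zero _
  smul_add a s t := by funext x; exact smul_add _ _ _
  add_smul a b s := by
    funext x
    change X.presheaf.germ U x.1 x.2 (a + b) • s x = X.presheaf.germ U x.1 x.2 a • s x + X.presheaf.germ U x.1 x.2 b • s x
    rw [map_add, add_smul]
  zero_smul s := by
    funext x
    change X.presheaf.germ U x.1 x.2 0 • s x = 0
    rw [map_zero, zero_smul]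

variable (T) in
/-- A local condition on families `(s x)`, `x ∈ U`, that is stable under the `𝒪_X`-module
operations. -/
structure LinearPredicate where
  toLocal : TopCat.LocalPredicate (X := X.carrier) T
  zero_mem : ∀ U : X.Opens, toLocal.pred (U := U) (fun x => (0 : T x))
  add_mem : ∀ (U : X.Opens) (s t : ∀ x : U, T x), toLocal.pred s → toLocal.pred t →
    toLocal.pred (U := U) (fun x => s x + t x)
  smul_mem : ∀ (U : X.Opens) (r : Γ(X, U)) (s : ∀ x : U, T x), toLocal.pred s →
    toLocal.pred (U := U) (fun x => X.presheaf.germ U x.1 x.2 r • s x)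

namespace LinearPredicate

variable (P : LinearPredicate T)

/-- The sections over `U`: the families that satisfy the condition. -/
def sections (U : X.Opens) : @Submodule Γ(X, U) (∀ x : U, T x) _ _ (sectionModule U) :=
  letI := sectionModule (T := T) U
  { carrier := {s | P.toLocal.pred s}
    zero_mem' := P.zero_mem U
    add_mem' := fun {s t} hs ht => P.add_mem U s t hs ht
    smul_mem' := fun r s hs => P.smul_mem U r s hs }

/-- The sections as a presheaf of abelian groups, with restriction of families. -/
def presheafAb : TopCat.Presheaf Ab.{u} X where
  obj U := AddCommGrpCat.of (P.sections U.unop)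
  map {U V} i := AddCommGrpCat.ofHom
    { toFun := fun s => (⟨fun x => s.1 ⟨x.1, i.unop.le x.2⟩, P.toLocal.res i.unop s.1 s.2⟩ : P.sections V.unop)
      map_zero' := rfl
      map_add' := fun _ _ => rfl }
  map_id _ := rfl
  map_comp _ _ := rfl

instance (U : X.Opensᵒᵖ) : Module (X.ringCatSheaf.obj.obj U) (P.presheafAb.obj U) :=
  letI := sectionModule (T := T) U.unop
  inferInstanceAs (Module Γ(X, U.unop) (P.sections U.unop))

/-- The sheaf of `𝒪_X`-modules of the families that satisfy the condition. -/
def toModules : X.Modules where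
  val := PresheafOfModules.ofPresheaf P.presheafAb (by
    intro _ _ f r m
    apply Subtype.ext
    funext x
    exact congrArg (fun a : X.presheaf.stalk x.1 => a • (m.1 ⟨x.1, f.unop.le x.2⟩ : T x.1))
      (X.presheaf.germ_res_apply f.unop x.1 x.2 r).symm)
  isSheaf := (TopCat.Presheaf.isSheaf_iff_isSheaf_comp (forget Ab.{u}) P.presheafAb).mpr
    (TopCat.subpresheafToTypes.isSheaf P.toLocal)

end LinearPredicate
end Pred

section Divisors
open Order

/-- A scheme is normal if all of its local rings are integrally closed domains. -/
class IsNormal (X : Scheme.{u}) : Prop where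
  isDomain : ∀ x : X, IsDomain (X.presheaf.stalk x)
  isIntegrallyClosed : ∀ x : X, IsIntegrallyClosed (X.presheaf.stalk x)

lemma isDiscreteValuationRing_stalk (X : Scheme.{u}) [IsIntegral X] [IsLocallyNoetherian X]
    [IsNormal X] (x : X) (hx : coheight x = 1) :
    IsDiscreteValuationRing (X.presheaf.stalk x) := by
  have : Ring.KrullDimLE 1 (X.presheaf.stalk x) := krullDimLE_of_coheight_le hx.le
  have := IsNormal.isIntegrallyClosed x
  have hdim := ringKrullDim_stalk_eq_coheight x
  have hnf : ¬ IsField (X.presheaf.stalk x) := by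
    intro h
    rw [ringKrullDim_eq_zero_of_isField h, hx] at hdim
    exact absurd hdim (by decide)
  have hm := (IsLocalRing.isField_iff_maximalIdeal_eq.not.mp hnf)
  have key := (IsDiscreteValuationRing.TFAE (X.presheaf.stalk x) hnf).out 0 3 (by rfl) (by rfl)
  exact key.mpr ⟨inferInstance, IsLocalRing.maximalIdeal _, ⟨hm, inferInstance⟩, fun P hP =>
      IsLocalRing.eq_maximalIdeal (Ideal.IsPrime.isMaximal_of_ne_bot hP.2 hP.1)⟩

/-- Weil divisors: locally finite integral combinations of points of codimension one (of their
closures, the prime divisors). -/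
def WeilDivisor (X : Scheme.{u}) : AddSubgroup (AlgebraicCycle X ℤ) where
  carrier := {D | ∀ x, coheight x ≠ 1 → D x = 0}
  zero_mem' _ _ := rfl
  add_mem' {D E} hD hE x hx := by
    simp [hD x hx, hE x hx]
  neg_mem' {D} hD x hx := by
    simp [hD x hx]

variable (X : Scheme.{u}) [IsIntegral X] [IsLocallyNoetherian X]

/-- `s` is a rational function `f` with `f = 0` or `div f + D ≥ 0` on `U`. -/
def divisorPrelocal (D : WeilDivisor X) :
    TopCat.PrelocalPredicate (X := X.carrier) (fun _ => X.functionField) where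
  pred {U} s := ∃ f : X.functionField, (∀ x, s x = f) ∧
    (f ≠ 0 → ∀ x ∈ U, coheight x = 1 → 0 ≤ Scheme.ord f x + D.1 x)
  res := by
    rintro U V i s ⟨f, hs, hf⟩
    exact ⟨f, fun x => hs _, fun h x hx => hf h x (i.le hx)⟩

variable [IsNormal X]

/-- The sheaf `𝒪_X(D)`, as a subsheaf of the constant sheaf of rational functions:
`Γ(U, 𝒪_X(D)) = {f | f = 0 or div f + D ≥ 0 on U}`. -/
def divisorSheaf (D : WeilDivisor X) : X.Modules :=
  LinearPredicate.toModules (T := fun _ : X => (X.functionField : Type u))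
  { toLocal := (divisorPrelocal X D).sheafify
    zero_mem := fun U => TopCat.PrelocalPredicate.sheafifyOf
      ⟨0, fun _ => rfl, fun h => absurd rfl h⟩
    add_mem := fun U s t hs ht => by
      refine TopCat.PrelocalPredicate.sheafify_inductionOn₂' _ _ (divisorPrelocal X D)
        (fun a b => a + b) ?_ hs ht
      rintro U V s t ⟨f, hs, hf⟩ ⟨g, ht, hg⟩
      refine ⟨f + g, fun x => congrArg₂ (· + ·) (hs ⟨x.1, x.2.1⟩) (ht ⟨x.1, x.2.2⟩), fun hfg x hx h1 => ?_⟩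
      by_cases hf0 : f = 0
      · subst hf0
        rw [zero_add] at hfg ⊢
        exact hg hfg x hx.2 h1
      by_cases hg0 : g = 0
      · subst hg0
        rw [add_zero] at hfg ⊢
        exact hf hfg x hx.1 h1
      have := isDiscreteValuationRing_stalk X x h1
      have h := Scheme.ord_add (x := x) hfg
      have h2 := hf hf0 x hx.1 h1
      have h3 := hg hg0 x hx.2 h1
      rcases min_le_iff.mp h with h | h <;> omega
    smul_mem := fun U r s hs x => by
      obtain ⟨V, hxV, i, f, hs, hf⟩ := hs x
      have : Nonempty V := ⟨⟨_, hxV⟩⟩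
      have : Nonempty U := ⟨x⟩
      refine ⟨V, hxV, i, r • f, fun y => ?_, fun h y hy h1 => ?_⟩
      · change algebraMap (X.presheaf.stalk y.1) X.functionField _ * s _ = algebraMap _ _ r * f
        rw [show s (i y) = f from hs y]
        exact congrArg (· * f) (Scheme.algebraMap_germ_eq_germToFunctionField X (i.le y.2) r)
      · have hr : r ≠ 0 := by rintro rfl; exact h (zero_smul _ _)
        have hf0 : f ≠ 0 := by rintro rfl; exact h (smul_zero _)
        have := Scheme.ord_le_smul (i.le hy) hr f
        have := hf hf0 y hy h1
        omega }

end Divisors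

section Ample
variable {X : Scheme.{u}}

/-- The section `s` of `M` over `U` trivializes `M` on `U`, that is, `r ↦ r s` is an isomorphism
from `𝒪_U` to the restriction of `M` to `U`. -/
def IsFrame {M : X.Modules} {U : X.Opens} (s : Γ(M, U)) : Prop :=
  ∀ (V : X.Opens) (h : V ≤ U),
    Function.Bijective fun r : Γ(X, V) => r • M.presheaf.map (homOfLE h).op s

/-- `M` is an invertible sheaf: locally isomorphic to `𝒪_X`. -/
def IsInvertible (M : X.Modules) : Prop :=
  ∀ x : X, ∃ U : X.Opens, x ∈ U ∧ ∃ s : Γ(M, U), IsFrame s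

/-- The open set of the points near which the global section `s` generates `M`. For an invertible
sheaf this is the usual set `X_s` where `s` does not vanish. -/
def nonvanishingLocus {M : X.Modules} (s : Γ(M, ⊤)) : X.Opens :=
  sSup {U : X.Opens | IsFrame (M.presheaf.map (homOfLE (le_top : U ≤ ⊤)).op s)}

/-- The Weil divisor `D` is ample: some positive multiple `n D` is Cartier, and the invertible sheaf
`L = 𝒪_X(n D)` is ample, which means that `X` is quasi-compact and every point lies in an affine
set `X_s` for a global section `s` of some positive tensor power of `L`. As `n D` is Cartier,
the `m`-th tensor power of `L` is `𝒪_X(m n D)`. -/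
def IsAmple [IsIntegral X] [IsLocallyNoetherian X] [IsNormal X] (D : WeilDivisor X) : Prop :=
  CompactSpace X ∧ ∃ n : ℕ, 0 < n ∧ IsInvertible (divisorSheaf X (n • D)) ∧
    ∀ x : X, ∃ m : ℕ, 0 < m ∧ ∃ s : Γ(divisorSheaf X (m • n • D), ⊤),
      x ∈ nonvanishingLocus s ∧ IsAffineOpen (nonvanishingLocus s)
end Ample

section Twist
variable {R : Type u} [CommRing R] {σ : Type*} [SetLike σ R] [AddSubgroupClass σ R]
  (𝒜 : ℕ → σ) [GradedRing 𝒜]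

/-- The homogeneous prime ideal of a point of `Proj`. -/
def primeAt (x : Proj 𝒜) : Ideal R :=
  ProjectiveSpectrum.asHomogeneousIdeal (𝒜 := 𝒜) x |>.toIdeal

instance (x : Proj 𝒜) : (primeAt 𝒜 x).IsPrime := ProjectiveSpectrum.isPrime (𝒜 := 𝒜) x

/-- The (full) localization of the graded ring at the prime ideal of a point. -/
abbrev LocalizedAt (x : Proj 𝒜) : Type u := Localization.AtPrime (primeAt 𝒜 x)

/-- The local ring of `Proj` at `x`, as the degree zero part of the localization. -/
def stalkToLocalization (x : Proj 𝒜) : (Proj 𝒜).presheaf.stalk x →+* LocalizedAt 𝒜 x :=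
  (algebraMap (HomogeneousLocalization.AtPrime 𝒜 (primeAt 𝒜 x)) (LocalizedAt 𝒜 x)).comp
    (Proj.stalkIso 𝒜 x).hom.hom

instance (x : Proj 𝒜) : Module ((Proj 𝒜).presheaf.stalk x) (LocalizedAt 𝒜 x) :=
  Module.compHom _ (stalkToLocalization 𝒜 x)

/-- `s` is a fraction `a / b` of homogeneous elements with `deg a = deg b + d`. -/
def twistPrelocal (d : ℕ) :
    TopCat.PrelocalPredicate (X := (Proj 𝒜).carrier) (LocalizedAt 𝒜) where
  pred {U} s := ∃ (i : ℕ) (a b : R), a ∈ 𝒜 (i + d) ∧ b ∈ 𝒜 i ∧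
    ∀ x : U, ∃ hb : b ∉ primeAt 𝒜 x.1, s x = Localization.mk a ⟨b, hb⟩
  res := by
    rintro U V i s ⟨n, a, b, ha, hb, h⟩
    exact ⟨n, a, b, ha, hb, fun x => h (i x)⟩

/-- The twisting sheaf `𝒪(d)` on `Proj`: its sections are locally homogeneous fractions of
degree `d`. -/
def serreTwist (d : ℕ) : (Proj 𝒜).Modules :=
  LinearPredicate.toModules (T := LocalizedAt 𝒜)
  { toLocal := (twistPrelocal 𝒜 d).sheafify
    zero_mem := fun U => TopCat.PrelocalPredicate.sheafifyOf
      ⟨0, 0, 1, zero_mem _, SetLike.GradedOne.one_mem, fun x =>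
        ⟨(inferInstance : (primeAt 𝒜 x.1).IsPrime).one_notMem, (Localization.mk_zero _).symm⟩⟩
    add_mem := fun U s t hs ht => by
      refine TopCat.PrelocalPredicate.sheafify_inductionOn₂' _ _ (twistPrelocal 𝒜 d)
        (fun a b => a + b) ?_ hs ht
      rintro U V s t ⟨i, a, b, ha, hb, h⟩ ⟨j, a', b', ha', hb', h'⟩
      refine ⟨i + j, b' * a + b * a', b * b', ?_, SetLike.mul_mem_graded hb hb', fun x => ?_⟩
      · have h1 := SetLike.mul_mem_graded hb' ha
        have h2 := SetLike.mul_mem_graded hb ha'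
        rw [show j + (i + d) = i + j + d by omega] at h1
        rw [show i + (j + d) = i + j + d by omega] at h2
        exact add_mem h1 h2
      · obtain ⟨hb1, e1⟩ := h ⟨x.1, x.2.1⟩
        obtain ⟨hb2, e2⟩ := h' ⟨x.1, x.2.2⟩
        refine ⟨fun hm => ((inferInstance : (primeAt 𝒜 x.1).IsPrime).mem_or_mem hm).elim hb1 hb2, ?_⟩
        refine (congrArg₂ (· + ·) e1 e2).trans ?_
        rw [Localization.add_mk]
        congr 1
        simp [add_comm]
    smul_mem := fun U r s hs x => by
      obtain ⟨V, hxV, i, j, a, b, ha, hb, h⟩ := hs x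
      obtain ⟨W, hxW, i', j', ⟨a', ha'⟩, ⟨b', hb'⟩, hn, h'⟩ := r.2 x
      refine ⟨V ⊓ W, ⟨hxV, hxW⟩, homOfLE (inf_le_left.trans i.le), j' + j, a' * a, b' * b, ?_,
        SetLike.mul_mem_graded hb' hb, fun y => ?_⟩
      · have h1 := SetLike.mul_mem_graded ha' ha
        rwa [← add_assoc] at h1
      · obtain ⟨hb1, e1⟩ := h ⟨y.1, y.2.1⟩
        have e2 := h' ⟨y.1, y.2.2⟩
        refine ⟨fun hm => ((inferInstance : (primeAt 𝒜 y.1).IsPrime).mem_or_mem hm).elim (hn ⟨y.1, y.2.2⟩) hb1, ?_⟩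
        have e3 := Proj.stalkIso'_germ 𝒜 U y.1 (i.le y.2.1) r
        refine (congrArg₂ (fun (p : HomogeneousLocalization.AtPrime 𝒜 (primeAt 𝒜 y.1))
          (q : LocalizedAt 𝒜 y.1) => p.val * q) (e3.trans e2) e1).trans ?_
        exact Localization.mk_mul a' a ⟨b', hn ⟨y.1, y.2.2⟩⟩ ⟨b, hb1⟩ }

/-- The multiplicity at `x` of the closed subscheme `V₊(f)` of `Proj`, for a homogeneous element `f`:
the length of `𝒪_x / I_x`, where `I_x` consists of the elements of `𝒪_x` that are divisible by `f`
in the localization of the graded ring at `x`. -/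
def vanishingMultiplicity (f : R) (x : Proj 𝒜) : ℕ∞ :=
  Module.length ((Proj 𝒜).presheaf.stalk x) ((Proj 𝒜).presheaf.stalk x ⧸
    (Ideal.span {algebraMap R (LocalizedAt 𝒜 x) f}).comap (stalkToLocalization 𝒜 x))

/-- `B` is the effective Weil divisor `V₊(f)`: its coefficient at each point of codimension one is
the (finite) multiplicity of the closed subscheme `V₊(f)`. -/
def IsVanishingDivisor (f : R) (B : WeilDivisor (Proj 𝒜)) : Prop :=
  ∀ x : Proj 𝒜, Order.coheight x = 1 →
    ∃ m : ℕ, vanishingMultiplicity 𝒜 f x = m ∧ B.1 x = m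

end Twist

section Fibrations
open Limits
attribute [local instance] MvPolynomial.gradedAlgebra

/-- The standard grading of `R[x₀, …, xₙ]`. -/
abbrev homogeneousCoordinates (n : ℕ) (R : Type u) [CommRing R] :
    ℕ → Submodule R (MvPolynomial (Fin (n + 1)) R) :=
  MvPolynomial.homogeneousSubmodule (Fin (n + 1)) R

/-- The projective space of dimension `n` over `R`: `Proj R[x₀, …, xₙ]`. -/
def ProjectiveSpace (n : ℕ) (R : Type u) [CommRing R] : Scheme.{u} :=
  Proj (homogeneousCoordinates n R)

/-- The structure morphism of projective space. -/
def ProjectiveSpace.toSpec (n : ℕ) (R : Type u) [CommRing R] :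
    ProjectiveSpace n R ⟶ Spec (.of R) :=
  Proj.toSpecZero (homogeneousCoordinates n R) ≫
    Spec.map (CommRingCat.ofHom (algebraMap R (homogeneousCoordinates n R 0)))

/-- The sheaf `𝒪(d)` on projective space. -/
def ProjectiveSpace.twist (n : ℕ) (R : Type u) [CommRing R] (d : ℕ) :
    (ProjectiveSpace n R).Modules :=
  serreTwist (homogeneousCoordinates n R) d

variable {Y : Scheme.{u}} {R : Type u} [CommRing R] (f : Y ⟶ Spec (.of R))

/-- A morphism to an affine scheme `Spec R` is projective if it factors as a closed immersion into
some projective space over `R` followed by the structure morphism. -/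
def IsProjective : Prop :=
  ∃ (n : ℕ) (i : Y ⟶ ProjectiveSpace n R),
    IsClosedImmersion i ∧ i ≫ ProjectiveSpace.toSpec n R = f

variable [IsDomain R]

/-- The fiber of `f` over the generic point of the integral affine scheme `Spec R`, whose function
field is the field of fractions of `R`. -/
def genericFiber : Scheme.{u} :=
  pullback f (Spec.map (CommRingCat.ofHom (algebraMap R (FractionRing R))))

/-- The projection of the generic fiber to the total space. -/
def genericFiber.ι : genericFiber f ⟶ Y := pullback.fst _ _

/-- The generic fiber is a scheme over the function field of the base. -/
def genericFiber.toSpec : genericFiber f ⟶ Spec (.of (FractionRing R)) := pullback.snd _ _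

/-- A `ℙ¹`-fibration: a surjective projective morphism of finite type whose generic fiber is
isomorphic, over the function field of the base, to the projective line. -/
structure IsP1Fibration : Prop where
  surjective : Surjective f
  projective : IsProjective f
  locallyOfFiniteType : LocallyOfFiniteType f
  quasiCompact : QuasiCompact f
  genericFiber : ∃ e : genericFiber f ≅ ProjectiveSpace 1 (FractionRing R),
    e.hom ≫ ProjectiveSpace.toSpec 1 (FractionRing R) = genericFiber.toSpec f

/-- A `k`-variety: an integral separated scheme of finite type over `k`. -/
structure IsVariety {k : Type u} [Field k] {X : Scheme.{u}} (p : X ⟶ Spec (.of k)) : Prop where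
  isIntegral : IsIntegral X
  isSeparated : IsSeparated p
  locallyOfFiniteType : LocallyOfFiniteType p
  quasiCompact : QuasiCompact p

end Fibrations

section Rees
open Polynomial
variable {k A : Type u} [Field k] [CommRing A] [Algebra k A] (δ : Derivation k A A)

/-- Every element is killed by some iterate of the derivation. -/
def IsLocallyNilpotent : Prop := ∀ a : A, ∃ n : ℕ, δ^[n] a = 0

/-- The ring of invariants `A₀`, the kernel of the derivation. -/
def kernel : Subalgebra k A where
  carrier := {a | δ a = 0}
  mul_mem' {a b} ha hb := by
    simp only [Set.mem_ofPred_eq] at *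
    simp [ha, hb]
  add_mem' {a b} ha hb := by
    simp only [Set.mem_ofPred_eq] at *
    simp [ha, hb]
  algebraMap_mem' r := by simp

/-- `Fₙ`, the kernel of the iterate `δ^(n+1)`. -/
def degreeModule (n : ℕ) : Submodule k A := LinearMap.ker (δ.toLinearMap ^ (n + 1))

lemma iterate_mul_eq_zero (N : ℕ) : ∀ (m n : ℕ) (a b : A), m + n ≤ N + 1 →
    (δ.toLinearMap ^ m) a = 0 → (δ.toLinearMap ^ n) b = 0 → (δ.toLinearMap ^ N) (a * b) = 0 := by
  induction N with
  | zero =>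
    intro m n a b h ha hb
    rcases Nat.eq_zero_or_pos m with rfl | hm
    · have : a = 0 := by simpa using ha
      simp [this]
    · obtain rfl : n = 0 := by omega
      have : b = 0 := by simpa using hb
      simp [this]
  | succ N ih =>
    intro m n a b h ha hb
    rcases m with _ | m
    · have : a = 0 := by simpa using ha
      simp [this]
    rcases n with _ | n
    · have : b = 0 := by simpa using hb
      simp [this]
    have e : δ.toLinearMap (a * b) = a * δ b + b * δ a := by simp
    rw [pow_succ, Module.End.mul_apply, e, map_add,
      ih (m + 1) n a (δ b) (by omega) ha (by rw [pow_succ] at hb; exact hb),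
      ih (n + 1) m b (δ a) (by omega) hb (by rw [pow_succ] at ha; exact ha), add_zero]

lemma mul_mem_degreeModule {m n : ℕ} {a b : A} (ha : a ∈ degreeModule δ m)
    (hb : b ∈ degreeModule δ n) : a * b ∈ degreeModule δ (m + n) :=
  iterate_mul_eq_zero δ (m + n + 1) (m + 1) (n + 1) a b (by omega) ha hb

lemma mem_degreeModule_of_mem_kernel {a : A} (ha : a ∈ kernel δ) (n : ℕ) :
    a ∈ degreeModule δ n := by
  change (δ.toLinearMap ^ (n + 1)) a = 0
  rw [pow_succ, Module.End.mul_apply]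
  exact (congrArg _ (show δ a = 0 from ha)).trans (map_zero _)

/-- The Rees algebra: the polynomials `∑ aₙ υⁿ` with `aₙ` in `Fₙ` for all `n`. -/
def reesAlgebra : Subalgebra k A[X] where
  carrier := {p | ∀ n, p.coeff n ∈ degreeModule δ n}
  mul_mem' {p q} hp hq n := by
    rw [coeff_mul]
    refine Submodule.sum_mem _ fun ij hij => ?_
    rw [← Finset.HasAntidiagonal.mem_antidiagonal.mp hij]
    exact mul_mem_degreeModule δ (hp _) (hq _)
  add_mem' {p q} hp hq n := by
    rw [coeff_add]
    exact Submodule.add_mem _ (hp n) (hq n)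
  algebraMap_mem' r n := by
    rw [show algebraMap k A[X] r = C (algebraMap k A r) from rfl, coeff_C]
    split
    · exact mem_degreeModule_of_mem_kernel δ ((kernel δ).algebraMap_mem r) n
    · exact Submodule.zero_mem _

/-- The homogeneous piece `Fₙ υⁿ` of degree `n` of the Rees algebra. -/
def reesGrading (n : ℕ) : Submodule k (reesAlgebra δ) where
  carrier := {p | ∀ m, m ≠ n → p.1.coeff m = 0}
  zero_mem' m _ := by simp
  add_mem' {p q} hp hq m hm := by simp [hp m hm, hq m hm]
  smul_mem' c p hp m hm := by simp [hp m hm]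

/-- The component `aₙ υⁿ` of an element of the Rees algebra. -/
def reesComponent (n : ℕ) (p : reesAlgebra δ) : reesGrading δ n :=
  ⟨⟨monomial n (p.1.coeff n), fun m => by
    rw [coeff_monomial]
    split
    · next h => exact h ▸ p.2 n
    · exact Submodule.zero_mem _⟩, fun m hm => by
    simp [coeff_monomial, hm.symm]⟩

lemma coeff_coeAddMonoidHom (x : DirectSum ℕ fun i => reesGrading δ i) (m : ℕ) :
    (DirectSum.coeAddMonoidHom (reesGrading δ) x).1.coeff m = (x m).1.1.coeff m := by
  induction x using DirectSum.induction_on with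
  | zero => simp
  | of i x =>
    rw [DirectSum.coeAddMonoidHom_of]
    by_cases h : i = m
    · subst h; simp
    · rw [DirectSum.of_eq_of_ne _ _ _ (Ne.symm h), x.2 m (Ne.symm h)]; simp
  | add x y hx hy => simp [hx, hy]

instance reesGradedAlgebra : GradedAlgebra (reesGrading δ) where
  one_mem m hm := by simp [coeff_one, hm]
  mul_mem {i j p q} hp hq m hm := by
    change (p.1 * q.1).coeff m = 0
    rw [coeff_mul]
    refine Finset.sum_eq_zero fun ab hab => ?_
    by_cases h : ab.1 = i
    · have : ab.2 ≠ j := by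
        rintro rfl; exact hm ((Finset.HasAntidiagonal.mem_antidiagonal.mp hab).symm.trans (by rw [h]))
      rw [hq _ this, mul_zero]
    · rw [hp _ h, zero_mul]
  decompose' p := DirectSum.mk _ p.1.support fun n => reesComponent δ n p
  left_inv p := by
    apply Subtype.ext
    ext m
    rw [coeff_coeAddMonoidHom]
    by_cases h : m ∈ p.1.support
    · rw [DirectSum.mk_apply_of_mem h]; simp [reesComponent]
    · rw [DirectSum.mk_apply_of_notMem h]; simpa using (notMem_support_iff.mp h).symm
  right_inv x := by
    refine DFinsupp.ext fun m => Subtype.ext (Subtype.ext ?_)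
    ext j
    by_cases hj : j = m
    · subst hj
      by_cases h : j ∈ (DirectSum.coeAddMonoidHom (reesGrading δ) x).1.support
      · rw [DirectSum.mk_apply_of_mem h]
        simp [reesComponent, coeff_coeAddMonoidHom]
      · rw [DirectSum.mk_apply_of_notMem h]
        rw [notMem_support_iff, coeff_coeAddMonoidHom] at h
        simpa using h.symm
    · rw [(x m).2 j hj]
      exact Subtype.property (p := fun p => p ∈ reesGrading δ m) _ j hj

/-- The element `υ` of degree one of the Rees algebra. -/
def upsilon : reesAlgebra δ :=
  ⟨X, fun n => by
    rw [coeff_X]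
    split
    · exact mem_degreeModule_of_mem_kernel δ (kernel δ).one_mem n
    · exact Submodule.zero_mem _⟩

/-- `A₀` as the degree zero part of the Rees algebra. -/
def kernelToDegreeZero : kernel δ →+* reesGrading δ 0 where
  toFun a := ⟨⟨C a.1, fun n => by
    rw [coeff_C]
    split
    · exact mem_degreeModule_of_mem_kernel δ a.2 n
    · exact Submodule.zero_mem _⟩, fun m hm => by simp [coeff_C, hm]⟩
  map_zero' := Subtype.ext (Subtype.ext C_0)
  map_one' := Subtype.ext (Subtype.ext C_1)
  map_add' a b := Subtype.ext (Subtype.ext C_add)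
  map_mul' a b := Subtype.ext (Subtype.ext C_mul)

/-- `Y₀ = Spec A₀`. -/
def quotientVariety : Scheme.{u} := Spec (.of (kernel δ))

def quotientVariety.structureMorphism : quotientVariety δ ⟶ Spec (.of k) :=
  Spec.map (CommRingCat.ofHom (algebraMap k (kernel δ)))

/-- `Y = Proj` of the Rees algebra. -/
def reesProj : Scheme.{u} := Proj (reesGrading δ)

/-- The structure morphism `π : Y → Y₀`. -/
def reesProj.π : reesProj δ ⟶ Spec (.of (kernel δ)) :=
  Proj.toSpecZero (reesGrading δ) ≫ Spec.map (CommRingCat.ofHom (kernelToDegreeZero δ))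

end Rees
end

end ReesFibration

open ReesFibration

open CategoryTheory AlgebraicGeometry TopologicalSpace Opposite

/-! Local nilpotence yields a local slice `s`: an element with `t = δ s ≠ 0` and `δ t = 0`. In
characteristic zero, `n! tⁿ a - δⁿ(a) sⁿ` lies in `Fₙ₋₁` for `a ∈ Fₙ` and `n ≥ 1`, so over `K = Frac
A₀` the space `Fₙ ⊗ K` has the basis `1, s, …, sⁿ`. Hence `R ⊗ K = K[sυ, υ]` is a polynomial ring in
two variables of degree one, and the generic fiber of `Y` is the projective line. The algebraic form
of this is `nonempty_trivialization`, the geometric one `isPullback_lineMap`.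

The modules `Fₙ` are saturated: `c a ∈ Fₙ` with `0 ≠ c ∈ A₀` implies `a ∈ Fₙ`. So `R` is the
intersection of the normal rings `A[υ]` and `K[sυ, υ]`, hence normal, and so are the degree zero
parts of its localizations, the local rings of `Y`. Saturation also shows that `υ` is prime in `R`,
because it is prime in `K[sυ, υ]`. Thus `B = V₊(υ)` is a single prime divisor of multiplicity one,
with local equation `υ / (sυ)` at its generic point.

On a normal scheme a function without poles in codimension one is regular (`exists_section`).
Therefore `f / υⁿ` with `f ∈ Fₙυⁿ` trivializes `𝒪(nB)` on `D₊(f)`. Finite generation of `R` gives `n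
> 0` for which such `f` have no common zero, and then `nB` is Cartier and ample. Whether `B` itself
is Cartier everywhere is left open, but it is so on `D₊(sυ) ∪ D₊(υ)`, which contains the generic
fiber. There the frames have the transition functions of `𝒪(1)`, and frames over sets that cover the
fiber suffice (`nonempty_pullback_iso_of_frames`).

For projectivity, suitable elements of one large degree define a morphism from `Y` to a projective
space over `A₀`. It is surjective on chart rings and it is proper, hence a closed immersion. -/

namespace ReesFibration

/-! ### Morphisms and pullbacks of modules from frames and transition functions -/

section Frames
open Scheme.Modules
variable {Y : Scheme.{u}}

/-- Restriction of sections of a sheaf of modules. -/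
noncomputable def res (M : Y.Modules) {U V : Y.Opens} (h : V ≤ U) : Γ(M, U) →+ Γ(M, V) :=
  (M.presheaf.map (homOfLE h).op).hom

/-- Restriction of functions. -/
noncomputable def resO {U V : Y.Opens} (h : V ≤ U) : Γ(Y, U) →+* Γ(Y, V) :=
  (Y.presheaf.map (homOfLE h).op).hom

lemma res_res (M : Y.Modules) {U V W : Y.Opens} (h : V ≤ U) (h' : W ≤ V) (s : Γ(M, U)) :
    res M h' (res M h s) = res M (h'.trans h) s := by
  change (M.presheaf.map (homOfLE h).op ≫ M.presheaf.map (homOfLE h').op).hom s = _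
  rw [← Functor.map_comp]
  rfl

lemma res_smul (M : Y.Modules) {U V : Y.Opens} (h : V ≤ U) (r : Γ(Y, U)) (s : Γ(M, U)) :
    res M h (r • s) = resO h r • res M h s :=
  Scheme.Modules.map_smul M (homOfLE h) r s

lemma app_res {M N : Y.Modules} (φ : M ⟶ N) {U V : Y.Opens} (h : V ≤ U) (s : Γ(M, U)) :
    φ.app V (res M h s) = res N h (φ.app U s) :=
  congrArg (fun f => f.hom s) (φ.mapPresheaf.naturality (homOfLE h).op)

lemma IsFrame.exists_smul {M : Y.Modules} {U : Y.Opens} {s : Γ(M, U)} (hs : IsFrame s)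
    {V : Y.Opens} (h : V ≤ U) (m : Γ(M, V)) : ∃ r : Γ(Y, V), r • res M h s = m :=
  (hs V h).2 m

lemma IsFrame.smul_inj {M : Y.Modules} {U : Y.Opens} {s : Γ(M, U)} (hs : IsFrame s)
    {V : Y.Opens} (h : V ≤ U) {r r' : Γ(Y, V)} (e : r • res M h s = r' • res M h s) : r = r' :=
  (hs V h).1 e

/-- Sections over any open set `V` glue uniquely along the sets `V ∩ U i`. -/
def GluesAlong {ι : Type*} (N : Y.Modules) (U : ι → Y.Opens) : Prop :=
  ∀ (V : Y.Opens) (f : ∀ i, Γ(N, V ⊓ U i)),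
    (∀ i j, res N (inf_le_inf_left V inf_le_left : V ⊓ (U i ⊓ U j) ≤ V ⊓ U i) (f i) =
      res N (inf_le_inf_left V inf_le_right) (f j)) →
    ∃! s : Γ(N, V), ∀ i, res N inf_le_left s = f i

lemma gluesAlong_of_cover {ι : Type*} (N : Y.Modules) (U : ι → Y.Opens) (hU : ⨆ i, U i = ⊤) :
    GluesAlong N U := by
  intro V f hf
  refine TopCat.Sheaf.existsUnique_gluing' ⟨N.presheaf, N.isSheaf⟩ (fun i => V ⊓ U i) V
    (fun i => homOfLE inf_le_left) ?_ f ?_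
  · rw [← inf_iSup_eq, hU, inf_top_eq]
  · intro i j
    have h := congrArg (res N (show (V ⊓ U i) ⊓ (V ⊓ U j) ≤ V ⊓ (U i ⊓ U j) from
      le_inf (inf_le_left.trans inf_le_left) (inf_le_inf inf_le_right inf_le_right))) (hf i j)
    rw [res_res, res_res] at h
    exact h

/-- Only the preimages of the `U i` have to cover `X`; the `U i` may miss part of `Y`. This admits
modules on `Y` that have frames only near the image of `X`. -/
lemma gluesAlong_pushforward {X : Scheme.{u}} (j : X ⟶ Y) {ι : Type*} (N : X.Modules)
    (U : ι → Y.Opens) (hU : ⨆ i, j ⁻¹ᵁ U i = ⊤) :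
    GluesAlong ((pushforward j).obj N) U := by
  intro V f hf
  exact gluesAlong_of_cover N (fun i => j ⁻¹ᵁ U i) hU (j ⁻¹ᵁ V) f hf

variable {ι : Type*} {M N : Y.Modules} {U : ι → Y.Opens} {s : ∀ i, Γ(M, U i)}
  {n : ∀ i, Γ(N, U i)}

/-- The families `s` and `n` have the same transition functions. -/
def SameTransition {Z : Scheme.{u}} {M N : Z.Modules} {U : ι → Z.Opens} (s : ∀ i, Γ(M, U i))
    (n : ∀ i, Γ(N, U i)) : Prop :=
  ∀ i j, ∃ c : Γ(Z, U i ⊓ U j), res M inf_le_left (s i) = c • res M inf_le_right (s j) ∧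
    res N inf_le_left (n i) = c • res N inf_le_right (n j)

/-- Write `m = r i • s i` on `V ∩ U i`. The sections `r i • n i` agree on overlaps because both
families have the same transition functions, so they glue. -/
lemma existsUnique_image (hs : ∀ i, IsFrame (s i)) (hN : GluesAlong N U)
    (hsn : SameTransition s n) (V : Y.Opens) (m : Γ(M, V)) :
    ∃! x : Γ(N, V), ∀ i (r : Γ(Y, V ⊓ U i)), res M inf_le_left m = r • res M inf_le_right (s i) →
      res N inf_le_left x = r • res N inf_le_right (n i) := by
  choose r hr using fun i => (hs i).exists_smul (V := V ⊓ U i) inf_le_right (res M inf_le_left m)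
  obtain ⟨x, hx, hx'⟩ := hN V (fun i => r i • res N inf_le_right (n i)) (by
    intro i j
    obtain ⟨c, hc, hc'⟩ := hsn i j
    have hi := congrArg (res M (inf_le_inf_left V inf_le_left : V ⊓ (U i ⊓ U j) ≤ V ⊓ U i)) (hr i)
    have hj := congrArg (res M (inf_le_inf_left V inf_le_right : V ⊓ (U i ⊓ U j) ≤ V ⊓ U j)) (hr j)
    have e := congrArg (res M (inf_le_right : V ⊓ (U i ⊓ U j) ≤ U i ⊓ U j)) hc
    have e' := congrArg (res N (inf_le_right : V ⊓ (U i ⊓ U j) ≤ U i ⊓ U j)) hc'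
    simp only [res_smul, res_res] at hi hj e e' ⊢
    rw [e']
    rw [e, ← hj, smul_smul] at hi
    rw [smul_smul]
    exact congrArg (· • _) ((hs j).smul_inj _ hi))
  refine ⟨x, fun i r' h => ?_, fun y hy => hx' y fun i => hy i (r i) (hr i).symm⟩
  rw [hx i]
  exact congrArg (· • _) ((hs i).smul_inj inf_le_right ((hr i).trans h))

/-- The homomorphism that takes the frames `s i` to the sections `n i`. -/
lemma exists_hom_of_frames (hs : ∀ i, IsFrame (s i)) (hN : GluesAlong N U)
    (hsn : SameTransition s n) : ∃ φ : M ⟶ N, ∀ i, φ.app (U i) (s i) = n i := by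
  choose F hF hF' using fun V m => existsUnique_image hs hN hsn V m
  have hex : ∀ (V : Y.Opens) (m : Γ(M, V)) i, ∃ r : Γ(Y, V ⊓ U i),
      res M inf_le_left m = r • res M inf_le_right (s i) := fun V m i => by
    obtain ⟨r, hr⟩ := (hs i).exists_smul (V := V ⊓ U i) inf_le_right (res M inf_le_left m)
    exact ⟨r, hr.symm⟩
  -- Having the coefficients of `m` along the frames characterizes the image of `m`; additivity,
  -- linearity and naturality all follow by comparing coefficients.
  have key : ∀ (V : Y.Opens) (m : Γ(M, V)) (x : Γ(N, V)),
      (∀ i, ∃ r : Γ(Y, V ⊓ U i), res M inf_le_left m = r • res M inf_le_right (s i) ∧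
        res N inf_le_left x = r • res N inf_le_right (n i)) → x = F V m := by
    intro V m x h
    refine hF' V m x fun i r hr => ?_
    obtain ⟨r', h1, h2⟩ := h i
    rw [h2]
    exact congrArg (· • _) ((hs i).smul_inj inf_le_right (h1.symm.trans hr))
  have hadd : ∀ V m m', F V (m + m') = F V m + F V m' := by
    intro V m m'
    refine (key V _ _ fun i => ?_).symm
    obtain ⟨r, hr⟩ := hex V m i
    obtain ⟨r', hr'⟩ := hex V m' i
    refine ⟨r + r', ?_, ?_⟩
    · rw [map_add, hr, hr', add_smul]
    · rw [map_add, hF V m i r hr, hF V m' i r' hr', add_smul]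
  have hsmul : ∀ V (a : Γ(Y, V)) m, F V (a • m) = a • F V m := by
    intro V a m
    refine (key V _ _ fun i => ?_).symm
    obtain ⟨r, hr⟩ := hex V m i
    refine ⟨resO inf_le_left a * r, ?_, ?_⟩
    · rw [res_smul, hr, smul_smul]
    · rw [res_smul, hF V m i r hr, smul_smul]
  have hnat : ∀ {V W : Y.Opens} (h : W ≤ V) m, F W (res M h m) = res N h (F V m) := by
    intro V W h m
    refine (key W _ _ fun i => ?_).symm
    obtain ⟨r, hr⟩ := hex V m i
    have e := congrArg (res M (inf_le_inf_right (U i) h)) hr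
    have e' := congrArg (res N (inf_le_inf_right (U i) h)) (hF V m i r hr)
    simp only [res_smul, res_res] at e e' ⊢
    exact ⟨_, e, e'⟩
  let ψ : M.presheaf ⟶ N.presheaf :=
    { app V := AddCommGrpCat.ofHom (AddMonoidHom.mk' (F V.unop) (hadd V.unop))
      naturality V W f := by
        ext m
        exact hnat f.unop.le m }
  refine ⟨⟨PresheafOfModules.homMk ψ fun V r m => hsmul V.unop r m⟩, fun i => ?_⟩
  refine (key (U i) (s i) (n i) fun j => ?_).symm
  obtain ⟨c, h, h'⟩ := hsn i j
  exact ⟨c, h, h'⟩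

lemma hom_ext_of_frames (hs : ∀ i, IsFrame (s i)) (hN : GluesAlong N U) {φ ψ : M ⟶ N}
    (h : ∀ i, φ.app (U i) (s i) = ψ.app (U i) (s i)) : φ = ψ := by
  refine Scheme.Modules.hom_ext _ _ fun V => ?_
  ext m
  refine (hN V (fun i => res N inf_le_left (φ.app V m)) fun i j => ?_).unique (fun i => rfl)
    fun i => ?_
  · rw [res_res, res_res]
  · obtain ⟨r, hr⟩ := (hs i).exists_smul (V := V ⊓ U i) inf_le_right (res M inf_le_left m)
    rw [← app_res, ← app_res, ← hr, Scheme.Modules.Hom.app_smul, Scheme.Modules.Hom.app_smul,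
      app_res, app_res, h]

/-- Two modules, on `Y` and on `X`, with frames that have the same transition functions, over
sets whose preimages cover `X`: the second one is the pullback of the first one. -/
lemma nonempty_pullback_iso_of_frames {X : Scheme.{u}} (j : X ⟶ Y) (L : X.Modules)
    (hU : ⨆ i, j ⁻¹ᵁ U i = ⊤) (hs : ∀ i, IsFrame (s i)) (t : ∀ i, Γ(L, j ⁻¹ᵁ U i))
    (ht : ∀ i, IsFrame (t i)) (hst : SameTransition (N := (pushforward j).obj L) s t) :
    Nonempty ((Scheme.Modules.pullback j).obj M ≅ L) := by
  obtain ⟨u, hu⟩ := exists_hom_of_frames (N := (pushforward j).obj L) hs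
    (gluesAlong_pushforward j L U hU) hst
  let adj := pullbackPushforwardAdjunction j
  let P := (Scheme.Modules.pullback j).obj M
  let η : M ⟶ (pushforward j).obj P := adj.unit.app M
  let p : ∀ i, Γ(P, j ⁻¹ᵁ U i) := fun i => η.app (U i) (s i)
  have htp : SameTransition t p := by
    intro i k
    obtain ⟨c, h, h'⟩ := hst i k
    refine ⟨(j.app (U i ⊓ U k)).hom c, h', ?_⟩
    have := congrArg (η.app (U i ⊓ U k)) h
    rw [Scheme.Modules.Hom.app_smul, app_res, app_res] at this
    exact this
  obtain ⟨w, hw⟩ := exists_hom_of_frames ht (gluesAlong_of_cover P _ hU) htp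
  let v : P ⟶ L := (adj.homEquiv M L).symm u
  have hv : η ≫ (pushforward j).map v = u := by
    have := (adj.homEquiv M L).apply_symm_apply u
    rwa [Adjunction.homEquiv_unit] at this
  have hvp : ∀ i, v.app (j ⁻¹ᵁ U i) (p i) = t i := fun i => by
    rw [← hu i, ← hv]
    rfl
  refine ⟨⟨v, w, ?_, ?_⟩⟩
  -- By adjunction, endomorphisms of the pullback become maps `M ⟶ j_* P`. The frames `s i`
  -- determine these even where the `U i` do not cover `Y`, since `j_* P` glues along the `U i`.
  · apply (adj.homEquiv M P).injective
    rw [Adjunction.homEquiv_unit, Adjunction.homEquiv_unit]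
    refine hom_ext_of_frames hs (gluesAlong_pushforward j P U hU) fun i => ?_
    change w.app (j ⁻¹ᵁ U i) (v.app (j ⁻¹ᵁ U i) (p i)) = p i
    rw [hvp, hw]
  · refine hom_ext_of_frames ht (gluesAlong_of_cover L _ hU) fun i => ?_
    change v.app (j ⁻¹ᵁ U i) (w.app (j ⁻¹ᵁ U i) (t i)) = t i
    rw [hw, hvp]

end Frames

/-! ### Local slices and the filtration by kernels of iterates -/

section Derivation
open Polynomial
variable {k A : Type u} [Field k] [CommRing A] [Algebra k A] {δ : Derivation k A A}

lemma pow_kernel_mul {c : A} (hc : c ∈ kernel δ) (n : ℕ) (a : A) :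
    (δ.toLinearMap ^ n) (c * a) = c * (δ.toLinearMap ^ n) a := by
  induction n generalizing a with
  | zero => simp
  | succ n ih =>
    have : δ c = 0 := hc
    rw [pow_succ, Module.End.mul_apply, Module.End.mul_apply]
    have e : δ.toLinearMap (c * a) = c * δ.toLinearMap a := by
      change δ (c * a) = c * δ a
      simp [this]
    rw [e, ih]

lemma mem_degreeModule_iff {n : ℕ} {a : A} :
    a ∈ degreeModule δ n ↔ (δ.toLinearMap ^ (n + 1)) a = 0 := Iff.rfl

lemma mem_degreeModule_zero {a : A} : a ∈ degreeModule δ 0 ↔ a ∈ kernel δ := by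
  rw [mem_degreeModule_iff, zero_add, pow_one]
  rfl

lemma pow_mem_kernel {n : ℕ} {a : A} (ha : a ∈ degreeModule δ n) :
    (δ.toLinearMap ^ n) a ∈ kernel δ := by
  rw [mem_degreeModule_iff, pow_succ', Module.End.mul_apply] at ha
  exact ha

/-- Iterates of `δ` are linear over the invariants, and `A` is a domain. This saturation property
carries the normality of the Rees algebra and the primality of `υ`. -/
lemma mem_of_kernel_mul_mem [IsDomain A] {n : ℕ} {a c : A} (hc : c ∈ kernel δ) (hc0 : c ≠ 0)
    (ha : c * a ∈ degreeModule δ n) : a ∈ degreeModule δ n := by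
  rw [mem_degreeModule_iff] at *
  rw [pow_kernel_mul hc] at ha
  exact (mul_eq_zero.mp ha).resolve_left hc0

/-- If `δ a ≠ 0` and `n + 2` is the least number of iterations that kill `a`, then `δⁿ a` is killed
by exactly two. -/
lemma exists_slice (hδ : IsLocallyNilpotent δ) (hδ0 : δ ≠ 0) :
    ∃ s, δ s ≠ 0 ∧ δ (δ s) = 0 := by
  classical
  obtain ⟨a, ha⟩ : ∃ a, δ a ≠ 0 := by
    by_contra! h
    exact hδ0 (Derivation.ext h)
  have hex := hδ a
  obtain ⟨n, hn⟩ : ∃ n, Nat.find hex = n + 2 := by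
    refine ⟨Nat.find hex - 2, ?_⟩
    have h0 : Nat.find hex ≠ 0 := fun h => by
      have := Nat.find_spec hex
      rw [h] at this
      exact ha ((congrArg δ this).trans (map_zero δ))
    have h1 : Nat.find hex ≠ 1 := fun h => by
      have := Nat.find_spec hex
      rw [h] at this
      exact ha this
    omega
  refine ⟨δ^[n] a, ?_, ?_⟩
  · have := Nat.find_min hex (m := n + 1) (by omega)
    rwa [Function.iterate_succ_apply'] at this
  · have := Nat.find_spec hex
    rwa [hn, Function.iterate_succ_apply', Function.iterate_succ_apply'] at this

variable {s : A} (hs : δ (δ s) = 0)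
include hs

lemma slice_mem : s ∈ degreeModule δ 1 := by
  rw [mem_degreeModule_iff, pow_succ, pow_one]
  exact hs

lemma slice_pow_mem (n : ℕ) : s ^ n ∈ degreeModule δ n := by
  induction n with
  | zero => rw [pow_zero, mem_degreeModule_zero]; exact (kernel δ).one_mem
  | succ n ih => rw [pow_succ]; exact mul_mem_degreeModule δ ih (slice_mem hs)

lemma pow_slice_pow (n : ℕ) : (δ.toLinearMap ^ n) (s ^ n) = (n.factorial : A) * δ s ^ n := by
  induction n with
  | zero => simp
  | succ n ih =>
    have h1 : ((n + 1 : ℕ) : A) * δ s ∈ kernel δ :=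
      (kernel δ).mul_mem ((kernel δ).natCast_mem _) hs
    rw [pow_succ, Module.End.mul_apply]
    have e : δ.toLinearMap (s ^ (n + 1)) = (((n + 1 : ℕ) : A) * δ s) * s ^ n := by
      change δ (s ^ (n + 1)) = _
      rw [Derivation.leibniz_pow]
      simp only [Nat.add_sub_cancel, nsmul_eq_mul, smul_eq_mul]
      ring
    rw [e, pow_kernel_mul h1, ih, Nat.factorial_succ]
    push_cast
    ring

end Derivation

/-! ### The Rees algebra compared with a polynomial ring over the invariants -/

section Rees
open Polynomial
variable {k A : Type u} [Field k] [CommRing A] [Algebra k A] {δ : Derivation k A A}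

/-- The element `a υⁿ` of the Rees algebra. -/
noncomputable def reesMonomial (n : ℕ) (a : A) (ha : a ∈ degreeModule δ n) : reesAlgebra δ :=
  ⟨monomial n a, fun m => by
    rw [coeff_monomial]
    split
    · next h => exact h ▸ ha
    · exact Submodule.zero_mem _⟩

lemma reesMonomial_mem (n : ℕ) (a : A) (ha : a ∈ degreeModule δ n) :
    reesMonomial n a ha ∈ reesGrading δ n := fun m hm => by
  change (monomial n a).coeff m = 0
  simp [coeff_monomial, hm.symm]

lemma exists_eq_reesMonomial {n : ℕ} {r : reesAlgebra δ} (hr : r ∈ reesGrading δ n) :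
    ∃ a ha, r = reesMonomial n a ha := by
  refine ⟨r.1.coeff n, r.2 n, Subtype.ext ?_⟩
  change r.1 = monomial n _
  ext m
  rw [coeff_monomial]
  split
  · next h => rw [h]
  · next h => exact hr m (Ne.symm h)

lemma upsilon_mem : upsilon δ ∈ reesGrading δ 1 := fun m hm => by
  change (X : A[X]).coeff m = 0
  rw [coeff_X, if_neg (Ne.symm hm)]

/-- The constants of the Rees algebra. -/
noncomputable def kernelToRees (δ : Derivation k A A) : kernel δ →+* reesAlgebra δ :=
  (SetLike.GradeZero.subring (reesGrading δ)).subtype.comp (kernelToDegreeZero δ)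

lemma kernelToRees_mem (c : kernel δ) : kernelToRees δ c ∈ reesGrading δ 0 :=
  (kernelToDegreeZero δ c).2

lemma kernelToDegreeZero_bijective : Function.Bijective (kernelToDegreeZero δ) := by
  constructor
  · intro a b h
    exact Subtype.ext (C_injective (congrArg (fun x => x.1.1) h))
  · rintro ⟨r, hr⟩
    obtain ⟨a, ha, rfl⟩ := exists_eq_reesMonomial hr
    exact ⟨⟨a, mem_degreeModule_zero.mp ha⟩, rfl⟩

lemma kernelToRees_injective : Function.Injective (kernelToRees δ) :=
  Subtype.val_injective.comp kernelToDegreeZero_bijective.1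

/-- Dividing by `υ` shifts coefficients down, so the coefficient of `υⁿ⁺¹` in `r` must lie in the
smaller `Fₙ`. This holds after multiplication by `c`, hence before it by saturation. -/
lemma dvd_of_kernel_mul_dvd [IsDomain A] {c : kernel δ} (hc : c ≠ 0) {r : reesAlgebra δ}
    (h : upsilon δ ∣ kernelToRees δ c * r) : upsilon δ ∣ r := by
  obtain ⟨r', hr'⟩ := h
  have hc0 : c.1 ≠ 0 := fun h => hc (Subtype.ext h)
  have e : C c.1 * r.1 = X * r'.1 := congrArg Subtype.val hr'
  have h0 : r.1.coeff 0 = 0 := by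
    have := congrArg (fun p => p.coeff 0) e
    simp only [coeff_C_mul, coeff_X_mul_zero] at this
    exact (mul_eq_zero.mp this).resolve_left hc0
  refine ⟨⟨r.1.divX, fun n => ?_⟩, Subtype.ext ?_⟩
  · rw [coeff_divX]
    refine mem_of_kernel_mul_mem c.2 hc0 ?_
    have := congrArg (fun p => p.coeff (n + 1)) e
    simp only [coeff_C_mul, coeff_X_mul] at this
    rw [this]
    exact r'.2 n
  · change r.1 = X * r.1.divX
    conv_lhs => rw [← divX_mul_X_add r.1, h0]
    simp [mul_comm]

instance [IsDomain A] : IsDomain (reesAlgebra δ) := inferInstance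

variable {s : A} (hs : δ (δ s) = 0)

/-- The homomorphism `A₀[x₀, x₁] → R` with `x₀ ↦ s υ`, `x₁ ↦ υ`. -/
noncomputable def sliceHom : MvPolynomial (Fin 2) (kernel δ) →+* reesAlgebra δ :=
  MvPolynomial.eval₂Hom (kernelToRees δ) ![reesMonomial 1 s (slice_mem hs), upsilon δ]

@[simp] lemma sliceHom_C (c : kernel δ) : sliceHom hs (MvPolynomial.C c) = kernelToRees δ c := by
  simp [sliceHom]

@[simp] lemma sliceHom_X0 : sliceHom hs (MvPolynomial.X 0) = reesMonomial 1 s (slice_mem hs) := by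
  simp [sliceHom]

@[simp] lemma sliceHom_X1 : sliceHom hs (MvPolynomial.X 1) = upsilon δ := by
  simp [sliceHom]

lemma sliceHom_val (p : MvPolynomial (Fin 2) (kernel δ)) : (sliceHom hs p).1 =
    ∑ m ∈ p.support, monomial (m 0 + m 1) ((MvPolynomial.coeff m p).1 * s ^ (m 0)) := by
  change (reesAlgebra δ).val (sliceHom hs p) = _
  rw [sliceHom, MvPolynomial.coe_eval₂Hom, MvPolynomial.eval₂_eq', map_sum]
  refine Finset.sum_congr rfl fun m _ => ?_
  rw [map_mul, Fin.prod_univ_two, map_mul, map_pow, map_pow]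
  change C (MvPolynomial.coeff m p).1 * (monomial 1 s ^ m 0 * X ^ m 1) = _
  rw [← C_mul_X_pow_eq_monomial, ← C_mul_X_pow_eq_monomial, mul_pow, pow_one, map_mul, map_pow,
    pow_add]
  ring

/-- Induction on the degree: a multiple of `sⁿ⁺¹` cancels the top term of a multiple of `a`, and the
difference drops to `Fₙ`. Characteristic zero keeps the factorial in the denominator nonzero. -/
lemma exists_kernel_mul_eq_aux [IsDomain A] [CharZero k] (hs' : δ s ≠ 0) (n : ℕ) :
    ∀ (a : A) (ha : a ∈ degreeModule δ n), ∃ c : kernel δ, c ≠ 0 ∧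
      ∃ p ∈ MvPolynomial.homogeneousSubmodule (Fin 2) (kernel δ) n,
        kernelToRees δ c * reesMonomial n a ha = sliceHom hs p := by
  have : CharZero A := charZero_of_injective_algebraMap (FaithfulSMul.algebraMap_injective k A)
  induction n with
  | zero =>
    intro a ha
    refine ⟨1, one_ne_zero, MvPolynomial.C ⟨a, mem_degreeModule_zero.mp ha⟩,
      MvPolynomial.isHomogeneous_C _ _, ?_⟩
    rw [map_one, one_mul, sliceHom_C]
    rfl
  | succ n ih =>
    intro a ha
    let t : kernel δ := ⟨δ s, hs⟩
    -- This is `δⁿ⁺¹(sⁿ⁺¹)`. With `b = δⁿ⁺¹(a)`, the elements `d a` and `b sⁿ⁺¹` have the same image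
    -- `d b` under `δⁿ⁺¹`.
    let d : kernel δ := (n + 1).factorial * t ^ (n + 1)
    have hd : d.1 = ((n + 1).factorial : A) * δ s ^ (n + 1) := by simp [d, t]
    have hd0 : d.1 ≠ 0 := by
      rw [hd]
      exact mul_ne_zero (Nat.cast_ne_zero.mpr (Nat.factorial_ne_zero _)) (pow_ne_zero _ hs')
    let b : kernel δ := ⟨_, pow_mem_kernel ha⟩
    have hmem : d.1 * a - b.1 * s ^ (n + 1) ∈ degreeModule δ n := by
      rw [mem_degreeModule_iff, map_sub, pow_kernel_mul d.2, pow_kernel_mul b.2,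
        pow_slice_pow hs, hd]
      change _ * (b.1) - _ = _
      ring
    obtain ⟨c, hc, p, hp, h⟩ := ih _ hmem
    -- The polynomial encodes `c d a υⁿ⁺¹ = υ · c (d a - b sⁿ⁺¹) υⁿ + c b (s υ)ⁿ⁺¹`.
    refine ⟨c * d, mul_ne_zero hc fun h => hd0 (by rw [h]; rfl),
      MvPolynomial.X 1 * p + MvPolynomial.C (c * b) * MvPolynomial.X 0 ^ (n + 1), ?_, ?_⟩
    · refine Submodule.add_mem _ ?_ ?_
      · rw [add_comm]
        exact MvPolynomial.IsHomogeneous.mul (MvPolynomial.isHomogeneous_X _ _) hp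
      · have := (MvPolynomial.isHomogeneous_C (Fin 2) (c * b)).mul
          (MvPolynomial.isHomogeneous_X_pow (R := kernel δ) (0 : Fin 2) (n + 1))
        rwa [zero_add] at this
    · simp only [map_add, map_mul, ← h, map_pow, sliceHom_X1, sliceHom_X0, sliceHom_C]
      apply Subtype.ext
      change C c.1 * C d.1 * monomial (n + 1) a =
        X * (C c.1 * monomial n (d.1 * a - b.1 * s ^ (n + 1))) +
          C c.1 * C b.1 * monomial 1 s ^ (n + 1)
      rw [map_sub]
      simp only [← C_mul_X_pow_eq_monomial, map_mul, map_pow]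
      ring

lemma exists_kernel_mul_eq [IsDomain A] [CharZero k] (hs' : δ s ≠ 0) (r : reesAlgebra δ) :
    ∃ c : kernel δ, c ≠ 0 ∧ ∃ p, kernelToRees δ c * r = sliceHom hs p := by
  induction r using DirectSum.Decomposition.inductionOn (reesGrading δ) with
  | zero => exact ⟨1, one_ne_zero, 0, by simp⟩
  | homogeneous r =>
    obtain ⟨a, ha, h⟩ := exists_eq_reesMonomial r.2
    obtain ⟨c, hc, p, -, hp⟩ := exists_kernel_mul_eq_aux hs hs' _ a ha
    exact ⟨c, hc, p, h ▸ hp⟩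
  | add r r' h h' =>
    obtain ⟨c, hc, p, hp⟩ := h
    obtain ⟨c', hc', p', hp'⟩ := h'
    refine ⟨c * c', mul_ne_zero hc hc', MvPolynomial.C c' * p + MvPolynomial.C c * p', ?_⟩
    simp only [map_add, map_mul, sliceHom_C, ← hp, ← hp']
    ring

/-- The degree in `υ` records the total degree. Among the monomials of one total degree, take the
largest exponent `i` of `x₀`: `δⁱ` kills the lower powers of `s` and sends `sⁱ` to `i! (δ s)ⁱ ≠ 0`,
so the coefficient of that monomial vanishes. -/
lemma sliceHom_injective [IsDomain A] [CharZero k] (hs' : δ s ≠ 0) :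
    Function.Injective (sliceHom hs) := by
  have : CharZero A := charZero_of_injective_algebraMap (FaithfulSMul.algebraMap_injective k A)
  rw [injective_iff_map_eq_zero]
  intro p hp
  by_contra hp0
  obtain ⟨m₀, hm₀⟩ := MvPolynomial.support_nonempty.mpr hp0
  obtain ⟨m, hm, hmax⟩ := Finset.exists_max_image
    (p.support.filter fun m => m 0 + m 1 = m₀ 0 + m₀ 1) (fun m => m 0) ⟨m₀, by simp [hm₀]⟩
  rw [Finset.mem_filter] at hm
  have e := congrArg (fun q => (δ.toLinearMap ^ (m 0)) (q.coeff (m₀ 0 + m₀ 1)))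
    ((sliceHom_val hs p).symm.trans (congrArg Subtype.val hp))
  simp only [finsetSum_coeff, map_sum] at e
  rw [Finset.sum_eq_single m] at e
  · rw [coeff_monomial, if_pos hm.2, pow_kernel_mul (MvPolynomial.coeff m p).2,
      pow_slice_pow hs] at e
    simp only [ZeroMemClass.coe_zero, coeff_zero, map_zero] at e
    rcases mul_eq_zero.mp e with h | h
    · exact MvPolynomial.mem_support_iff.mp hm.1 (Subtype.ext h)
    · exact mul_ne_zero (Nat.cast_ne_zero.mpr (Nat.factorial_ne_zero _)) (pow_ne_zero _ hs') h
  · intro m' hm' hne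
    rw [coeff_monomial]
    split
    · next h =>
      have hle := hmax m' (Finset.mem_filter.mpr ⟨hm', h⟩)
      have hlt : m' 0 < m 0 := lt_of_le_of_ne hle fun h0 => hne (by
        ext i
        fin_cases i
        · exact h0
        · have := h.trans hm.2.symm
          change m' 0 = m 0 at h0
          change m' 1 = m 1
          omega)
      rw [pow_kernel_mul (MvPolynomial.coeff m' p).2]
      have h1 := mem_degreeModule_iff.mp (slice_pow_mem hs (m' 0))
      obtain ⟨j, hj⟩ := Nat.exists_eq_add_of_lt hlt
      rw [hj, show m' 0 + j + 1 = j + (m' 0 + 1) by ring, pow_add, Module.End.mul_apply, h1,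
        map_zero, mul_zero]
    · simp
  · exact fun h => absurd hm.1 h

end Rees

/-! ### Criteria for integral closedness -/

section Normality

/-- Elements of the fraction field of `R` that are integral over `R` come from every integrally
closed domain that contains `R`. -/
lemma exists_mul_eq_of_isIntegral {R S : Type*} [CommRing R] [IsDomain R] [CommRing S] [IsDomain S]
    [IsIntegrallyClosed S] (f : R →+* S) (hf : Function.Injective f) {a b : R}
    {z : FractionRing R} (hz : z * algebraMap R _ b = algebraMap R _ a) (hi : IsIntegral R z) :
    ∃ x : S, x * f b = f a := by
  have hg : Function.Injective ((algebraMap S (FractionRing S)).comp f) :=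
    (IsFractionRing.injective S _).comp hf
  let F : FractionRing R →+* FractionRing S := IsFractionRing.lift hg
  have hF : ∀ r, F (algebraMap R _ r) = algebraMap S _ (f r) := fun r =>
    IsFractionRing.lift_algebraMap hg r
  have hFz : IsIntegral S (F z) := by
    obtain ⟨p, hp, h⟩ := hi
    refine ⟨p.map f, hp.map f, ?_⟩
    rw [Polynomial.eval₂_map]
    have := congrArg F h
    rw [Polynomial.hom_eval₂, map_zero] at this
    rw [← this]
    congr 1
    ext r
    exact (hF r).symm
  obtain ⟨x, hx⟩ := IsIntegrallyClosed.isIntegral_iff.mp hFz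
  refine ⟨x, IsFractionRing.injective S (FractionRing S) ?_⟩
  rw [map_mul, hx, ← hF, ← hF, ← map_mul, hz]

/-- A domain is integrally closed if fractions that are integral are divisible. -/
lemma isIntegrallyClosed_of_forall {R : Type*} [CommRing R] [IsDomain R]
    (h : ∀ (a b : R) (z : FractionRing R), b ≠ 0 → z * algebraMap R _ b = algebraMap R _ a →
      IsIntegral R z → ∃ x, x * b = a) : IsIntegrallyClosed R := by
  refine (isIntegrallyClosed_iff (FractionRing R)).mpr fun {z} hz => ?_
  obtain ⟨⟨a, b⟩, hab⟩ := IsLocalization.surj (nonZeroDivisors R) z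
  have hb : (b : R) ≠ 0 := nonZeroDivisors.coe_ne_zero b
  obtain ⟨x, hx⟩ := h a b z hb hab hz
  refine ⟨x, mul_right_cancel₀ (b := algebraMap R (FractionRing R) b) ?_ ?_⟩
  · exact fun h0 => hb ((IsFractionRing.injective R (FractionRing R)) (h0.trans (map_zero _).symm))
  · rw [hab, ← map_mul, hx]

end Normality

/-! ### Trivialization over the field of invariants; normality of `A₀` and `R`; primality of `υ` -/

section Rees
open Polynomial
attribute [local instance] MvPolynomial.gradedAlgebra
variable {k A : Type u} [Field k] [CommRing A] [Algebra k A] {δ : Derivation k A A}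

/-- Taking the constant coefficient exhibits `A₀` as a quotient of the Rees algebra. -/
lemma finiteType_kernel (hR : Algebra.FiniteType k (reesAlgebra δ)) :
    Algebra.FiniteType k (kernel δ) := by
  let f : reesAlgebra δ →ₐ[k] kernel δ :=
    { toFun := fun r => ⟨r.1.coeff 0, mem_degreeModule_zero.mp (r.2 0)⟩
      map_one' := Subtype.ext (by simp)
      map_zero' := Subtype.ext (by simp)
      map_mul' := fun a b => Subtype.ext (by simp [mul_coeff_zero])
      map_add' := fun a b => Subtype.ext (by simp)
      commutes' := fun r => Subtype.ext (by
        change (C (algebraMap k A r)).coeff 0 = algebraMap k A r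
        simp) }
  refine Algebra.FiniteType.of_surjective f fun c => ⟨kernelToRees δ c, Subtype.ext ?_⟩
  change (C c.1).coeff 0 = c.1
  simp

variable [IsDomain A]

/-- An integral fraction `a / b` of invariants is an element `x` of `A`, and applying `δ` to `x b =
a` gives `δ(x) b = 0`. -/
lemma isIntegrallyClosed_kernel [IsIntegrallyClosed A] : IsIntegrallyClosed (kernel δ) := by
  refine isIntegrallyClosed_of_forall fun a b z hb hz hi => ?_
  obtain ⟨x, hx⟩ := exists_mul_eq_of_isIntegral (kernel δ).val.toRingHom Subtype.val_injective hz hi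
  change x * b.1 = a.1 at hx
  have hb0 : b.1 ≠ 0 := fun h => hb (Subtype.ext h)
  refine ⟨⟨x, ?_⟩, Subtype.ext hx⟩
  have h := congrArg δ hx
  rw [Derivation.leibniz, show δ b.1 = 0 from b.2, show δ a.1 = 0 from a.2, smul_zero, zero_add,
    smul_eq_mul] at h
  exact (mul_eq_zero.mp h).resolve_left hb0

variable (δ) in
/-- A localization map of the Rees algebra to the polynomial ring in two variables over the field
of invariants. -/
structure Trivialization where
  hom : GradedRingHom (reesGrading δ) (homogeneousCoordinates 1 (FractionRing (kernel δ)))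
  injective : Function.Injective hom
  map_const : ∀ c, hom (kernelToRees δ c) = MvPolynomial.C (algebraMap _ _ c)
  map_upsilon : hom (upsilon δ) = MvPolynomial.X 1
  slice : reesAlgebra δ
  slice_mem : slice ∈ reesGrading δ 1
  map_slice : hom slice = MvPolynomial.X 0
  exists_mul_eq : ∀ q, ∃ c : kernel δ, c ≠ 0 ∧ ∃ r,
    MvPolynomial.C (algebraMap _ _ c) * q = hom r

lemma exists_C_mul_eq_map {R : Type*} [CommRing R] [IsDomain R] {σ : Type*}
    (q : MvPolynomial σ (FractionRing R)) : ∃ c : R, c ≠ 0 ∧ ∃ p : MvPolynomial σ R,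
      MvPolynomial.C (algebraMap R _ c) * q = MvPolynomial.map (algebraMap R _) p := by
  let _ : Algebra (MvPolynomial σ R) (MvPolynomial σ (FractionRing R)) :=
    MvPolynomial.algebraMvPolynomial
  obtain ⟨⟨p, ⟨_, c, hc, rfl⟩⟩, h⟩ := IsLocalization.surj
    ((nonZeroDivisors R).map (MvPolynomial.C (σ := σ))) q
  refine ⟨c, nonZeroDivisors.ne_zero hc, p, ?_⟩
  rw [mul_comm]
  refine Eq.trans ?_ h
  congr 1
  exact (MvPolynomial.map_C _ _).symm

/-- Both rings sit inside `Q = Frac R`: the evaluation `K[x₀, x₁] → Q` is injective because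
`sliceHom` is, and its image contains `R` because a multiple of every element of `R` by a nonzero
invariant lies in the image of `sliceHom`. The trivialization is the inverse of the evaluation,
restricted to `R`. -/
lemma nonempty_trivialization [CharZero k] (hδ : IsLocallyNilpotent δ) (hδ0 : δ ≠ 0) :
    Nonempty (Trivialization δ) := by
  obtain ⟨s, hs', hs⟩ := exists_slice hδ hδ0
  let K := FractionRing (kernel δ)
  let Q := FractionRing (reesAlgebra δ)
  have hQ : Function.Injective (algebraMap (reesAlgebra δ) Q) := IsFractionRing.injective _ _
  have hι : Function.Injective ((algebraMap (reesAlgebra δ) Q).comp (kernelToRees δ)) :=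
    hQ.comp kernelToRees_injective
  let ev : MvPolynomial (Fin 2) K →+* Q := MvPolynomial.eval₂Hom (IsFractionRing.lift hι)
    fun i => algebraMap _ Q (sliceHom hs (MvPolynomial.X i))
  have hevC : ∀ c : kernel δ, ev (MvPolynomial.C (algebraMap _ K c)) =
      algebraMap _ Q (kernelToRees δ c) := fun c => by
    simp [ev, IsFractionRing.lift_algebraMap hι]
  have hevm : ∀ p, ev (MvPolynomial.map (algebraMap _ K) p) = algebraMap _ Q (sliceHom hs p) := by
    intro p
    induction p using MvPolynomial.induction_on with
    | C c => rw [MvPolynomial.map_C, hevC, sliceHom_C]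
    | add p q hp hq => simp only [map_add, hp, hq]
    | mul_X p i hp =>
      rw [map_mul, map_mul, hp, MvPolynomial.map_X, map_mul, map_mul]
      congr 1
      simp [ev]
  have hinj : Function.Injective ev := by
    rw [injective_iff_map_eq_zero]
    intro q hq
    obtain ⟨c, hc, p, h⟩ := exists_C_mul_eq_map q
    have := congrArg ev h
    rw [map_mul, hq, mul_zero, hevm] at this
    have hp : p = 0 := sliceHom_injective hs hs' ((hQ (this.symm.trans
      (map_zero _).symm)).trans (map_zero _).symm)
    rw [hp, map_zero] at h
    refine (mul_eq_zero.mp h).resolve_left fun h0 => hc ?_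
    exact IsFractionRing.injective (kernel δ) K ((MvPolynomial.C_injective _ _
      (h0.trans (map_zero _).symm)).trans (map_zero _).symm)
  have hc0 : ∀ {c : kernel δ}, c ≠ 0 → algebraMap _ K c ≠ 0 := fun hc h0 =>
    hc (IsFractionRing.injective (kernel δ) K (h0.trans (map_zero _).symm))
  have hdiv : ∀ (r : reesAlgebra δ) (c : kernel δ) (p), c ≠ 0 → kernelToRees δ c * r = sliceHom hs p →
      ev (MvPolynomial.C (algebraMap _ K c)⁻¹ * MvPolynomial.map (algebraMap _ K) p) =
        algebraMap _ Q r := by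
    intro r c p hc hp
    refine mul_left_cancel₀ (a := algebraMap _ Q (kernelToRees δ c)) ?_ ?_
    · exact fun h => hc (hι (h.trans (map_zero _).symm))
    · rw [← map_mul, hp, ← hevm, ← hevC, ← map_mul, ← mul_assoc, ← map_mul,
        mul_inv_cancel₀ (hc0 hc), map_one, one_mul]
  have hrange : ∀ r, algebraMap (reesAlgebra δ) Q r ∈ ev.range := fun r => by
    obtain ⟨c, hc, p, hp⟩ := exists_kernel_mul_eq hs hs' r
    exact ⟨_, hdiv r c p hc hp⟩
  let e := RingEquiv.ofBijective ev.rangeRestrict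
    ⟨fun a b h => hinj (congrArg Subtype.val h), ev.rangeRestrict_surjective⟩
  let φ : reesAlgebra δ →+* MvPolynomial (Fin 2) K :=
    e.symm.toRingHom.comp ((algebraMap (reesAlgebra δ) Q).codRestrict ev.range hrange)
  have hφ : ∀ r, ev (φ r) = algebraMap _ Q r := fun r =>
    congrArg Subtype.val (e.apply_symm_apply ⟨_, hrange r⟩)
  have hφ' : ∀ r q, ev q = algebraMap _ Q r → φ r = q := fun r q h => hinj ((hφ r).trans h.symm)
  refine ⟨⟨⟨φ, ?_⟩, ?_, ?_, ?_, reesMonomial 1 s (slice_mem hs), reesMonomial_mem _ _ _, ?_, ?_⟩⟩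
  · intro n r hr
    obtain ⟨a, ha, rfl⟩ := exists_eq_reesMonomial hr
    obtain ⟨c, hc, p, hp, h⟩ := exists_kernel_mul_eq_aux hs hs' n a ha
    change φ _ ∈ _
    rw [hφ' _ _ (hdiv _ c p hc h)]
    have := (MvPolynomial.isHomogeneous_C (Fin 2) (algebraMap _ K c)⁻¹).mul
      (MvPolynomial.IsHomogeneous.map hp (algebraMap _ K))
    rwa [zero_add] at this
  · exact fun a b h => hQ (by rw [← hφ, ← hφ]; exact congrArg ev h)
  · exact fun c => hφ' _ _ (hevC c)
  · refine hφ' _ _ ?_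
    rw [← sliceHom_X1 hs, ← hevm, MvPolynomial.map_X]
  · refine hφ' _ _ ?_
    rw [← sliceHom_X0 hs, ← hevm, MvPolynomial.map_X]
  · intro q
    obtain ⟨c, hc, p, h⟩ := exists_C_mul_eq_map q
    refine ⟨c, hc, sliceHom hs p, h.trans (hφ' _ _ (hevm p)).symm⟩

namespace Trivialization
variable (τ : Trivialization δ)

-- An integral fraction of `R` lies in `A[υ]` and in `K[x₀, x₁]`. Clearing denominators in the
-- second ring, `c p ∈ R` for its representative `p ∈ A[υ]` and some invariant `c ≠ 0`; saturation
-- removes `c`.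
include τ in
lemma isIntegrallyClosed_rees [IsIntegrallyClosed A] : IsIntegrallyClosed (reesAlgebra δ) := by
  refine isIntegrallyClosed_of_forall fun a b z hb hz hi => ?_
  obtain ⟨p, hp⟩ := exists_mul_eq_of_isIntegral (reesAlgebra δ).val.toRingHom
    Subtype.val_injective hz hi
  obtain ⟨q, hq⟩ := exists_mul_eq_of_isIntegral τ.hom.toRingHom τ.injective hz hi
  change p * b.1 = a.1 at hp
  change q * τ.hom b = τ.hom a at hq
  obtain ⟨c, hc, r, hr⟩ := τ.exists_mul_eq q
  have hc0 : c.1 ≠ 0 := fun h => hc (Subtype.ext h)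
  have h1 : r * b = kernelToRees δ c * a := τ.injective (by
    rw [map_mul, map_mul, ← hr, mul_assoc, hq, τ.map_const])
  have h2 : r.1 = C c.1 * p := by
    refine mul_right_cancel₀ (b := b.1) (fun h => hb (Subtype.ext h)) ?_
    rw [mul_assoc, hp]
    exact congrArg Subtype.val h1
  refine ⟨⟨p, fun n => mem_of_kernel_mul_mem c.2 hc0 ?_⟩, Subtype.ext hp⟩
  rw [← coeff_C_mul, ← h2]
  exact r.2 n

/-- A quotient in `K[x₀, x₁]` acquires coefficients in `R` after multiplication by some invariant `c
≠ 0`; then `υ ∣ c r`, and `c` can be dropped. -/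
lemma upsilon_dvd_iff (r : reesAlgebra δ) :
    upsilon δ ∣ r ↔ (MvPolynomial.X 1 : MvPolynomial (Fin 2) _) ∣ τ.hom r := by
  constructor
  · rintro ⟨r', rfl⟩
    exact ⟨τ.hom r', by rw [map_mul, τ.map_upsilon]⟩
  · rintro ⟨q, hq⟩
    obtain ⟨c, hc, r', hr'⟩ := τ.exists_mul_eq q
    refine dvd_of_kernel_mul_dvd hc ⟨r', τ.injective ?_⟩
    rw [map_mul, map_mul, hq, ← hr', τ.map_const, τ.map_upsilon]
    ring

include τ in
lemma prime_upsilon : Prime (upsilon δ) := by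
  have hX : Prime (MvPolynomial.X 1 : MvPolynomial (Fin 2) (FractionRing (kernel δ))) :=
    MvPolynomial.X_prime
  refine ⟨fun h => ?_, fun h => ?_, fun a b h => ?_⟩
  · exact hX.ne_zero (by rw [← τ.map_upsilon, h, map_zero])
  · exact hX.not_isUnit (by rw [← τ.map_upsilon]; exact h.map τ.hom)
  · simp only [τ.upsilon_dvd_iff, map_mul] at h ⊢
    exact hX.dvd_or_dvd h

lemma not_upsilon_dvd_slice : ¬ upsilon δ ∣ τ.slice := by
  rw [τ.upsilon_dvd_iff, τ.map_slice, MvPolynomial.X_dvd_X]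
  simp

end Trivialization

end Rees

/-! ### Normality and integrality of `Proj` of a normal graded domain -/

section GradedDomain
open HomogeneousLocalization

variable {R : Type u} [CommRing R] {σ : Type*} [SetLike σ R] [AddSubgroupClass σ R]
  (𝒜 : ℕ → σ) [GradedRing 𝒜]

lemma exists_component_notMem {p : Ideal R} {r : R} (hr : r ∉ p) :
    ∃ d, (DirectSum.decompose 𝒜 r d : R) ∉ p := by
  classical
  by_contra! h
  refine hr ?_
  rw [← DirectSum.sum_support_decompose 𝒜 r]
  exact Ideal.sum_mem _ fun d _ => h d

variable [IsDomain R]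

instance isDomain_homogeneousLocalization (p : Ideal R) [p.IsPrime] :
    IsDomain (HomogeneousLocalization.AtPrime 𝒜 p) :=
  Function.Injective.isDomain
    (algebraMap (HomogeneousLocalization.AtPrime 𝒜 p) (Localization.AtPrime p)) (val_injective _)

/-- The full localization is integrally closed, so an integral fraction equals some `r / s` there.
It is made homogeneous by passing to components of one degree `d` for which `s_d ∉ p`. -/
lemma isIntegrallyClosed_homogeneousLocalization [IsIntegrallyClosed R] (p : Ideal R) [p.IsPrime] :
    IsIntegrallyClosed (HomogeneousLocalization.AtPrime 𝒜 p) := by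
  have hle : p.primeCompl ≤ nonZeroDivisors R := p.primeCompl_le_nonZeroDivisors
  have := isIntegrallyClosed_of_isLocalization (Localization.AtPrime p) p.primeCompl hle
  refine isIntegrallyClosed_of_forall fun a b z hb hz hi => ?_
  obtain ⟨x, hx⟩ := exists_mul_eq_of_isIntegral
    (algebraMap (HomogeneousLocalization.AtPrime 𝒜 p) (Localization.AtPrime p))
    (val_injective _) hz hi
  obtain ⟨⟨i, ⟨a₁, ha₁⟩, ⟨a₂, ha₂⟩, ha⟩, rfl⟩ := mk_surjective a
  obtain ⟨⟨j, ⟨b₁, hb₁⟩, ⟨b₂, hb₂⟩, hb'⟩, rfl⟩ := mk_surjective b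
  obtain ⟨⟨r, s⟩, rfl⟩ : ∃ y : R × p.primeCompl, Localization.mk y.1 y.2 = x :=
    Localization.ind (fun y => ⟨y, rfl⟩) x
  change Localization.mk r s * Localization.mk b₁ ⟨b₂, hb'⟩ = Localization.mk a₁ ⟨a₂, ha⟩ at hx
  have inj := IsLocalization.injective (Localization.AtPrime p) hle
  rw [Localization.mk_mul, Localization.mk_eq_mk_iff, Localization.r_iff_exists] at hx
  obtain ⟨c, hc⟩ := hx
  have hc' : a₂ * (r * b₁) = s * b₂ * a₁ :=
    mul_left_cancel₀ (nonZeroDivisors.ne_zero (hle c.2)) hc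
  obtain ⟨d, hd⟩ := exists_component_notMem 𝒜 s.2
  -- The factors `a₂ b₁` and `b₂ a₁` are homogeneous of the same degree `i + j`; this compares the
  -- components of degree `d + i + j` in `hc'`.
  have hdeg : (DirectSum.decompose 𝒜 r d : R) * (a₂ * b₁) =
      (DirectSum.decompose 𝒜 s.1 d : R) * (b₂ * a₁) := by
    have h1 := SetLike.mul_mem_graded ha₂ hb₁
    have h2 := SetLike.mul_mem_graded hb₂ ha₁
    rw [add_comm] at h2
    rw [← DirectSum.coe_decompose_mul_add_of_right_mem 𝒜 h1,
      ← DirectSum.coe_decompose_mul_add_of_right_mem 𝒜 h2]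
    congr 3
    linear_combination hc'
  refine ⟨mk ⟨d, DirectSum.decompose 𝒜 r d, DirectSum.decompose 𝒜 s.1 d, hd⟩, ?_⟩
  apply val_injective
  rw [val_mul, val_mk, val_mk, val_mk, Localization.mk_mul, Localization.mk_eq_mk_iff,
    Localization.r_iff_exists]
  refine ⟨1, ?_⟩
  simp only [Submonoid.coe_mul, one_mul, OneMemClass.coe_one]
  linear_combination hdeg

instance isDomain_stalk (x : Proj 𝒜) : IsDomain ((Proj 𝒜).presheaf.stalk x) :=
  (Proj.stalkIso 𝒜 x).commRingCatIsoToRingEquiv.toMulEquiv.isDomain _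

lemma isNormal_proj [IsIntegrallyClosed R] : IsNormal (Proj 𝒜) where
  isDomain x := inferInstance
  isIntegrallyClosed x := by
    have := isIntegrallyClosed_homogeneousLocalization 𝒜 (primeAt 𝒜 x)
    let e : HomogeneousLocalization.AtPrime 𝒜 (primeAt 𝒜 x) ≃+* (Proj 𝒜).presheaf.stalk x :=
      (Proj.stalkIso 𝒜 x).commRingCatIsoToRingEquiv.symm
    exact IsIntegrallyClosed.of_equiv e

variable {𝒜}

lemma isPrime_bot_toIdeal : (⊥ : HomogeneousIdeal 𝒜).toIdeal.IsPrime := by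
  rw [HomogeneousIdeal.toIdeal_bot]
  exact Ideal.isPrime_bot

/-- A homogeneous prime element, not dividing some homogeneous element of positive degree, as
a point of `Proj`. -/
def pointOfIdeal (I : HomogeneousIdeal 𝒜) (hI : I.toIdeal.IsPrime) {m : ℕ} {f : R} (hf : f ∈ 𝒜 m)
    (hm : 0 < m) (hfI : f ∉ I.toIdeal) : Proj 𝒜 :=
  (⟨I, hI, fun h => hfI (h (HomogeneousIdeal.mem_irrelevant_of_mem 𝒜 hm hf))⟩ :
    ProjectiveSpectrum 𝒜)

/-- Since `f ≠ 0` has positive degree, the zero ideal is a point of `Proj`, and it lies in every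
nonempty open set. Reducedness holds because the stalks are domains. -/
lemma isIntegral_proj {m : ℕ} {f : R} (hf : f ∈ 𝒜 m) (hm : 0 < m) (hf0 : f ≠ 0) :
    IsIntegral (Proj 𝒜) := by
  have : IsReduced (Proj 𝒜) := isReduced_of_isReduced_stalk _
  let ξ : Proj 𝒜 := pointOfIdeal ⊥ isPrime_bot_toIdeal hf hm (by simpa using hf0)
  have hξ : ∀ U : Set (Proj 𝒜), IsOpen U → U.Nonempty → ξ ∈ U := by
    rintro U hU ⟨x, hx⟩
    obtain ⟨_, ⟨g, rfl⟩, hxg, hgU⟩ :=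
      (ProjectiveSpectrum.isTopologicalBasis_basic_opens 𝒜).exists_subset_of_mem_open hx hU
    refine hgU ?_
    change g ∉ (⊥ : HomogeneousIdeal 𝒜).toIdeal
    intro h
    have : g = 0 := by simpa using h
    exact hxg (this ▸ zero_mem _)
  have : IrreducibleSpace (Proj 𝒜) :=
    { toNonempty := ⟨ξ⟩
      isPreirreducible_univ := fun U V hU hV ⟨x, hx⟩ ⟨y, hy⟩ =>
        ⟨ξ, trivial, hξ U hU ⟨x, hx.2⟩, hξ V hV ⟨y, hy.2⟩⟩ }
  exact isIntegral_of_irreducibleSpace_of_isReduced _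

end GradedDomain

lemma isNormal_spec (R : Type u) [CommRing R] [IsDomain R] [IsIntegrallyClosed R] :
    IsNormal (Spec (.of R)) := by
  have e : ∀ x : PrimeSpectrum R, Localization.AtPrime x.asIdeal ≃+*
      (Spec (.of R)).presheaf.stalk x := fun x =>
    (Spec.stalkIso (.of R) x).commRingCatIsoToRingEquiv.symm
  have h : ∀ x : PrimeSpectrum R, IsIntegrallyClosed ((Spec (.of R)).presheaf.stalk x) := fun x =>
    have := isIntegrallyClosed_of_isLocalization (Localization.AtPrime x.asIdeal)
      x.asIdeal.primeCompl x.asIdeal.primeCompl_le_nonZeroDivisors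
    IsIntegrallyClosed.of_equiv (e x)
  exact ⟨fun x => (e x).symm.toMulEquiv.isDomain _, h⟩

/-! ### `Y₀` and `Y` as varieties; properness and surjectivity of `π` -/

section Rees
variable {k A : Type u} [Field k] [CommRing A] [Algebra k A] {δ : Derivation k A A}

instance isIso_specMap_kernelToDegreeZero :
    IsIso (Spec.map (CommRingCat.ofHom (S := reesGrading δ 0) (kernelToDegreeZero δ))) := by
  have : IsIso (CommRingCat.ofHom (S := reesGrading δ 0) (kernelToDegreeZero δ)) :=
    (RingEquiv.ofBijective _ (kernelToDegreeZero_bijective (δ := δ))).toCommRingCatIso.isIso_hom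
  infer_instance

lemma finiteType_degreeZero (hR : Algebra.FiniteType k (reesAlgebra δ)) :
    Algebra.FiniteType (reesGrading δ 0) (reesAlgebra δ) :=
  have : IsScalarTower k (reesGrading δ 0) (reesAlgebra δ) :=
    ⟨fun a b c => smul_mul_assoc a b.1 c⟩
  Algebra.FiniteType.of_restrictScalars_finiteType k _ _

lemma isProper_π (hR : Algebra.FiniteType k (reesAlgebra δ)) : IsProper (reesProj.π δ) := by
  have := finiteType_degreeZero hR
  exact inferInstanceAs (IsProper (Proj.toSpecZero (reesGrading δ) ≫
    Spec.map (CommRingCat.ofHom (S := reesGrading δ 0) (kernelToDegreeZero δ))))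

/-- The structure map of the chart of `Y` at a homogeneous element. -/
noncomputable def kernelToAway (f : reesAlgebra δ) :
    kernel δ →+* HomogeneousLocalization.Away (reesGrading δ) f :=
  (HomogeneousLocalization.fromZeroRingHom (reesGrading δ) _).comp (kernelToDegreeZero δ)

lemma val_kernelToAway (f : reesAlgebra δ) (c : kernel δ) :
    (kernelToAway f c).val = algebraMap _ _ (kernelToRees δ c) := rfl

lemma awayι_π {m : ℕ} {f : reesAlgebra δ} (hf : f ∈ reesGrading δ m) (hm : 0 < m) :
    Proj.awayι (reesGrading δ) f hf hm ≫ reesProj.π δ =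
      Spec.map (CommRingCat.ofHom (kernelToAway f)) := by
  rw [reesProj.π]
  erw [Proj.awayι_toSpecZero_assoc]
  rw [← Spec.map_comp]
  rfl

variable [IsDomain A]

lemma isVariety_quotient (hR : Algebra.FiniteType k (reesAlgebra δ)) :
    IsVariety (quotientVariety.structureMorphism δ) := by
  have hk := finiteType_kernel hR
  have : LocallyOfFiniteType (quotientVariety.structureMorphism δ) := by
    refine (HasRingHomProperty.Spec_iff (P := @LocallyOfFiniteType)).mpr ?_
    exact RingHom.finiteType_algebraMap.mpr hk
  exact ⟨inferInstanceAs (IsIntegral (Spec (.of (kernel δ)))),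
    inferInstanceAs (IsSeparated (Spec.map _)), this, inferInstanceAs (QuasiCompact (Spec.map _))⟩

lemma kernelToAway_injective {f : reesAlgebra δ} (hf : f ≠ 0) :
    Function.Injective (kernelToAway f) := by
  intro a b h
  have h' := congrArg HomogeneousLocalization.val h
  rw [val_kernelToAway, val_kernelToAway] at h'
  exact kernelToRees_injective (IsLocalization.injective (Localization.Away f)
    (powers_le_nonZeroDivisors_of_noZeroDivisors hf) h')

lemma upsilon_ne_zero : upsilon δ ≠ 0 := fun h =>
  Polynomial.X_ne_zero (congrArg Subtype.val h)

/-- Already the chart `D₊(υ)` dominates `Y₀`, because `A₀` embeds into its coordinate ring;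
properness makes the image of `π` closed. -/
lemma surjective_π (hR : Algebra.FiniteType k (reesAlgebra δ)) : Surjective (reesProj.π δ) := by
  have := isProper_π hR
  have h1 : IsDominant (Spec.map (CommRingCat.ofHom (kernelToAway (upsilon δ)))) :=
    ⟨(PrimeSpectrum.denseRange_comap_iff_ker_le_nilRadical _).mpr (by
      refine le_of_eq_of_le ?_ bot_le
      exact (RingHom.injective_iff_ker_eq_bot _).mp
        (kernelToAway_injective (upsilon_ne_zero (δ := δ))))⟩
  rw [← awayι_π upsilon_mem one_pos] at h1
  have h2 : IsDominant (reesProj.π δ) := IsDominant.of_comp (Proj.awayι (reesGrading δ) (upsilon δ) upsilon_mem one_pos)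
    (reesProj.π δ)
  exact surjective_of_isDominant_of_isClosed_range _ (reesProj.π δ).isClosedMap.isClosed_range

lemma isIntegral_reesProj : IsIntegral (reesProj δ) :=
  isIntegral_proj upsilon_mem one_pos upsilon_ne_zero

lemma isVariety_reesProj (hR : Algebra.FiniteType k (reesAlgebra δ)) :
    IsVariety (reesProj.π δ ≫ quotientVariety.structureMorphism δ) := by
  have := isProper_π hR
  obtain ⟨-, h1, h2, h3⟩ := isVariety_quotient hR
  exact ⟨isIntegral_reesProj,
    @MorphismProperty.comp_mem _ _ @IsSeparated _ _ _ _ _ _ inferInstance h1,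
    @MorphismProperty.comp_mem _ _ @LocallyOfFiniteType _ _ _ _ _ _ inferInstance h2,
    @MorphismProperty.comp_mem _ _ @QuasiCompact _ _ _ _ _ _ inferInstance h3⟩

lemma isLocallyNoetherian_reesProj (hR : Algebra.FiniteType k (reesAlgebra δ)) :
    IsLocallyNoetherian (reesProj δ) := by
  have := (isVariety_reesProj hR).locallyOfFiniteType
  exact LocallyOfFiniteType.isLocallyNoetherian (reesProj.π δ ≫ quotientVariety.structureMorphism δ)

end Rees

/-- A square is a pullback if it is one over every member of an open cover. -/
lemma isPullback_of_charts {W X Y Z : Scheme.{u}} (fWX : W ⟶ X) (fWY : W ⟶ Y) (fXZ : X ⟶ Z)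
    (fYZ : Y ⟶ Z) (𝒰 : X.OpenCover) (H : ∀ i, ∃ (V : Scheme.{u}) (g : V ⟶ 𝒰.X i) (j : V ⟶ W),
      IsPullback g j (𝒰.f i) fWX ∧ IsPullback g (j ≫ fWY) (𝒰.f i ≫ fXZ) fYZ) :
    IsPullback fWX fWY fXZ fYZ := by
  refine Scheme.isPullback_of_openCover _ _ _ _ 𝒰 fun i => ?_
  obtain ⟨V, g, j, h1, h2⟩ := H i
  refine h2.of_iso h1.flip.isoPullback (Iso.refl _) (Iso.refl _) (Iso.refl _) ?_ ?_ ?_ ?_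
  · rw [Iso.refl_hom, Category.comp_id]
    exact h1.flip.isoPullback_hom_snd.symm
  · rw [Iso.refl_hom, Category.comp_id]
    exact (h1.flip.isoPullback_hom_fst_assoc _).symm
  · rw [Iso.refl_hom, Iso.refl_hom, Category.comp_id, Category.id_comp]
  · rw [Iso.refl_hom, Iso.refl_hom, Category.comp_id, Category.id_comp]

/-! ### The generic fiber is the projective line -/

section GenericFiber
open HomogeneousLocalization Limits
attribute [local instance] MvPolynomial.gradedAlgebra
variable {k A : Type u} [Field k] [CommRing A] [Algebra k A] {δ : Derivation k A A}

lemma irrelevant_le_span_X {n : ℕ} {K : Type u} [CommRing K] :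
    (HomogeneousIdeal.irrelevant (homogeneousCoordinates n K)).toIdeal ≤
      Ideal.span (Set.range MvPolynomial.X) := by
  rw [HomogeneousIdeal.toIdeal_irrelevant_le]
  intro i hi q hq
  change q ∈ Ideal.span _
  rw [← Set.image_univ, MvPolynomial.mem_ideal_span_X_image]
  intro m hm
  by_contra! h
  have hm0 : m = 0 := Finsupp.ext fun j => h j trivial
  have := (MvPolynomial.mem_homogeneousSubmodule i q).mp hq (MvPolynomial.mem_support_iff.mp hm)
  rw [hm0, map_zero] at this
  exact hi.ne this

namespace Trivialization
variable (τ : Trivialization δ)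

/-- The slice and `υ` map to the two coordinates, which generate the irrelevant ideal. So the
induced morphism is defined on the whole projective line. -/
lemma irrelevant_le :
    HomogeneousIdeal.irrelevant (homogeneousCoordinates 1 (FractionRing (kernel δ))) ≤
      (HomogeneousIdeal.irrelevant (reesGrading δ)).map τ.hom := by
  change (HomogeneousIdeal.irrelevant (homogeneousCoordinates 1 _)).toIdeal ≤
    ((HomogeneousIdeal.irrelevant (reesGrading δ)).map τ.hom).toIdeal
  refine irrelevant_le_span_X.trans (Ideal.span_le.mpr ?_)
  have h : ∀ r ∈ reesGrading δ 1, τ.hom r ∈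
      ((HomogeneousIdeal.irrelevant (reesGrading δ)).map τ.hom).toIdeal := fun r hr =>
    Ideal.mem_map_of_mem _ (HomogeneousIdeal.mem_irrelevant_of_mem _ one_pos hr)
  rintro _ ⟨i, rfl⟩
  fin_cases i
  · have := h _ τ.slice_mem
    rwa [τ.map_slice] at this
  · have := h _ upsilon_mem
    rwa [τ.map_upsilon] at this

/-- The morphism from the projective line over the field of invariants to `Y`. -/
noncomputable def lineMap : ProjectiveSpace 1 (FractionRing (kernel δ)) ⟶ reesProj δ :=
  Proj.map τ.hom τ.irrelevant_le

lemma mem_of_hom_mem {n : ℕ} {r : reesAlgebra δ}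
    (h : τ.hom r ∈ homogeneousCoordinates 1 (FractionRing (kernel δ)) n) :
    r ∈ reesGrading δ n := by
  have e : τ.hom (DirectSum.decompose (reesGrading δ) r n : reesAlgebra δ) = τ.hom r := by
    rw [GradedRingHom.map_directSumDecompose, DirectSum.decompose_of_mem_same _ h]
  rw [← τ.injective e]
  exact Subtype.property _

/-- The structure map of the chart of projective space at a homogeneous element. -/
noncomputable def _root_.ReesFibration.coefficientsToAway {n : ℕ} {K : Type u} [CommRing K]
    (f : MvPolynomial (Fin (n + 1)) K) : K →+* Away (homogeneousCoordinates n K) f :=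
  (fromZeroRingHom (homogeneousCoordinates n K) _).comp
    (algebraMap K (homogeneousCoordinates n K 0))

lemma _root_.ReesFibration.val_coefficientsToAway {n : ℕ} {K : Type u} [CommRing K]
    (f : MvPolynomial (Fin (n + 1)) K) (c : K) :
    (coefficientsToAway f c).val =
      algebraMap (MvPolynomial (Fin (n + 1)) K) (Localization.Away f) (MvPolynomial.C c) := rfl

lemma _root_.ReesFibration.awayι_toSpec {n : ℕ} {K : Type u} [CommRing K]
    {f : MvPolynomial (Fin (n + 1)) K} {m : ℕ} (hf : f ∈ homogeneousCoordinates n K m)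
    (hm : 0 < m) : Proj.awayι (homogeneousCoordinates n K) f hf hm ≫ ProjectiveSpace.toSpec n K =
      Spec.map (CommRingCat.ofHom (coefficientsToAway f)) := by
  rw [ProjectiveSpace.toSpec]
  erw [Proj.awayι_toSpecZero_assoc]
  rw [← Spec.map_comp]
  rfl

lemma awayMap_comp (f : reesAlgebra δ) : (Away.map τ.hom f).comp (kernelToAway f) =
    (coefficientsToAway (τ.hom f)).comp (algebraMap (kernel δ) (FractionRing (kernel δ))) := by
  ext c
  change Localization.mk (τ.hom (kernelToRees δ c)) ⟨τ.hom 1, _⟩ =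
    Localization.mk (MvPolynomial.C (algebraMap _ _ c)) 1
  simp only [τ.map_const, map_one]
  rfl

variable [IsDomain A]

lemma awayMap_injective {m : ℕ} {f : reesAlgebra δ} (hf : f ∈ reesGrading δ m) :
    Function.Injective (Away.map τ.hom f) := by
  by_cases hf0 : f = 0
  · have := HomogeneousLocalization.subsingleton (reesGrading δ) (x := Submonoid.powers f)
      ⟨1, by simp [hf0]⟩
    exact Function.injective_of_subsingleton _
  rw [injective_iff_map_eq_zero]
  intro z hz
  obtain ⟨n, a, ha, rfl⟩ := Away.mk_surjective _ hf z
  rw [Away.map_mk] at hz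
  have h := congrArg HomogeneousLocalization.val hz
  have hf0' : τ.hom f ≠ 0 := fun h => hf0 (τ.injective (h.trans (map_zero _).symm))
  rw [Away.val_mk, val_zero, Localization.mk_eq_mk', IsLocalization.mk'_eq_zero_iff] at h
  obtain ⟨⟨_, j, rfl⟩, h⟩ := h
  have ha0 : a = 0 := τ.injective (((mul_eq_zero.mp h).resolve_left
    (pow_ne_zero _ hf0')).trans (map_zero _).symm)
  subst ha0
  exact mk_eq_zero_of_num _ rfl

/-- The chart ring of the line is the localization of the chart ring of `Y` at the nonzero
invariants: a fraction over `K` needs only its numerator cleared of denominators, and no kernel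
arises by injectivity. Such a localization is the base change from `A₀` to `K`. -/
lemma isPushout_away {m : ℕ} {f : reesAlgebra δ} (hf : f ∈ reesGrading δ m) :
    IsPushout (CommRingCat.ofHom (kernelToAway f))
      (CommRingCat.ofHom (algebraMap (kernel δ) (FractionRing (kernel δ))))
      (CommRingCat.ofHom (Away.map τ.hom f))
      (CommRingCat.ofHom (coefficientsToAway (τ.hom f))) := by
  let _ : Algebra (Away (reesGrading δ) f)
      (Away (homogeneousCoordinates 1 (FractionRing (kernel δ))) (τ.hom f)) :=
    (Away.map τ.hom f).toAlgebra
  have hcomp : ∀ c, Away.map τ.hom f (kernelToAway f c) =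
      coefficientsToAway (τ.hom f) (algebraMap _ _ c) := fun c =>
    congrArg (fun g => g c) (τ.awayMap_comp f)
  have : IsLocalization ((nonZeroDivisors (kernel δ)).map (kernelToAway f))
      (Away (homogeneousCoordinates 1 (FractionRing (kernel δ))) (τ.hom f)) := by
    refine ⟨?_, ?_, ?_⟩
    · rintro ⟨_, c, hc, rfl⟩
      change IsUnit (Away.map τ.hom f (kernelToAway f c))
      rw [hcomp]
      exact (IsLocalization.map_units (FractionRing (kernel δ)) ⟨c, hc⟩).map
        (coefficientsToAway (τ.hom f))
    · intro z
      obtain ⟨n, q, hq, rfl⟩ := Away.mk_surjective _ (τ.hom.2 hf) z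
      obtain ⟨c, hc, r, hr⟩ := τ.exists_mul_eq q
      have hr' : r ∈ reesGrading δ (n • m) := by
        refine τ.mem_of_hom_mem ?_
        rw [← hr]
        have := (MvPolynomial.isHomogeneous_C (Fin 2) (algebraMap _ (FractionRing (kernel δ)) c)).mul
          hq
        rwa [zero_add] at this
      refine ⟨⟨Away.mk _ hf n r hr', ⟨_, c, mem_nonZeroDivisors_of_ne_zero hc, rfl⟩⟩, ?_⟩
      change _ * Away.map τ.hom f (kernelToAway f c) = Away.map τ.hom f _
      rw [hcomp, Away.map_mk]
      apply val_injective
      rw [val_mul, val_coefficientsToAway, Away.val_mk, Away.val_mk, ← hr,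
        ← Localization.mk_one_eq_algebraMap, Localization.mk_mul, mul_one, mul_comm q]
      rfl
    · intro x y h
      exact ⟨1, by rw [τ.awayMap_injective hf h]⟩
  exact CommRingCat.isPushout_of_isLocalization (kernelToAway f) (coefficientsToAway (τ.hom f))
    (τ.awayMap_comp f).symm (nonZeroDivisors (kernel δ))

lemma isPullback_lineMap : IsPullback τ.lineMap
    (ProjectiveSpace.toSpec 1 (FractionRing (kernel δ))) (reesProj.π δ)
    (Spec.map (CommRingCat.ofHom (algebraMap (kernel δ) (FractionRing (kernel δ))))) := by
  refine isPullback_of_charts _ _ _ _ (Proj.affineOpenCover (reesGrading δ)).openCover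
    fun i => ?_
  have hm : 0 < i.1.1 := i.1.2
  have hf : i.2.1 ∈ reesGrading δ i.1.1 := i.2.2
  have h1 : IsPullback (Spec.map (CommRingCat.ofHom (Away.map τ.hom i.2.1)))
      (Proj.awayι (homogeneousCoordinates 1 (FractionRing (kernel δ))) (τ.hom i.2.1)
        (τ.hom.2 hf) hm)
      (Proj.awayι (reesGrading δ) i.2.1 hf hm) (Proj.map τ.hom τ.irrelevant_le) := by
    refine IsOpenImmersion.isPullback _ _ _ _
      (Proj.awayι_comp_map τ.hom τ.irrelevant_le hm i.2.1 hf) ?_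
    rw [Proj.opensRange_awayι, Proj.opensRange_awayι]
    rfl
  have h2 := isPullback_SpecMap_of_isPushout _ _ _ _ (τ.isPushout_away hf)
  rw [← awayι_π hf hm, ← awayι_toSpec (τ.hom.2 hf) hm] at h2
  exact ⟨_, _, _, h1, h2⟩

end Trivialization
end GenericFiber

/-! ### Morphisms of `Proj` from homomorphisms that multiply degrees -/

section DegreeMultiplying
open HomogeneousLocalization Limits

variable {A B : Type u} {σ τ : Type*} [CommRing A] [CommRing B] [SetLike σ A]
  [AddSubgroupClass σ A] [SetLike τ B] [AddSubgroupClass τ B] {𝒜 : ℕ → σ} {ℬ : ℕ → τ}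
  [GradedRing 𝒜] [GradedRing ℬ] {ψ : A →+* B} {d : ℕ}

/-- A ring homomorphism that multiplies degrees by `d` acts on homogeneous fractions. -/
noncomputable def degreeMultiplyingAwayMap (hψ : ∀ m, ∀ a ∈ 𝒜 m, ψ a ∈ ℬ (d * m)) (f : A) :
    Away 𝒜 f →+* Away ℬ (ψ f) :=
  have hle : Submonoid.powers f ≤ (Submonoid.powers (ψ f)).comap ψ := by
    rintro _ ⟨n, rfl⟩; exact ⟨n, (map_pow ψ f n).symm⟩
  { toFun := Quotient.map'
      (fun x ↦ ⟨d * x.1, ⟨ψ x.2, hψ _ _ x.2.2⟩, ⟨ψ x.3, hψ _ _ x.3.2⟩, hle x.4⟩)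
      fun x y (e : x.embedding = y.embedding) ↦ by
        apply_fun IsLocalization.map (Localization (Submonoid.powers (ψ f))) ψ hle at e
        simp_rw [NumDenSameDeg.embedding, Localization.mk_eq_mk',
          IsLocalization.map_mk', ← Localization.mk_eq_mk'] at e
        exact e
    map_add' := Quotient.ind₂' fun x y ↦ by
      apply val_injective
      refine Eq.trans ?_ (val_add _ _).symm
      change Localization.mk (ψ (x.den * y.num + y.den * x.num)) ⟨ψ (x.den * y.den), _⟩ =
        Localization.mk (ψ x.num) ⟨ψ x.den, _⟩ + Localization.mk (ψ y.num) ⟨ψ y.den, _⟩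
      rw [Localization.add_mk]
      simp only [map_add, map_mul]
      rfl
    map_mul' := Quotient.ind₂' fun x y ↦ by
      apply val_injective
      refine Eq.trans ?_ (val_mul _ _).symm
      change Localization.mk (ψ (x.num * y.num)) ⟨ψ (x.den * y.den), _⟩ =
        Localization.mk (ψ x.num) ⟨ψ x.den, _⟩ * Localization.mk (ψ y.num) ⟨ψ y.den, _⟩
      rw [Localization.mk_mul]
      simp only [map_mul]
      rfl
    map_zero' := by
      apply val_injective
      change Localization.mk (ψ 0) ⟨ψ 1, _⟩ = _
      rw [map_zero, Localization.mk_zero]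
      exact val_zero.symm
    map_one' := by
      apply val_injective
      change Localization.mk (ψ 1) ⟨ψ 1, _⟩ = _
      rw [Localization.mk_self ⟨ψ 1, _⟩]
      exact val_one.symm }

variable (hψ : ∀ m, ∀ a ∈ 𝒜 m, ψ a ∈ ℬ (d * m))

lemma val_degreeMultiplyingAwayMap_mk {m : ℕ} {f : A} (hf : f ∈ 𝒜 m) (n : ℕ) (a : A)
    (ha : a ∈ 𝒜 (n • m)) : (degreeMultiplyingAwayMap hψ f (Away.mk 𝒜 hf n a ha)).val =
      Localization.mk (ψ a) (⟨ψ f ^ n, n, rfl⟩ : Submonoid.powers (ψ f)) := by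
  change Localization.mk (ψ a) ⟨ψ (f ^ n), _⟩ = _
  simp only [map_pow]

lemma degreeMultiplyingAwayMap_comp_awayMap {m m' : ℕ} {f g x : A} (hf : f ∈ 𝒜 m)
    (hg : g ∈ 𝒜 m') (hx : x = f * g) (hx' : ψ x = ψ f * ψ g) :
    (degreeMultiplyingAwayMap hψ x).comp (awayMap 𝒜 hg hx) =
      (awayMap ℬ (hψ _ _ hg) hx').comp (degreeMultiplyingAwayMap hψ f) := by
  ext z
  obtain ⟨n, a, ha, rfl⟩ := Away.mk_surjective 𝒜 hf z
  rw [RingHom.comp_apply, RingHom.comp_apply, awayMap_mk, val_degreeMultiplyingAwayMap_mk]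
  have ha' : ψ a ∈ ℬ (n • (d * m)) := by
    have := hψ _ _ ha
    rwa [show d * n • m = n • (d * m) by simp only [smul_eq_mul]; ring] at this
  have h : degreeMultiplyingAwayMap hψ f (Away.mk 𝒜 hf n a ha) =
      Away.mk ℬ (hψ _ _ hf) n (ψ a) ha' := val_injective _ (by
    rw [val_degreeMultiplyingAwayMap_mk, Away.val_mk])
  rw [h, awayMap_mk, Away.val_mk]
  simp only [map_mul, map_pow]

/-- The element that cuts out `D₊(g)` in `D₊(f)` is `g ^ deg f / f ^ deg g`. Multiplying degrees by
`d` multiplies both exponents by `d`, whence the `d`-th power. -/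
lemma degreeMultiplyingAwayMap_isLocalizationElem {m m' : ℕ} {f g : A} (hf : f ∈ 𝒜 m)
    (hg : g ∈ 𝒜 m') : Away.isLocalizationElem (hψ _ _ hf) (hψ _ _ hg) =
      degreeMultiplyingAwayMap hψ f (Away.isLocalizationElem hf hg) ^ d := by
  apply val_injective
  rw [Away.isLocalizationElem, Away.isLocalizationElem, val_pow, val_degreeMultiplyingAwayMap_mk,
    Away.val_mk, Localization.mk_pow]
  congr 1
  · simp only [map_pow, ← pow_mul, mul_comm d]
  · exact Subtype.ext ((congrArg (ψ f ^ ·) (mul_comm d m')).trans (pow_mul _ _ _))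

variable {ι : Type*} {f : ι → A} {m : ι → ℕ} (hf : ∀ i, f i ∈ 𝒜 (m i)) (hm : ∀ i, 0 < m i)
  (hd : 0 < d) (hcov : ⨆ i, Proj.basicOpen ℬ (ψ (f i)) = ⊤)

/-- The standard affine charts of `Proj` at homogeneous elements without common zeros. -/
noncomputable def awayCover {ι : Type*} {f : ι → A} {m : ι → ℕ} (hf : ∀ i, f i ∈ 𝒜 (m i))
    (hm : ∀ i, 0 < m i) (hcov : ⨆ i, Proj.basicOpen 𝒜 (f i) = ⊤) : (Proj 𝒜).AffineOpenCover where
  I₀ := ι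
  X i := .of (Away 𝒜 (f i))
  f i := Proj.awayι 𝒜 (f i) (hf i) (hm i)
  idx x := (Opens.mem_iSup.mp (hcov.ge (Set.mem_univ x))).choose
  covers x := by
    change x ∈ (Proj.awayι 𝒜 _ _ _).opensRange
    rw [Proj.opensRange_awayι]
    exact (Opens.mem_iSup.mp (hcov.ge (Set.mem_univ x))).choose_spec

/-- A ring homomorphism multiplying degrees by `d` induces a morphism of projective spectra,
if the images of some homogeneous elements have no common zeros. -/
noncomputable def degreeMultiplyingProjMap : Proj ℬ ⟶ Proj 𝒜 :=
  Scheme.Cover.glueMorphisms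
    (awayCover (fun i => hψ _ _ (hf i)) (fun i => Nat.mul_pos hd (hm i)) hcov).openCover
    (fun i => Spec.map (CommRingCat.ofHom (degreeMultiplyingAwayMap hψ (f i))) ≫
      Proj.awayι 𝒜 (f i) (hf i) (hm i)) (fun i j => by
    have h1 := congrArg (fun g => Spec.map (CommRingCat.ofHom g))
      (degreeMultiplyingAwayMap_comp_awayMap hψ (hf i) (hf j) rfl (map_mul ψ _ _))
    have h2 := congrArg (fun g => Spec.map (CommRingCat.ofHom g))
      (degreeMultiplyingAwayMap_comp_awayMap hψ (hf j) (hf i) (mul_comm _ _)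
        ((map_mul ψ (f i) (f j)).trans (mul_comm _ _)))
    simp only [CommRingCat.ofHom_comp, Spec.map_comp] at h1 h2
    have key : pullback.fst (Proj.awayι ℬ (ψ (f i)) (hψ _ _ (hf i)) (Nat.mul_pos hd (hm i)))
        (Proj.awayι ℬ (ψ (f j)) (hψ _ _ (hf j)) (Nat.mul_pos hd (hm j))) ≫
        Spec.map (CommRingCat.ofHom (degreeMultiplyingAwayMap hψ (f i))) ≫
          Proj.awayι 𝒜 (f i) (hf i) (hm i) = pullback.snd _ _ ≫
        Spec.map (CommRingCat.ofHom (degreeMultiplyingAwayMap hψ (f j))) ≫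
          Proj.awayι 𝒜 (f j) (hf j) (hm j) := by
      rw [← cancel_epi (Proj.pullbackAwayιIso ℬ (hψ _ _ (hf i)) (Nat.mul_pos hd (hm i))
        (hψ _ _ (hf j)) (Nat.mul_pos hd (hm j)) (map_mul ψ _ _)).inv,
        Proj.pullbackAwayιIso_inv_fst_assoc, Proj.pullbackAwayιIso_inv_snd_assoc,
        ← reassoc_of% h1, ← reassoc_of% h2, Proj.SpecMap_awayMap_awayι, Proj.SpecMap_awayMap_awayι]
      rfl
    exact key)

lemma awayι_degreeMultiplyingProjMap (i : ι) :
    Proj.awayι ℬ (ψ (f i)) (hψ _ _ (hf i)) (Nat.mul_pos hd (hm i)) ≫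
      degreeMultiplyingProjMap hψ hf hm hd hcov =
    Spec.map (CommRingCat.ofHom (degreeMultiplyingAwayMap hψ (f i))) ≫
      Proj.awayι 𝒜 (f i) (hf i) (hm i) :=
  Scheme.Cover.ι_glueMorphisms
    (awayCover (fun i => hψ _ _ (hf i)) (fun i => Nat.mul_pos hd (hm i)) hcov).openCover _ _ i

/-- On each chart `D₊(ψ (f j))` both sides are basic open sets, of an element and of its `d`-th
power. -/
lemma degreeMultiplyingProjMap_preimage (i : ι) :
    degreeMultiplyingProjMap hψ hf hm hd hcov ⁻¹ᵁ Proj.basicOpen 𝒜 (f i) =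
      Proj.basicOpen ℬ (ψ (f i)) := by
  ext x
  obtain ⟨j, hj⟩ := Opens.mem_iSup.mp (hcov.ge (Set.mem_univ x))
  have hj' := hj
  rw [← Proj.opensRange_awayι ℬ (ψ (f j)) (hψ _ _ (hf j)) (Nat.mul_pos hd (hm j))] at hj'
  obtain ⟨y, rfl⟩ := hj'
  have h1 := congrArg (fun U => y ∈ U) (Proj.awayι_preimage_basicOpen ℬ (hψ _ _ (hf j))
    (Nat.mul_pos hd (hm j)) (hψ _ _ (hf i)) (Nat.mul_pos hd (hm i)))
  have h2 := congrArg (fun U => (Spec.map (CommRingCat.ofHom (degreeMultiplyingAwayMap hψ (f j)))) y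
    ∈ U) (Proj.awayι_preimage_basicOpen 𝒜 (hf j) (hm j) (hf i) (hm i))
  have h3 := congrArg (fun g => g y) (congrArg (fun g : _ ⟶ _ => (g : _ → _)) (awayι_degreeMultiplyingProjMap hψ hf hm hd hcov j))
  rw [degreeMultiplyingAwayMap_isLocalizationElem hψ (hf j) (hf i), PrimeSpectrum.basicOpen_pow _ _ hd] at h1
  change (degreeMultiplyingProjMap hψ hf hm hd hcov (_) ∈ Proj.basicOpen 𝒜 (f i)) ↔ _
  refine Iff.trans ?_ h1.to_iff.symm
  refine Iff.trans ?_ h2.to_iff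
  simp only [Scheme.Hom.comp_apply] at h3
  rw [h3]
  rfl

/-- The sets `D₊(f i)` need not cover the target, but they contain the image, and over each of them
the morphism is `Spec` of a surjection. -/
lemma isPreimmersion_degreeMultiplyingProjMap
    (hs : ∀ i, Function.Surjective (degreeMultiplyingAwayMap hψ (f i))) :
    IsPreimmersion (degreeMultiplyingProjMap hψ hf hm hd hcov) := by
  have : MorphismProperty.RespectsRight @IsPreimmersion @IsOpenImmersion :=
    ⟨fun i (_ : IsOpenImmersion i) g (_ : IsPreimmersion g) => inferInstance⟩
  refine IsZariskiLocalAtTarget.of_range_subset_iSup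
    (fun i => (Proj.awayι 𝒜 (f i) (hf i) (hm i)).opensRange) ?_ fun i => ?_
  · rintro _ ⟨x, rfl⟩
    obtain ⟨i, hi⟩ := Opens.mem_iSup.mp (hcov.ge (Set.mem_univ x))
    refine Opens.mem_iSup.mpr ⟨i, ?_⟩
    rw [Proj.opensRange_awayι]
    rw [← degreeMultiplyingProjMap_preimage hψ hf hm hd hcov i] at hi
    exact hi
  · have hiso : MorphismProperty.RespectsIso @IsPreimmersion.{u} :=
      MorphismProperty.IsStableUnderBaseChange.respectsIso
    have h : IsPullback (Spec.map (CommRingCat.ofHom (degreeMultiplyingAwayMap hψ (f i))))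
        (Proj.awayι ℬ (ψ (f i)) (hψ _ _ (hf i)) (Nat.mul_pos hd (hm i)))
        (Proj.awayι 𝒜 (f i) (hf i) (hm i)) (degreeMultiplyingProjMap hψ hf hm hd hcov) := by
      refine IsOpenImmersion.isPullback _ _ _ _
        (awayι_degreeMultiplyingProjMap hψ hf hm hd hcov i) ?_
      rw [Proj.opensRange_awayι, Proj.opensRange_awayι]
      exact degreeMultiplyingProjMap_preimage hψ hf hm hd hcov i
    have h' : IsClosedImmersion
        (Spec.map (CommRingCat.ofHom (degreeMultiplyingAwayMap hψ (f i)))) :=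
      IsClosedImmersion.spec_of_surjective _ (hs i)
    refine (MorphismProperty.arrow_mk_iso_iff (P := @IsPreimmersion.{u})
      (morphismRestrictOpensRange _ _)).mpr ?_
    refine (MorphismProperty.cancel_left_of_respectsIso (P := @IsPreimmersion.{u})
      h.flip.isoPullback.hom _).mp ?_
    rw [h.flip.isoPullback_hom_snd]
    infer_instance

/-- Closedness of the image cannot be tested on charts that do not cover the target; properness
supplies it. -/
lemma isClosedImmersion_degreeMultiplyingProjMap
    (hs : ∀ i, Function.Surjective (degreeMultiplyingAwayMap hψ (f i)))
    [IsProper (degreeMultiplyingProjMap hψ hf hm hd hcov)] :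
    IsClosedImmersion (degreeMultiplyingProjMap hψ hf hm hd hcov) :=
  have := isPreimmersion_degreeMultiplyingProjMap hψ hf hm hd hcov hs
  .of_isPreimmersion _ (degreeMultiplyingProjMap hψ hf hm hd hcov).isClosedMap.isClosed_range

end DegreeMultiplying

/-! ### Generators of the chart rings in one common degree -/

section Generators
open HomogeneousLocalization

variable {R : Type u} [CommRing R] {σ : Type*} [SetLike σ R] [AddSubgroupClass σ R]
  (𝒜 : ℕ → σ) [GradedRing 𝒜]

/-- Finitely many fractions have a common denominator, and any larger power of `f` serves as well.
-/
lemma exists_away_mk_eq {f : R} {d : ℕ} (hf : f ∈ 𝒜 d) (T : Finset (Away 𝒜 f)) :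
    ∃ N₀, ∀ N ≥ N₀, ∀ t ∈ T, ∃ (z : R) (hz : z ∈ 𝒜 (N • d)), t = Away.mk 𝒜 hf N z hz := by
  classical
  choose n z hz h using fun t => Away.mk_surjective 𝒜 hf t
  refine ⟨T.sup n, fun N hN t ht => ⟨f ^ (N - n t) * z t, ?_, ?_⟩⟩
  · have hle : n t ≤ N := (Finset.le_sup ht).trans hN
    have := SetLike.mul_mem_graded (SetLike.pow_mem_graded (N - n t) hf) (hz t)
    rwa [← add_smul, Nat.sub_add_cancel hle] at this
  · have hle : n t ≤ N := (Finset.le_sup ht).trans hN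
    apply val_injective
    conv_lhs => rw [← h t]
    rw [Away.val_mk, Away.val_mk, Localization.mk_eq_mk_iff, Localization.r_iff_exists]
    refine ⟨1, ?_⟩
    simp only [OneMemClass.coe_one, one_mul, ← mul_assoc, ← pow_add, Nat.add_sub_cancel' hle]

lemma awayMap_pow_surjective {g : R} {L : ℕ} (hg : g ∈ 𝒜 L) (M : ℕ) :
    Function.Surjective (awayMap 𝒜 (SetLike.pow_mem_graded M hg) (pow_succ' g M)) := by
  intro w
  obtain ⟨n, a, ha, rfl⟩ := Away.mk_surjective 𝒜 (SetLike.pow_mem_graded (M + 1) hg) w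
  refine ⟨Away.mk 𝒜 hg (n * (M + 1)) a (by rwa [mul_smul]), ?_⟩
  apply val_injective
  rw [awayMap_mk, Away.val_mk, Away.val_mk, Localization.mk_eq_mk_iff, Localization.r_iff_exists]
  refine ⟨1, ?_⟩
  change 1 * ((g ^ (M + 1)) ^ n * (a * (g ^ M) ^ (n * (M + 1)))) =
    1 * ((g ^ (M + 1)) ^ (n * (M + 1)) * a)
  ring

lemma val_awayMap_pow_mk {g : R} {L : ℕ} (hg : g ∈ 𝒜 L) (M : ℕ) (z : R)
    (hz : z ∈ 𝒜 ((M + 1) • L)) :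
    (awayMap 𝒜 (SetLike.pow_mem_graded M hg) (pow_succ' g M) (Away.mk 𝒜 hg (M + 1) z hz)).val =
      Localization.mk z ⟨g ^ (M + 1), Submonoid.mem_powers _⟩ := by
  rw [awayMap_mk, Away.val_mk, Localization.mk_eq_mk_iff, Localization.r_iff_exists]
  refine ⟨1, ?_⟩
  change 1 * (g ^ (M + 1) * (z * (g ^ M) ^ (M + 1))) = 1 * ((g ^ (M + 1)) ^ (M + 1) * z)
  ring

lemma adjoin_away_pow_eq_top {g : R} {L : ℕ} (hg : g ∈ 𝒜 L) (M : ℕ) {T : Set (Away 𝒜 g)}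
    (hT : Algebra.adjoin (𝒜 0) T = ⊤) (S : Set R)
    (h : ∀ t ∈ T, ∃ (z : R) (hz : z ∈ 𝒜 ((M + 1) • L)), z ∈ S ∧ t = Away.mk 𝒜 hg (M + 1) z hz) :
    Algebra.adjoin (𝒜 0) {w : Away 𝒜 (g ^ (M + 1)) |
        ∃ y ∈ S, w.val = Localization.mk y ⟨g ^ (M + 1), Submonoid.mem_powers _⟩} = ⊤ := by
  rw [eq_top_iff, ← (AlgHom.range_eq_top (awayMapₐ 𝒜 (SetLike.pow_mem_graded M hg)
    (pow_succ' g M))).mpr (awayMap_pow_surjective 𝒜 hg M), ← Algebra.map_top, ← hT,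
    AlgHom.map_adjoin]
  refine Algebra.adjoin_mono ?_
  rintro _ ⟨t, ht, rfl⟩
  obtain ⟨z, hz, hzS, rfl⟩ := h t ht
  exact ⟨z, hzS, val_awayMap_pow_mk 𝒜 hg M z hz⟩

/-- Replacing `g` by `g ^ (M + 1)` preserves the chart and makes the generators of its ring
fractions with denominator exactly that element. Every large `M` works, so that one exponent can
serve several charts. -/
lemma exists_generators_away_pow [Algebra.FiniteType (𝒜 0) R] {g : R} {L : ℕ} (hg : g ∈ 𝒜 L) :
    ∃ N, ∀ M ≥ N, ∃ S : Finset R, (∀ y ∈ S, y ∈ 𝒜 ((M + 1) • L)) ∧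
      Algebra.adjoin (𝒜 0) {w : Away 𝒜 (g ^ (M + 1)) |
        ∃ y ∈ S, w.val = Localization.mk y ⟨g ^ (M + 1), Submonoid.mem_powers _⟩} = ⊤ := by
  classical
  obtain ⟨T, hT⟩ := (Away.finiteType (𝒜 := 𝒜) g L hg).out
  obtain ⟨N, hN⟩ := exists_away_mk_eq 𝒜 hg T
  refine ⟨N, fun M hM => ?_⟩
  have h : ∀ t : T, ∃ z : R, ∃ hz : z ∈ 𝒜 ((M + 1) • L), t.1 = Away.mk 𝒜 hg (M + 1) z hz :=
    fun t => hN (M + 1) (hM.trans M.le_succ) t.1 t.2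
  choose z hz h using h
  refine ⟨Finset.univ.image z, fun y hy => ?_, ?_⟩
  · obtain ⟨t, -, rfl⟩ := Finset.mem_image.mp hy
    exact hz _
  · have := adjoin_away_pow_eq_top 𝒜 hg M hT (Finset.univ.image z) fun t ht =>
      ⟨z ⟨t, ht⟩, hz ⟨t, ht⟩, Finset.mem_coe.mpr (Finset.mem_image_of_mem z (Finset.mem_univ _)),
        h ⟨t, ht⟩⟩
    exact this

/-- A finitely generated graded algebra has finitely many elements of one positive degree such that
the degree zero localizations at some of them cover `Proj`, and are generated by the fractions
with numerators among these elements. -/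
lemma exists_uniform_generators [Algebra.FiniteType (𝒜 0) R] :
    ∃ (D : ℕ) (S s : Finset R), 0 < D ∧ s ⊆ S ∧ (∀ y ∈ S, y ∈ 𝒜 D) ∧
      ⨆ g : s, Proj.basicOpen 𝒜 g.1 = ⊤ ∧
      ∀ g ∈ s, Algebra.adjoin (𝒜 0) {w : Away 𝒜 g |
        ∃ y ∈ S, w.val = Localization.mk y ⟨g, Submonoid.mem_powers g⟩} = ⊤ := by
  classical
  obtain ⟨s₀, hs₀, hs₀'⟩ := GradedAlgebra.exists_finset_adjoin_eq_top_and_homogeneous_ne_zero 𝒜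
  choose! d hd hxd using hs₀'
  -- Raising the generators to suitable powers brings them all to the common degree `L`.
  obtain ⟨L, hL, hdL⟩ : ∃ L > 0, ∀ x ∈ s₀, d x ∣ L :=
    ⟨∏ x ∈ s₀, d x, Finset.prod_pos fun x hx => Nat.pos_of_ne_zero (hd x hx),
      fun x hx => Finset.dvd_prod_of_mem d hx⟩
  let e : R → ℕ := fun x => L / d x
  have he : ∀ x ∈ s₀, 0 < e x := fun x hx =>
    Nat.div_pos (Nat.le_of_dvd hL (hdL x hx)) (Nat.pos_of_ne_zero (hd x hx))
  have hg : ∀ x ∈ s₀, x ^ e x ∈ 𝒜 L := fun x hx => by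
    have := SetLike.pow_mem_graded (e x) (hxd x hx)
    rwa [smul_eq_mul, Nat.div_mul_cancel (hdL x hx)] at this
  choose N hN using fun x : s₀ => exists_generators_away_pow 𝒜 (hg x x.2)
  set M := Finset.univ.sup N
  choose S hSM hS using fun x => hN x M (Finset.le_sup (Finset.mem_univ x))
  let s : Finset R := Finset.univ.image fun x : s₀ => (x.1 ^ e x) ^ (M + 1)
  refine ⟨(M + 1) * L, s ∪ Finset.univ.biUnion S, s, by positivity,
    Finset.subset_union_left, ?_, ?_, ?_⟩
  · intro y hy
    rcases Finset.mem_union.mp hy with hy | hy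
    · obtain ⟨x, -, rfl⟩ := Finset.mem_image.mp hy
      exact SetLike.pow_mem_graded (M + 1) (hg x x.2)
    · obtain ⟨x, -, hy⟩ := Finset.mem_biUnion.mp hy
      exact hSM x y hy
  · rw [eq_top_iff, ← Proj.iSup_basicOpen_eq_top' 𝒜 (ι := s₀) (↑) (fun i ↦ ⟨_, hxd _ i.2⟩)
      (by simpa using hs₀)]
    refine iSup_le fun x => le_iSup_of_le (⟨(x.1 ^ e x) ^ (M + 1),
      Finset.mem_image_of_mem _ (Finset.mem_univ x)⟩ : s) ?_
    change _ ≤ Proj.basicOpen 𝒜 ((x.1 ^ e x) ^ (M + 1))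
    rw [← pow_mul, Proj.basicOpen_pow _ _ _ (Nat.mul_pos (he x x.2) M.succ_pos)]
  · intro g hgs
    obtain ⟨x, -, rfl⟩ := Finset.mem_image.mp hgs
    rw [eq_top_iff, ← hS x]
    refine Algebra.adjoin_mono ?_
    rintro w ⟨y, hy, hw⟩
    exact ⟨y, Finset.mem_union_right _ (Finset.mem_biUnion.mpr ⟨x, Finset.mem_univ x, hy⟩), hw⟩

end Generators

/-! ### Projectivity of `π` -/

section Projective
open HomogeneousLocalization
attribute [local instance] MvPolynomial.gradedAlgebra
variable {k A : Type u} [Field k] [CommRing A] [Algebra k A] {δ : Derivation k A A}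

lemma eval₂_mem_grading {K R : Type u} [CommRing K] [CommRing R] {σ : Type*} [SetLike σ R]
    [AddSubgroupClass σ R] {𝒜 : ℕ → σ} [GradedRing 𝒜] {c : K →+* R} (hc : ∀ r, c r ∈ 𝒜 0)
    {n D : ℕ} {y : Fin (n + 1) → R} (hy : ∀ i, y i ∈ 𝒜 D) (m : ℕ)
    (q : MvPolynomial (Fin (n + 1)) K) (hq : q ∈ homogeneousCoordinates n K m) :
    MvPolynomial.eval₂Hom c y q ∈ 𝒜 (D * m) := by
  rw [MvPolynomial.coe_eval₂Hom, MvPolynomial.eval₂_eq']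
  refine sum_mem fun a ha => ?_
  have hdeg : ∑ i, a i = m := by
    have := (MvPolynomial.mem_homogeneousSubmodule m q).mp hq (MvPolynomial.mem_support_iff.mp ha)
    rw [← this, Finsupp.weight_apply, Finsupp.sum_fintype _ _ (by simp)]
    simp
  have h1 : ∏ i, y i ^ a i ∈ 𝒜 (∑ i, a i • D) :=
    SetLike.prod_mem_graded _ _ _ fun i _ => SetLike.pow_mem_graded (a i) (hy i)
  rw [← Finset.sum_smul, hdeg, smul_eq_mul, mul_comm] at h1
  have := SetLike.mul_mem_graded (hc (q.coeff a)) h1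
  rwa [zero_add] at this

lemma degreeMultiplyingAwayMap_coefficients {n D : ℕ} {y : Fin (n + 1) → reesAlgebra δ}
    (hψ : ∀ m, ∀ a ∈ homogeneousCoordinates n (kernel δ) m,
      MvPolynomial.eval₂Hom (kernelToRees δ) y a ∈ reesGrading δ (D * m))
    (f : MvPolynomial (Fin (n + 1)) (kernel δ)) :
    (degreeMultiplyingAwayMap hψ f).comp (coefficientsToAway f) = kernelToAway _ := by
  ext c
  change Localization.mk (MvPolynomial.eval₂Hom (kernelToRees δ) y (MvPolynomial.C c))
    ⟨MvPolynomial.eval₂Hom (kernelToRees δ) y 1, _⟩ = Localization.mk (kernelToRees δ c) 1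
  simp only [map_one, MvPolynomial.eval₂Hom_C]
  rfl

/-- The image contains the constants, and the fractions `y j / y i` as images of `x j / x i`; by
hypothesis these generate the chart ring. -/
lemma degreeMultiplyingAwayMap_surjective {n D : ℕ} {y : Fin (n + 1) → reesAlgebra δ}
    (hψ : ∀ m, ∀ a ∈ homogeneousCoordinates n (kernel δ) m,
      MvPolynomial.eval₂Hom (kernelToRees δ) y a ∈ reesGrading δ (D * m)) (i : Fin (n + 1))
    {S : Set (reesAlgebra δ)} (hS : S ⊆ Set.range y)
    (h : Algebra.adjoin (reesGrading δ 0) {w : Away (reesGrading δ)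
      (MvPolynomial.eval₂Hom (kernelToRees δ) y (MvPolynomial.X i)) | ∃ y ∈ S, w.val =
        Localization.mk y ⟨_, Submonoid.mem_powers _⟩} = ⊤) :
    Function.Surjective (degreeMultiplyingAwayMap hψ (MvPolynomial.X i)) := by
  intro w
  have hw : w ∈ Algebra.adjoin (reesGrading δ 0) {w : Away (reesGrading δ)
      (MvPolynomial.eval₂Hom (kernelToRees δ) y (MvPolynomial.X i)) | ∃ y ∈ S, w.val =
        Localization.mk y ⟨_, Submonoid.mem_powers _⟩} := h ▸ Algebra.mem_top
  change w ∈ (degreeMultiplyingAwayMap hψ (MvPolynomial.X i)).range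
  induction hw using Algebra.adjoin_induction with
  | mem w hw =>
    obtain ⟨_, hy, hw⟩ := hw
    obtain ⟨j, rfl⟩ := hS hy
    have hX : ∀ j : Fin (n + 1), MvPolynomial.X j ∈ homogeneousCoordinates n (kernel δ) 1 :=
      fun j => MvPolynomial.isHomogeneous_X _ j
    refine ⟨Away.mk _ (hX i) 1 (MvPolynomial.X j) (hX j), val_injective _ ?_⟩
    rw [val_degreeMultiplyingAwayMap_mk, hw]
    simp only [pow_one, MvPolynomial.eval₂Hom_X']
  | algebraMap r =>
    obtain ⟨c, rfl⟩ := kernelToDegreeZero_bijective.2 r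
    exact ⟨coefficientsToAway _ c, congrArg (fun g => g c)
      (degreeMultiplyingAwayMap_coefficients hψ (MvPolynomial.X i))⟩
  | add a b _ _ ha hb => exact add_mem ha hb
  | mul a b _ _ ha hb => exact mul_mem ha hb

/-- Prepending `0` guarantees at least one coordinate even for empty `S`; it is harmless since `0`
is homogeneous of every degree. -/
lemma exists_fin_range {R : Type u} [Zero R] (S : Finset R) :
    ∃ (n : ℕ) (y : Fin (n + 1) → R), Set.range y = insert 0 (S : Set R) := by
  refine ⟨S.card, Fin.cons 0 fun i => S.equivFin.symm i, ?_⟩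
  rw [Fin.range_cons]
  congr 1
  ext x
  constructor
  · rintro ⟨i, rfl⟩
    exact (S.equivFin.symm i).2
  · intro hx
    exact ⟨S.equivFin ⟨x, hx⟩, by simp⟩

instance isSeparated_toSpec (n : ℕ) (K : Type u) [CommRing K] :
    IsSeparated (ProjectiveSpace.toSpec n K) :=
  inferInstanceAs (IsSeparated (Proj.toSpecZero _ ≫ Spec.map _))

/-- The morphism from `Y` to projective space given by elements of one degree. -/
noncomputable def toProjectiveSpace {n D : ℕ} {y : Fin (n + 1) → reesAlgebra δ}
    (hψ : ∀ m, ∀ a ∈ homogeneousCoordinates n (kernel δ) m,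
      MvPolynomial.eval₂Hom (kernelToRees δ) y a ∈ reesGrading δ (D * m)) {ι : Type*}
    {f : ι → MvPolynomial (Fin (n + 1)) (kernel δ)} {m : ι → ℕ}
    (hf : ∀ i, f i ∈ homogeneousCoordinates n (kernel δ) (m i)) (hm : ∀ i, 0 < m i) (hD : 0 < D)
    (hcov : ⨆ i, Proj.basicOpen (reesGrading δ)
      (MvPolynomial.eval₂Hom (kernelToRees δ) y (f i)) = ⊤) :
    reesProj δ ⟶ ProjectiveSpace n (kernel δ) :=
  degreeMultiplyingProjMap hψ hf hm hD hcov

lemma toProjectiveSpace_toSpec {n D : ℕ} {y : Fin (n + 1) → reesAlgebra δ}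
    (hψ : ∀ m, ∀ a ∈ homogeneousCoordinates n (kernel δ) m,
      MvPolynomial.eval₂Hom (kernelToRees δ) y a ∈ reesGrading δ (D * m)) {ι : Type*}
    {f : ι → MvPolynomial (Fin (n + 1)) (kernel δ)} {m : ι → ℕ}
    (hf : ∀ i, f i ∈ homogeneousCoordinates n (kernel δ) (m i)) (hm : ∀ i, 0 < m i) (hD : 0 < D)
    (hcov : ⨆ i, Proj.basicOpen (reesGrading δ)
      (MvPolynomial.eval₂Hom (kernelToRees δ) y (f i)) = ⊤) :
    toProjectiveSpace hψ hf hm hD hcov ≫ ProjectiveSpace.toSpec n (kernel δ) =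
      reesProj.π δ := by
  refine (awayCover (fun i => hψ _ _ (hf i)) (fun i => Nat.mul_pos hD (hm i))
    hcov).openCover.hom_ext _ _ fun i => ?_
  have h1 := awayι_degreeMultiplyingProjMap hψ hf hm hD hcov i
  change _ ≫ toProjectiveSpace hψ hf hm hD hcov = _ ≫ (_ : _ ⟶ ProjectiveSpace n (kernel δ)) at h1
  have h2 := awayι_toSpec (hf i) (hm i)
  have h3 := awayι_π (hψ _ _ (hf i)) (Nat.mul_pos hD (hm i))
  have h4 := congrArg (fun g => Spec.map (CommRingCat.ofHom g))
    (degreeMultiplyingAwayMap_coefficients hψ (f i))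
  simp only [CommRingCat.ofHom_comp, Spec.map_comp] at h4
  have := congrArg (· ≫ ProjectiveSpace.toSpec n (kernel δ)) h1
  refine (Category.assoc _ _ _).symm.trans (this.trans ((Category.assoc _ _ _).trans ?_))
  exact (congrArg (_ ≫ ·) h2).trans (h4.trans h3.symm)

/-- The morphism to projective space is proper because `π` is proper and projective space is
separated over `Y₀`. -/
lemma isProjective_of_generators (hR : Algebra.FiniteType k (reesAlgebra δ)) {n D : ℕ} (hD : 0 < D)
    {y : Fin (n + 1) → reesAlgebra δ} (hy : ∀ i, y i ∈ reesGrading δ D) {I : Set (Fin (n + 1))}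
    (hcov : ⨆ i : I, Proj.basicOpen (reesGrading δ) (y i) = ⊤)
    {S : Set (reesAlgebra δ)} (hS : S ⊆ Set.range y)
    (h : ∀ i ∈ I, Algebra.adjoin (reesGrading δ 0) {w : Away (reesGrading δ) (y i) |
      ∃ z ∈ S, w.val = Localization.mk z ⟨_, Submonoid.mem_powers _⟩} = ⊤) :
    IsProjective (reesProj.π δ) := by
  have hψ := eval₂_mem_grading (c := kernelToRees δ) kernelToRees_mem hy
  have hf : ∀ i : I, MvPolynomial.X i.1 ∈ homogeneousCoordinates n (kernel δ) 1 :=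
    fun i => MvPolynomial.isHomogeneous_X _ i.1
  have hψX : ∀ i, MvPolynomial.eval₂Hom (kernelToRees δ) y (MvPolynomial.X i) = y i :=
    fun i => MvPolynomial.eval₂Hom_X' _ _ i
  have hcov' : ⨆ i : I, Proj.basicOpen (reesGrading δ) (MvPolynomial.eval₂Hom (kernelToRees δ) y
      (MvPolynomial.X i.1)) = ⊤ := by
    simpa only [hψX] using hcov
  have hΦ := toProjectiveSpace_toSpec hψ hf (fun _ => one_pos) hD hcov'
  have hproper := isProper_π hR
  rw [← hΦ] at hproper
  have : IsProper (toProjectiveSpace hψ hf (fun _ => one_pos) hD hcov') :=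
    IsProper.of_comp _ (ProjectiveSpace.toSpec n (kernel δ))
  have : IsProper (degreeMultiplyingProjMap hψ hf (fun _ => one_pos) hD hcov') := this
  refine ⟨n, _, isClosedImmersion_degreeMultiplyingProjMap hψ hf (fun _ => one_pos) hD hcov'
    fun i => degreeMultiplyingAwayMap_surjective hψ i.1 hS ?_, hΦ⟩
  have := h i.1 i.2
  rw [← hψX] at this
  exact this

lemma isProjective_π (hR : Algebra.FiniteType k (reesAlgebra δ)) :
    IsProjective (reesProj.π δ) := by
  have := finiteType_degreeZero hR
  obtain ⟨D, S, s, hD, hsS, hSD, hcov, hgen⟩ := exists_uniform_generators (reesGrading δ)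
  obtain ⟨n, y, hy⟩ := exists_fin_range S
  have hyD : ∀ i, y i ∈ reesGrading δ D := fun i => by
    have : y i ∈ insert 0 (S : Set (reesAlgebra δ)) := hy ▸ Set.mem_range_self i
    rcases this with h | h
    · rw [h]; exact zero_mem _
    · exact hSD _ h
  refine isProjective_of_generators hR hD hyD (I := {i | y i ∈ s}) ?_ (S := S) ?_
    fun i hi => hgen _ hi
  · rw [eq_top_iff, ← hcov]
    refine iSup_le fun g => ?_
    obtain ⟨i, hi⟩ : g.1 ∈ Set.range y := hy ▸ Set.mem_insert_of_mem _ (hsS g.2)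
    refine le_iSup_of_le ⟨i, show y i ∈ s from hi ▸ g.2⟩ ?_
    change _ ≤ Proj.basicOpen _ (y i)
    rw [← hi]
  · rw [hy]
    exact Set.subset_insert _ _

end Projective

/-! ### A noetherian normal domain as an intersection over primes of height one -/

section HeightOne

/-- An element of the fraction field of a noetherian normal domain that is not in the domain is
also not in the localization at some prime of height one. -/
lemma exists_height_eq_one {R K : Type*} [CommRing R] [IsDomain R] [IsNoetherianRing R]
    [IsIntegrallyClosed R] [Field K] [Algebra R K] [IsFractionRing R K] {h : K}
    (hh : h ∉ Set.range (algebraMap R K)) :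
    ∃ P : Ideal R, P.IsPrime ∧ P.height = 1 ∧
      ∀ s r, algebraMap R K s * h = algebraMap R K r → s ∈ P := by
  obtain ⟨a, b, hb, rfl⟩ := IsFractionRing.div_surjective (A := R) h
  have hb0 : b ≠ 0 := nonZeroDivisors.ne_zero hb
  have inj := IsFractionRing.injective R K
  have hbK : algebraMap R K b ≠ 0 := fun h => hb0 (inj (h.trans (map_zero _).symm))
  have ha : (Ideal.Quotient.mk (Ideal.span {b}) a) ≠ 0 := by
    rw [Ne, Ideal.Quotient.eq_zero_iff_mem, Ideal.mem_span_singleton]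
    rintro ⟨c, rfl⟩
    exact hh ⟨c, by rw [map_mul, mul_div_cancel_left₀ _ hbK]⟩
  -- The denominators of `h = a / b` form the annihilator of the class of `a` in `R / (b)`, which
  -- lies in an associated prime `P = (b : c)`.
  obtain ⟨P, hP, hle⟩ := exists_le_isAssociatedPrime_of_isNoetherianRing R _ ha
  rw [isAssociatedPrime_iff] at hP
  obtain ⟨hPp, y, hPy⟩ := hP
  obtain ⟨c, rfl⟩ := Ideal.Quotient.mk_surjective y
  have memP : ∀ r, r ∈ P ↔ b ∣ r * c := by
    intro r
    rw [hPy, Submodule.mem_colon_singleton, Submodule.mem_bot, ← Ideal.mem_span_singleton,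
      ← Ideal.Quotient.eq_zero_iff_mem]
    rfl
  have hbP : b ∈ P := (memP b).mpr (dvd_mul_right _ _)
  have hc : ¬ b ∣ c := fun hc => hPp.one_notMem ((memP 1).mpr (by rwa [one_mul]))
  have hmul : ∀ p ∈ P, ∃ q, algebraMap R K c / algebraMap R K b * algebraMap R K p =
      algebraMap R K q := fun p hp => by
    obtain ⟨q, hq⟩ := (memP p).mp hp
    refine ⟨q, ?_⟩
    rw [div_mul_eq_mul_div, div_eq_iff hbK, ← map_mul, ← map_mul, mul_comm c, hq, mul_comm]
  -- Here `(c / b) P ⊆ R`. If it were contained in `P`, then `c / b` would be integral, as it maps a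
  -- nonzero finitely generated module to itself; normality would put it in `R`, against `b ∤ c`.
  obtain ⟨p, hp, u, hu, hpu⟩ : ∃ p ∈ P, ∃ u ∉ P,
      algebraMap R K c / algebraMap R K b * algebraMap R K p = algebraMap R K u := by
    by_contra! hcon
    have hint : IsIntegral R (algebraMap R K c / algebraMap R K b) := by
      refine isIntegral_of_smul_mem_submodule (M := K)
        (Submodule.map (Algebra.linearMap R K) P) ?_
        ((IsNoetherian.noetherian P).map _) _ ?_
      · intro hbot
        have : algebraMap R K b ∈ Submodule.map (Algebra.linearMap R K) P := ⟨b, hbP, rfl⟩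
        rw [hbot] at this
        exact hbK this
      · rintro _ ⟨p, hp, rfl⟩
        obtain ⟨q, hq⟩ := hmul p hp
        refine ⟨q, ?_, hq.symm⟩
        by_contra hqP
        exact hcon p hp q hqP hq
    obtain ⟨d, hd⟩ := IsIntegrallyClosed.isIntegral_iff.mp hint
    rw [eq_div_iff hbK, ← map_mul] at hd
    exact hc ⟨d, by rw [mul_comm]; exact (inj hd).symm⟩
  -- For a prime `Q ⊆ P` containing `p` and for `q ∈ P`, the relation `u q = v p ∈ Q` with `u ∉ P`
  -- forces `q ∈ Q`. By Krull's principal ideal theorem `P` then has height at most one.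
  have hmin : P ∈ (Ideal.span {p}).minimalPrimes := by
    refine ⟨⟨hPp, (Ideal.span_singleton_le_iff_mem _).mpr hp⟩, ?_⟩
    rintro Q ⟨hQ, hpQ⟩ hQP q hq
    obtain ⟨v, hv⟩ := hmul q hq
    have : u * q = v * p := inj (by
      rw [map_mul, map_mul, ← hpu, ← hv]; ring)
    exact (hQ.mem_or_mem (this ▸ Q.mul_mem_left v ((Ideal.span_singleton_le_iff_mem _).mp hpQ)
      : u * q ∈ Q)).resolve_left fun huQ => hu (hQP huQ)
  refine ⟨P, hPp, le_antisymm (Ideal.height_le_one_of_isPrincipal_of_mem_minimalPrimes _ P hmin)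
    ?_, ?_⟩
  · rw [Order.one_le_iff_ne_zero, Ne, Ideal.height_eq_zero_iff_eq_bot]
    rintro rfl
    exact hb0 hbP
  · intro s r hsr
    refine hle ?_
    rw [Submodule.mem_colon_singleton, Submodule.mem_bot]
    change Ideal.Quotient.mk _ (s * a) = 0
    rw [Ideal.Quotient.eq_zero_iff_mem, Ideal.mem_span_singleton]
    refine ⟨r, inj ?_⟩
    rw [mul_div_assoc', div_eq_iff hbK] at hsr
    rw [map_mul, map_mul, hsr, mul_comm]

lemma mem_range_of_one_le_ordFrac {R K : Type*} [CommRing R] [IsDomain R]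
    [IsDiscreteValuationRing R] [Field K] [Algebra R K] [IsFractionRing R K] {h : K}
    (hh : 1 ≤ Ring.ordFrac R h) : h ∈ Set.range (algebraMap R K) := by
  rw [Ring.ordFrac_eq_valuation_inv] at hh
  refine IsDiscreteValuationRing.exists_lift_of_le_one ?_
  by_cases h0 : (IsDiscreteValuationRing.maximalIdeal R).valuation K h = 0
  · rw [h0]; exact zero_le_one
  · exact (one_le_inv₀ (zero_lt_iff.mpr h0)).mp hh

end HeightOne

/-! ### Rational functions without poles in codimension one are regular -/

section Hartogs
variable {X : Scheme.{u}} [IsIntegral X] [IsNormal X]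

lemma isIntegrallyClosed_section {U : X.Opens} (hU : IsAffineOpen U) [Nonempty U] :
    IsIntegrallyClosed Γ(X, U) := by
  refine IsIntegrallyClosed.of_localization_maximal fun p _ hp => ?_
  let y : PrimeSpectrum Γ(X, U) := ⟨p, inferInstance⟩
  have hy : hU.fromSpec y ∈ U := hU.range_fromSpec.le ⟨y, rfl⟩
  let _ := TopCat.Presheaf.algebra_section_stalk X.presheaf (⟨_, hy⟩ : U)
  have hloc : IsLocalization.AtPrime (X.presheaf.stalk (hU.fromSpec y)) p :=
    hU.isLocalization_stalk' y hy
  have := IsNormal.isIntegrallyClosed (hU.fromSpec y)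
  exact IsIntegrallyClosed.of_equiv
    (IsLocalization.algEquiv p.primeCompl (X.presheaf.stalk (hU.fromSpec y))
      (Localization.AtPrime p)).toRingEquiv

variable [IsLocallyNoetherian X]

/-- Otherwise some prime `P` of height one contains all denominators of `h`. It is a point of
codimension one whose stalk is a discrete valuation ring, and nonnegative order there produces a
denominator outside `P`. -/
lemma exists_section_affine {U : X.Opens} (hU : IsAffineOpen U) [Nonempty U] {h : X.functionField}
    (hh : ∀ x ∈ U, Order.coheight x = 1 → 0 ≤ Scheme.ord h x) :
    ∃ s : Γ(X, U), X.germToFunctionField U s = h := by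
  have := isIntegrallyClosed_section hU
  have := IsLocallyNoetherian.component_noetherian ⟨U, hU⟩
  have : IsFractionRing Γ(X, U) X.functionField := functionField_isFractionRing_of_isAffineOpen X U hU
  by_contra hcon
  have hne : h ∉ Set.range (algebraMap Γ(X, U) X.functionField) := hcon
  obtain ⟨P, hP, hP1, hPs⟩ := exists_height_eq_one hne
  let y : PrimeSpectrum Γ(X, U) := ⟨P, inferInstance⟩
  have hy : hU.fromSpec y ∈ U := hU.range_fromSpec.le ⟨y, rfl⟩
  let _ := TopCat.Presheaf.algebra_section_stalk X.presheaf (⟨_, hy⟩ : U)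
  have hloc : IsLocalization.AtPrime (X.presheaf.stalk (hU.fromSpec y)) P :=
    hU.isLocalization_stalk' y hy
  have hco : Order.coheight (hU.fromSpec y) = 1 := by
    have h1 := ringKrullDim_stalk_eq_coheight (hU.fromSpec y)
    rw [IsLocalization.AtPrime.ringKrullDim_eq_height P, hP1] at h1
    exact_mod_cast h1.symm
  have hdvr := isDiscreteValuationRing_stalk X _ hco
  have h0 : h ≠ 0 := by rintro rfl; exact hne ⟨0, map_zero _⟩
  have h1 := hh _ hy hco
  rw [Scheme.le_ord_iff hco h0] at h1
  obtain ⟨t, ht⟩ := mem_range_of_one_le_ordFrac (R := X.presheaf.stalk (hU.fromSpec y)) h1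
  obtain ⟨⟨r, s⟩, hrs⟩ := IsLocalization.surj P.primeCompl t
  refine s.2 (hPs s r ?_)
  have := functionField_isScalarTower X U ⟨_, hy⟩
  rw [IsScalarTower.algebraMap_apply Γ(X, U) (X.presheaf.stalk (hU.fromSpec y)) X.functionField,
    IsScalarTower.algebraMap_apply Γ(X, U) (X.presheaf.stalk (hU.fromSpec y)) X.functionField,
    ← ht, ← map_mul, mul_comm, hrs]

/-- A rational function without poles in codimension one on a normal scheme is regular. -/
lemma exists_section {U : X.Opens} [Nonempty U] {h : X.functionField}
    (hh : ∀ x ∈ U, Order.coheight x = 1 → 0 ≤ Scheme.ord h x) :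
    ∃ s : Γ(X, U), X.germToFunctionField U s = h := by
  let I := {V : X.affineOpens // V.1 ≤ U ∧ Nonempty V.1}
  have hI : ∀ i : I, Nonempty i.1.1 := fun i => i.2.2
  have hs : ∀ i : I, ∃ s : Γ(X, i.1.1), X.germToFunctionField i.1.1 s = h := fun i =>
    exists_section_affine i.1.2 fun x hx => hh x (i.2.1 hx)
  choose s hs using hs
  have hgen : ∀ V : X.Opens, Nonempty V → genericPoint X ∈ V := fun V ⟨x⟩ =>
    ((genericPoint_spec X).mem_open_set_iff V.isOpen).mpr ⟨x.1, trivial, x.2⟩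
  have hcover : U ≤ iSup fun i : I => i.1.1 := by
    intro x hx
    obtain ⟨_, ⟨V, hV, rfl⟩, hxV, hVU⟩ := X.isBasis_affineOpens.exists_subset_of_mem_open hx U.isOpen
    exact Opens.mem_iSup.mpr ⟨⟨⟨V, hV⟩, hVU, ⟨⟨x, hxV⟩⟩⟩, hxV⟩
  -- The local sections agree on overlaps, because each has the germ `h` at the generic point.
  obtain ⟨t, ht, -⟩ := X.sheaf.existsUnique_gluing' (fun i : I => i.1.1) U
    (fun i => homOfLE i.2.1) hcover s (fun i j => by
      have : Nonempty (i.1.1 ⊓ j.1.1 : X.Opens) := ⟨⟨_, hgen _ (hI i), hgen _ (hI j)⟩⟩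
      apply X.germToFunctionField_injective (i.1.1 ⊓ j.1.1)
      change X.presheaf.germ _ _ _ (X.presheaf.map _ (s i)) =
        X.presheaf.germ _ _ _ (X.presheaf.map _ (s j))
      rw [X.presheaf.germ_res_apply, X.presheaf.germ_res_apply]
      exact (hs i).trans (hs j).symm)
  refine ⟨t, ?_⟩
  have hη := hgen U inferInstance
  obtain ⟨i, hi⟩ := Opens.mem_iSup.mp (hcover hη)
  rw [← hs i, ← ht i]
  exact (X.presheaf.germ_res_apply _ _ _ _).symm

end Hartogs

namespace LinearPredicate
variable {X : Scheme.{u}} {T : X → Type u} [∀ x, AddCommGroup (T x)]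
  [∀ x, Module (X.presheaf.stalk x) (T x)] {P : LinearPredicate T} {U V : X.Opens}

/-- A family that satisfies the condition, as a section of the sheaf. -/
def ofFamily (s : ∀ x : U, T x) (hs : P.toLocal.pred s) : Γ(P.toModules, U) :=
  (⟨s, hs⟩ : P.sections U)

/-- The family of a section. -/
def family (s : Γ(P.toModules, U)) : ∀ x : U, T x :=
  Subtype.val (p := fun t => t ∈ P.sections U) s

lemma pred_family (s : Γ(P.toModules, U)) : P.toLocal.pred (family s) :=
  Subtype.property (p := fun t => t ∈ P.sections U) s

lemma family_ext {s t : Γ(P.toModules, U)} (h : family s = family t) : s = t :=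
  Subtype.ext (p := fun t => t ∈ P.sections U) h

end LinearPredicate

/-! ### Sections and frames of `𝒪(D)` -/

section DivisorFrames
open LinearPredicate

lemma genericPoint_mem {X : Scheme.{u}} [IsIntegral X] (U : X.Opens) [hU : Nonempty U] : genericPoint X ∈ U :=
  ((genericPoint_spec X).mem_open_set_iff U.isOpen).mpr ⟨hU.some.1, trivial, hU.some.2⟩

variable {X : Scheme.{u}} [IsIntegral X] [IsLocallyNoetherian X] [IsNormal X]

/-- A rational function as a section of the sheaf of a divisor. -/
noncomputable def rationalSection (D : WeilDivisor X) (U : X.Opens) (g : X.functionField)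
    (hg : ∀ x ∈ U, Order.coheight x = 1 → 0 ≤ Scheme.ord g x + D.1 x) : Γ(divisorSheaf X D, U) :=
  ofFamily (fun _ => g) (TopCat.PrelocalPredicate.sheafifyOf ⟨g, fun _ => rfl, fun _ => hg⟩)

/-- The local rational functions coincide because every nonempty open set contains the generic
point, so sheafification adds no sections over a nonempty set. -/
lemma exists_eq_rationalSection {D : WeilDivisor X} {U : X.Opens} [Nonempty U]
    (s : Γ(divisorSheaf X D, U)) : ∃ f : X.functionField,
      (f ≠ 0 → ∀ x ∈ U, Order.coheight x = 1 → 0 ≤ Scheme.ord f x + D.1 x) ∧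
      ∀ x : U, (family s : U → X.functionField) x = f := by
  have key : ∀ x : U, (family s x : X.functionField) = family s ⟨_, genericPoint_mem U⟩ ∧
      ((family s x : X.functionField) ≠ 0 → Order.coheight x.1 = 1 →
        0 ≤ Scheme.ord (family s x : X.functionField) x.1 + D.1 x.1) := by
    intro x
    obtain ⟨V, hxV, i, f, hf, hord⟩ := pred_family s x
    have : Nonempty V := ⟨⟨_, hxV⟩⟩
    have h1 : family s x = f := hf ⟨x, hxV⟩
    refine ⟨h1.trans (hf ⟨_, genericPoint_mem V⟩).symm, ?_⟩
    rw [h1]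
    exact fun h0 h => hord h0 _ hxV h
  refine ⟨family s ⟨_, genericPoint_mem U⟩, fun h0 x hx h => ?_, fun x => (key x).1⟩
  have := (key ⟨x, hx⟩).2
  rw [(key ⟨x, hx⟩).1] at this
  exact this h0 h

/-- As `div g = -D` on `U`, a rational function `f` is a section of `𝒪(D)` exactly when `f / g` has
no poles in codimension one, that is, when it is regular. -/
lemma isFrame_rationalSection {D : WeilDivisor X} {U : X.Opens} {g : X.functionField} (hg0 : g ≠ 0)
    (hg : ∀ x ∈ U, Order.coheight x = 1 → Scheme.ord g x + D.1 x = 0) :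
    IsFrame (rationalSection D U g fun x hx h => (hg x hx h).ge) := by
  intro V hVU
  have hfam : ∀ (r : Γ(X, V)) (x : V), (family (r • res (divisorSheaf X D) hVU
      (rationalSection D U g fun x hx h => (hg x hx h).ge)) x : X.functionField) =
      algebraMap (X.presheaf.stalk x.1) X.functionField (X.presheaf.germ V x.1 x.2 r) * g :=
    fun r x => Algebra.smul_def (X.presheaf.germ V x.1 x.2 r) g
  by_cases hV : Nonempty V
  · have hfam' : ∀ (r : Γ(X, V)) (x : V), (family (r • res (divisorSheaf X D) hVU
      (rationalSection D U g fun x hx h => (hg x hx h).ge)) x : X.functionField) =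
      X.germToFunctionField V r * g := fun r x => by
        rw [hfam, X.algebraMap_germ_eq_germToFunctionField]
    constructor
    · intro r r' h
      have := congrArg (fun s => (family s hV.some : X.functionField)) h
      have h2 := (hfam' r hV.some).symm.trans (this.trans (hfam' r' hV.some))
      exact X.germToFunctionField_injective V (mul_right_cancel₀ hg0 h2)
    · intro t
      obtain ⟨f, hf, hft⟩ := exists_eq_rationalSection t
      by_cases hf0 : f = 0
      · refine ⟨0, family_ext (funext fun x => ?_)⟩
        exact (hfam' 0 x).trans (by rw [map_zero, zero_mul, hft, hf0])
      obtain ⟨r, hr⟩ := exists_section (U := V) (h := f / g) fun x hx h => by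
        have h1 := hf hf0 x hx h
        have h2 := hg x (hVU hx) h
        have h3 := Scheme.ord_mul (x := x) (div_ne_zero hf0 hg0) hg0
        rw [div_mul_cancel₀ _ hg0] at h3
        omega
      refine ⟨r, family_ext (funext fun x => ?_)⟩
      exact (hfam' r x).trans (by rw [hr, hft, div_mul_cancel₀ _ hg0])
  -- The empty set contains no generic point and is treated apart: everything over it is trivial.
  · have hV' : V = ⊥ := by
      ext x
      exact ⟨fun hx => hV ⟨⟨x, hx⟩⟩, fun hx => hx.elim⟩
    subst hV'
    refine ⟨fun r r' _ => Subsingleton.elim r r', fun t => ⟨0, family_ext (funext fun x => ?_)⟩⟩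
    exact x.2.elim

end DivisorFrames

lemma ord_algebraMap_nonneg {X : Scheme.{u}} [IsIntegral X] [IsLocallyNoetherian X] (x : X)
    (t : X.presheaf.stalk x) : 0 ≤ Scheme.ord (algebraMap _ X.functionField t) x := by
  by_cases h0 : t = 0
  · rw [h0, map_zero, Scheme.ord_zero]; rfl
  by_cases hx : Order.coheight x = 1
  · have : Ring.KrullDimLE 1 (X.presheaf.stalk x) := krullDimLE_of_coheight_le hx.le
    rw [Scheme.le_ord_iff hx fun h => h0 (IsFractionRing.injective (X.presheaf.stalk x)
      X.functionField (h.trans (map_zero _).symm))]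
    exact Ring.ordFrac_ge_one_of_ne_zero h0
  · rw [Scheme.ord_eq_zero_of_coheight_neq_one hx]

lemma ord_pow {X : Scheme.{u}} [IsIntegral X] [IsLocallyNoetherian X] (x : X)
    {f : X.functionField} (hf : f ≠ 0) (n : ℕ) : Scheme.ord (f ^ n) x = n * Scheme.ord f x := by
  induction n with
  | zero =>
    have h := Scheme.ord_mul (x := x) (f := 1) (g := (1 : X.functionField)) one_ne_zero one_ne_zero
    rw [one_mul] at h
    rw [pow_zero, Nat.cast_zero, zero_mul]
    omega
  | succ n ih => rw [pow_succ, Scheme.ord_mul (pow_ne_zero _ hf) hf, ih]; push_cast; ring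

/-! ### Homogeneous fractions as rational functions on `Proj` -/

section Fractions
variable {R : Type u} [CommRing R] {σ : Type*} [SetLike σ R] [AddSubgroupClass σ R]
  {𝒜 : ℕ → σ} [GradedRing 𝒜]

/-- A homogeneous fraction as a regular function. -/
def fractionSection {n : ℕ} (a b : 𝒜 n) : Γ(Proj 𝒜, Proj.basicOpen 𝒜 b.1) :=
  ⟨fun x => HomogeneousLocalization.mk ⟨n, a, b, x.2⟩,
    fun x => ⟨Proj.basicOpen 𝒜 b.1, x.2, 𝟙 _, n, a, b, fun y => y.2, fun _ => rfl⟩⟩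

lemma stalkToLocalization_germ {n : ℕ} (a b : 𝒜 n) (x : Proj 𝒜) (hx : x ∈ Proj.basicOpen 𝒜 b.1) :
    stalkToLocalization 𝒜 x ((Proj 𝒜).presheaf.germ _ x hx (fractionSection a b)) =
      Localization.mk a.1 ⟨b.1, hx⟩ :=
  congrArg HomogeneousLocalization.val
    (Proj.stalkIso'_germ 𝒜 (Proj.basicOpen 𝒜 b.1) x hx (fractionSection a b))

lemma stalkToLocalization_injective (x : Proj 𝒜) :
    Function.Injective (stalkToLocalization 𝒜 x) :=
  (HomogeneousLocalization.val_injective _).comp (Proj.stalkIso' 𝒜 x).injective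

lemma exists_homogeneous_notMem (x : Proj 𝒜) : ∃ m > 0, ∃ f ∈ 𝒜 m, f ∉ primeAt 𝒜 x := by
  by_contra! h
  exact ProjectiveSpectrum.not_irrelevant_le (𝒜 := 𝒜) x
    ((HomogeneousIdeal.toIdeal_irrelevant_le _).mpr fun i hi r hr => h i hi r hr)

variable [IsDomain R] [IsIntegral (Proj 𝒜)]

lemma nonempty_basicOpen {b : R} (hb : b ≠ 0) : Nonempty (Proj.basicOpen 𝒜 b) := by
  obtain ⟨m, hm, f, hf, hfx⟩ := exists_homogeneous_notMem (genericPoint (Proj 𝒜))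
  exact ⟨⟨pointOfIdeal ⊥ isPrime_bot_toIdeal hf hm
    (by rintro h; exact hfx ((show f = 0 by simpa using h) ▸ zero_mem _)), by
      change b ∉ (⊥ : HomogeneousIdeal 𝒜).toIdeal
      simpa using hb⟩⟩

lemma genericPoint_mem_basicOpen {b : R} (hb : b ≠ 0) :
    genericPoint (Proj 𝒜) ∈ Proj.basicOpen 𝒜 b :=
  have := nonempty_basicOpen (𝒜 := 𝒜) hb
  genericPoint_mem _

open Classical in
/-- A homogeneous fraction as a rational function. -/
noncomputable def fraction {n : ℕ} (a b : 𝒜 n) : (Proj 𝒜).functionField :=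
  if hb : b.1 ≠ 0 then
    (Proj 𝒜).presheaf.germ _ _ (genericPoint_mem_basicOpen hb) (fractionSection a b) else 0

lemma germToFunctionField_fractionSection {n : ℕ} (a b : 𝒜 n)
    [h : Nonempty (Proj.basicOpen 𝒜 b.1)] :
    (Proj 𝒜).germToFunctionField _ (fractionSection a b) = fraction a b := by
  have hb : b.1 ≠ 0 := by
    intro h0
    obtain ⟨x, hx⟩ := h
    have hx' : b.1 ∉ primeAt 𝒜 x := hx
    rw [h0] at hx'
    exact hx' (zero_mem _)
  rw [fraction, dif_pos hb]

lemma algebraMap_germ_fractionSection {n : ℕ} (a b : 𝒜 n) {x : Proj 𝒜}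
    (hx : x ∈ Proj.basicOpen 𝒜 b.1) :
    algebraMap _ (Proj 𝒜).functionField ((Proj 𝒜).presheaf.germ _ x hx (fractionSection a b)) =
      fraction a b := by
  have : Nonempty (Proj.basicOpen 𝒜 b.1) := ⟨⟨x, hx⟩⟩
  rw [Scheme.algebraMap_germ_eq_germToFunctionField, germToFunctionField_fractionSection]

lemma stalkToLocalization_fraction {n : ℕ} (a b : 𝒜 n) (hb : b.1 ≠ 0) :
    stalkToLocalization 𝒜 (genericPoint (Proj 𝒜)) (fraction a b) =
      Localization.mk a.1 ⟨b.1, genericPoint_mem_basicOpen hb⟩ := by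
  rw [fraction, dif_pos hb]
  exact stalkToLocalization_germ a b _ _

/-- The function field embeds into the full localization at the generic point, where the identity
becomes one between elements of `R`. -/
lemma fraction_mul {n m l : ℕ} {a b : 𝒜 n} {c d : 𝒜 m} {e f : 𝒜 l} (hb : b.1 ≠ 0) (hd : d.1 ≠ 0)
    (hf : f.1 ≠ 0) (h : a.1 * c.1 * f.1 = e.1 * (b.1 * d.1)) :
    fraction a b * fraction c d = fraction e f := by
  apply stalkToLocalization_injective
  rw [map_mul, stalkToLocalization_fraction _ _ hb, stalkToLocalization_fraction _ _ hd,
    stalkToLocalization_fraction _ _ hf, Localization.mk_mul, Localization.mk_eq_mk_iff,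
    Localization.r_iff_exists]
  refine ⟨1, ?_⟩
  change 1 * (f.1 * (a.1 * c.1)) = 1 * (b.1 * d.1 * e.1)
  linear_combination h

lemma fraction_self {n : ℕ} {a : 𝒜 n} (ha : a.1 ≠ 0) : fraction a a = 1 := by
  apply stalkToLocalization_injective
  rw [stalkToLocalization_fraction _ _ ha, map_one]
  exact Localization.mk_self ⟨a.1, _⟩

lemma fraction_mul_symm {n : ℕ} {a b : 𝒜 n} (ha : a.1 ≠ 0) (hb : b.1 ≠ 0) :
    fraction a b * fraction b a = 1 :=
  (fraction_mul (e := a) (f := a) hb ha ha (by ring)).trans (fraction_self ha)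

lemma fraction_ne_zero {n : ℕ} {a b : 𝒜 n} (ha : a.1 ≠ 0) (hb : b.1 ≠ 0) : fraction a b ≠ 0 :=
  left_ne_zero_of_mul_eq_one (fraction_mul_symm ha hb)

lemma fraction_pow {n m : ℕ} {a b : 𝒜 n} {c d : 𝒜 m} (k : ℕ) (hb : b.1 ≠ 0)
    (hc : c.1 = a.1 ^ k) (hd : d.1 = b.1 ^ k) : fraction a b ^ k = fraction c d := by
  apply stalkToLocalization_injective
  rw [map_pow, stalkToLocalization_fraction _ _ hb,
    stalkToLocalization_fraction _ _ (hd ▸ pow_ne_zero k hb), Localization.mk_pow]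
  congr 1
  · exact hc.symm
  · exact Subtype.ext hd.symm

variable [IsLocallyNoetherian (Proj 𝒜)]

lemma ord_fraction_nonneg {n : ℕ} (a b : 𝒜 n) {x : Proj 𝒜} (hb : b.1 ∉ primeAt 𝒜 x) :
    0 ≤ Scheme.ord (fraction a b) x := by
  rw [← algebraMap_germ_fractionSection a b (x := x) hb]
  exact ord_algebraMap_nonneg x _

/-- Both the fraction and its inverse are regular at `x`. -/
lemma ord_fraction_eq_zero {n : ℕ} {a b : 𝒜 n} {x : Proj 𝒜} (ha : a.1 ∉ primeAt 𝒜 x)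
    (hb : b.1 ∉ primeAt 𝒜 x) : Scheme.ord (fraction a b) x = 0 := by
  have ha0 : a.1 ≠ 0 := fun h => ha (h ▸ zero_mem _)
  have hb0 : b.1 ≠ 0 := fun h => hb (h ▸ zero_mem _)
  have h := Scheme.ord_mul (x := x) (fraction_ne_zero ha0 hb0) (fraction_ne_zero hb0 ha0)
  have h1 := Scheme.ord_mul (x := x) (f := 1) (g := (1 : (Proj 𝒜).functionField)) one_ne_zero
    one_ne_zero
  rw [one_mul] at h1
  rw [fraction_mul_symm ha0 hb0] at h
  have h2 := ord_fraction_nonneg a b hb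
  have h3 := ord_fraction_nonneg b a ha
  omega

end Fractions

/-! ### The zero locus of a homogeneous prime element -/

section PrimeElement
variable {R : Type u} [CommRing R] {σ : Type*} [SetLike σ R] [AddSubgroupClass σ R]
  {𝒜 : ℕ → σ} [GradedRing 𝒜]

lemma exists_eq_germ (x : Proj 𝒜) (z : (Proj 𝒜).presheaf.stalk x) :
    ∃ (n : ℕ) (a b : 𝒜 n) (hb : x ∈ Proj.basicOpen 𝒜 b.1),
      z = (Proj 𝒜).presheaf.germ _ x hb (fractionSection a b) := by
  obtain ⟨⟨n, a, b, hb⟩, h⟩ := HomogeneousLocalization.mk_surjective (Proj.stalkIso' 𝒜 x z)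
  refine ⟨n, a, b, hb, (Proj.stalkIso' 𝒜 x).injective ?_⟩
  rw [← h]
  exact (Proj.stalkIso'_germ 𝒜 (Proj.basicOpen 𝒜 b.1) x hb (fractionSection a b)).symm

lemma isUnit_germ_iff {n : ℕ} {a b : 𝒜 n} {x : Proj 𝒜} (hb : x ∈ Proj.basicOpen 𝒜 b.1) :
    IsUnit ((Proj 𝒜).presheaf.germ _ x hb (fractionSection a b)) ↔ a.1 ∉ primeAt 𝒜 x := by
  constructor
  · intro h
    have h' := h.map (stalkToLocalization 𝒜 x)
    rw [stalkToLocalization_germ, Localization.mk_eq_mk',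
      IsLocalization.AtPrime.isUnit_mk'_iff _ (primeAt 𝒜 x)] at h'
    exact h'
  · intro ha
    refine IsUnit.of_mul_eq_one ((Proj 𝒜).presheaf.germ _ x ha (fractionSection b a)) ?_
    apply stalkToLocalization_injective
    refine (map_mul _ _ _).trans ((congrArg₂ (· * ·) (stalkToLocalization_germ a b x hb)
      (stalkToLocalization_germ b a x ha)).trans (.trans ?_ (map_one _).symm))
    refine (Localization.mk_mul _ _ _ _).trans (.trans ?_ (Localization.mk_self
      (⟨b.1 * a.1, ((primeAt 𝒜 x).primeCompl).mul_mem hb ha⟩ : (primeAt 𝒜 x).primeCompl)))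
    exact congrArg (fun t => Localization.mk t _) (mul_comm a.1 b.1)

/-- A suitable homogeneous component of any quotient is again a quotient. If `n < m` there is no
such component, and `a = 0`. -/
lemma exists_homogeneous_quotient {u a : R} {m n : ℕ} (hu : u ∈ 𝒜 m) (ha : a ∈ 𝒜 n) (h : u ∣ a) :
    a = 0 ∨ ∃ l, ∃ c ∈ 𝒜 l, m + l = n ∧ a = u * c := by
  classical
  obtain ⟨c, hc⟩ := h
  have h1 := DirectSum.decompose_of_mem_same 𝒜 ha
  rw [hc, DirectSum.coe_decompose_mul_of_left_mem 𝒜 n hu] at h1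
  split_ifs at h1 with hmn
  · exact .inr ⟨n - m, _, Subtype.property _, Nat.add_sub_cancel' hmn, hc.trans h1.symm⟩
  · exact .inl (hc.trans h1.symm)

variable {u s : R} {d : ℕ} (hu : Prime u) (hud : u ∈ 𝒜 d) (hs : s ∈ 𝒜 d) (hd : 0 < d)
  (hus : ¬ u ∣ s)

/-- The generic point of the zero locus of a homogeneous prime element. -/
def vanishingPoint : Proj 𝒜 :=
  pointOfIdeal ⟨Ideal.span {u}, Ideal.homogeneous_span 𝒜 _ (by rintro _ rfl; exact ⟨d, hud⟩)⟩
    ((Ideal.span_singleton_prime hu.ne_zero).mpr hu) hs hd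
    (fun h => hus (Ideal.mem_span_singleton.mp h))

lemma mem_primeAt_vanishingPoint {a : R} :
    a ∈ primeAt 𝒜 (vanishingPoint hu hud hs hd hus) ↔ u ∣ a :=
  Ideal.mem_span_singleton

lemma slice_notMem_vanishingPoint : vanishingPoint hu hud hs hd hus ∈ Proj.basicOpen 𝒜 s := fun h =>
  hus ((mem_primeAt_vanishingPoint hu hud hs hd hus).mp h)

/-- The local equation of the zero locus of a prime element at its generic point. -/
noncomputable def localEquation : (Proj 𝒜).presheaf.stalk (vanishingPoint hu hud hs hd hus) :=
  (Proj 𝒜).presheaf.germ _ _ (slice_notMem_vanishingPoint hu hud hs hd hus)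
    (fractionSection ⟨u, hud⟩ ⟨s, hs⟩)

lemma stalkToLocalization_localEquation :
    stalkToLocalization 𝒜 _ (localEquation hu hud hs hd hus) =
      Localization.mk u ⟨s, slice_notMem_vanishingPoint hu hud hs hd hus⟩ :=
  stalkToLocalization_germ ⟨u, hud⟩ ⟨s, hs⟩ _ _

/-- A nonunit `a / b` has `u ∣ a`, say `a = u c`, and then `a / b = (u / s) (c s / b)`. The element
`s`, of the same degree as `u` and not divisible by it, keeps both factors of degree zero and
regular. -/
lemma localEquation_dvd {z : (Proj 𝒜).presheaf.stalk (vanishingPoint hu hud hs hd hus)}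
    (hz : ¬ IsUnit z) : localEquation hu hud hs hd hus ∣ z := by
  obtain ⟨n, a, b, hb, rfl⟩ := exists_eq_germ _ z
  rw [isUnit_germ_iff, not_not, mem_primeAt_vanishingPoint] at hz
  rcases exists_homogeneous_quotient hud a.2 hz with ha | ⟨l, c, hc, hl, ha⟩
  · have : (Proj 𝒜).presheaf.germ _ _ hb (fractionSection a b) = 0 := by
      apply stalkToLocalization_injective
      rw [stalkToLocalization_germ, map_zero, ha, Localization.mk_zero]
    rw [this]
    exact dvd_zero _
  · have hcs : c * s ∈ 𝒜 n := by
      rw [← hl, add_comm]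
      exact SetLike.mul_mem_graded hc hs
    refine ⟨(Proj 𝒜).presheaf.germ _ _ hb (fractionSection ⟨c * s, hcs⟩ b), ?_⟩
    apply stalkToLocalization_injective
    refine (stalkToLocalization_germ _ _ _ _).trans (.trans ?_ (map_mul _ _ _).symm)
    refine .trans ?_ (congrArg₂ (· * ·) (stalkToLocalization_localEquation hu hud hs hd hus)
      (stalkToLocalization_germ ⟨c * s, hcs⟩ b _ hb)).symm
    refine .trans ?_ (Localization.mk_mul _ _ _ _).symm
    rw [Localization.mk_eq_mk_iff, Localization.r_iff_exists]
    refine ⟨1, ?_⟩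
    change 1 * (s * b.1 * a.1) = 1 * (b.1 * (u * (c * s)))
    rw [ha]
    ring

lemma not_isUnit_localEquation : ¬ IsUnit (localEquation hu hud hs hd hus) :=
  fun h => (isUnit_germ_iff (a := ⟨u, hud⟩) (b := ⟨s, hs⟩) _).mp h
    ((mem_primeAt_vanishingPoint hu hud hs hd hus).mpr dvd_rfl)

lemma maximalIdeal_vanishingPoint :
    IsLocalRing.maximalIdeal ((Proj 𝒜).presheaf.stalk (vanishingPoint hu hud hs hd hus)) =
      Ideal.span {localEquation hu hud hs hd hus} := by
  refine le_antisymm (fun z hz => ?_) ((Ideal.span_singleton_le_iff_mem _).mpr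
    ((IsLocalRing.mem_maximalIdeal _).mpr (not_isUnit_localEquation hu hud hs hd hus)))
  exact Ideal.mem_span_singleton.mpr
    (localEquation_dvd hu hud hs hd hus ((IsLocalRing.mem_maximalIdeal _).mp hz))

variable [IsDomain R]

lemma localEquation_ne_zero : localEquation hu hud hs hd hus ≠ 0 := by
  intro h
  have h' := (stalkToLocalization_localEquation hu hud hs hd hus).symm.trans
    ((congrArg (stalkToLocalization 𝒜 _) h).trans (map_zero _))
  rw [Localization.mk_eq_mk', IsLocalization.mk'_eq_zero_iff] at h'
  obtain ⟨m, hm⟩ := h'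
  rcases mul_eq_zero.mp hm with hm | hm
  · exact m.2 (hm ▸ zero_mem _)
  · exact hu.ne_zero hm

variable [IsLocallyNoetherian (Proj 𝒜)]

/-- The maximal ideal of the stalk is generated by one nonzerodivisor that is not a unit, so it has
height one. -/
lemma coheight_vanishingPoint : Order.coheight (vanishingPoint hu hud hs hd hus) = 1 := by
  have h1 := ringKrullDim_stalk_eq_coheight (vanishingPoint hu hud hs hd hus)
  rw [← IsLocalRing.maximalIdeal_height_eq_ringKrullDim, maximalIdeal_vanishingPoint,
    Ideal.height_span_singleton_eq_one_of_mem_nonZeroDivisors (mem_nonZeroDivisors_of_ne_zero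
      (localEquation_ne_zero hu hud hs hd hus)) (not_isUnit_localEquation hu hud hs hd hus)] at h1
  exact_mod_cast h1.symm

/-- Since `u` vanishes at `x`, the vanishing point specializes to `x`. It already has codimension
one, and a strict specialization would raise the codimension. -/
lemma eq_vanishingPoint {x : Proj 𝒜} (hx : Order.coheight x = 1) (hux : u ∈ primeAt 𝒜 x) :
    x = vanishingPoint hu hud hs hd hus := by
  set x₀ := vanishingPoint hu hud hs hd hus with hx₀
  have hle : primeAt 𝒜 x₀ ≤ primeAt 𝒜 x := fun a ha => by
    obtain ⟨c, rfl⟩ := (mem_primeAt_vanishingPoint hu hud hs hd hus).mp ha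
    exact Ideal.mul_mem_right _ _ hux
  have hspec : x₀ ⤳ x := by
    rw [specializes_iff_mem_closure]
    exact (ProjectiveSpectrum.le_iff_mem_closure 𝒜 _ _).mp hle
  have h1 : x ≤ x₀ := Scheme.le_iff_specializes.mpr hspec
  by_contra hne
  have h2 : x < x₀ := lt_of_le_not_ge h1 fun h3 => hne (by
    have := Scheme.le_iff_specializes.mp h3
    exact (this.antisymm hspec).eq)
  have h3 := Order.coheight_add_one_le h2
  rw [hx, hx₀, coheight_vanishingPoint] at h3
  exact absurd h3 (by decide)

variable [IsIntegral (Proj 𝒜)] [IsNormal (Proj 𝒜)]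

lemma ord_fraction_vanishingPoint : Scheme.ord (fraction (𝒜 := 𝒜) ⟨u, hud⟩ ⟨s, hs⟩)
    (vanishingPoint hu hud hs hd hus) = 1 := by
  have hco := coheight_vanishingPoint hu hud hs hd hus
  have := isDiscreteValuationRing_stalk _ _ hco
  have hs0 : s ≠ 0 := by rintro rfl; exact hus (dvd_zero u)
  rw [Scheme.ord_eq_iff hco (fraction_ne_zero hu.ne_zero hs0),
    ← algebraMap_germ_fractionSection _ _ (slice_notMem_vanishingPoint hu hud hs hd hus)]
  exact Ring.ordFrac_irreducible ((IsDiscreteValuationRing.irreducible_iff_uniformizer _).mpr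
    (maximalIdeal_vanishingPoint hu hud hs hd hus))

end PrimeElement

/-! ### The divisor of a homogeneous prime element -/

section VanishingDivisor
variable {R : Type u} [CommRing R] {σ : Type*} [SetLike σ R] [AddSubgroupClass σ R]
  {𝒜 : ℕ → σ} [GradedRing 𝒜]

lemma pow_notMem_primeAt {a : R} {x : Proj 𝒜} (ha : a ∉ primeAt 𝒜 x) (n : ℕ) :
    a ^ n ∉ primeAt 𝒜 x :=
  fun h => ha ((inferInstance : (primeAt 𝒜 x).IsPrime).mem_of_pow_mem n h)

lemma vanishingMultiplicity_eq_zero {u : R} {x : Proj 𝒜} (hux : u ∉ primeAt 𝒜 x) :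
    vanishingMultiplicity 𝒜 u x = 0 := by
  have h1 : Ideal.span {algebraMap R (LocalizedAt 𝒜 x) u} = ⊤ :=
    Ideal.span_singleton_eq_top.mpr
      (IsLocalization.map_units (LocalizedAt 𝒜 x) (⟨u, hux⟩ : (primeAt 𝒜 x).primeCompl))
  rw [vanishingMultiplicity, h1, Ideal.comap_top, Module.length_eq_zero_iff]
  exact Submodule.Quotient.subsingleton_iff.mpr rfl

variable {u s : R} {d : ℕ} (hu : Prime u) (hud : u ∈ 𝒜 d) (hs : s ∈ 𝒜 d) (hd : 0 < d)
  (hus : ¬ u ∣ s)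

/-- The elements of the stalk divisible by `u` form a proper ideal that contains the generator `u /
s` of the maximal ideal; the quotient is the residue field, of length one. -/
lemma vanishingMultiplicity_vanishingPoint :
    vanishingMultiplicity 𝒜 u (vanishingPoint hu hud hs hd hus) = 1 := by
  set x := vanishingPoint hu hud hs hd hus
  have h1 : (Ideal.span {algebraMap R (LocalizedAt 𝒜 x) u}).comap (stalkToLocalization 𝒜 x) =
      IsLocalRing.maximalIdeal _ := by
    apply le_antisymm
    · refine IsLocalRing.le_maximalIdeal (Ideal.comap_ne_top _ fun h => ?_)
      exact (IsLocalization.AtPrime.isUnit_to_map_iff (LocalizedAt 𝒜 x) (primeAt 𝒜 x) u).mp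
        (Ideal.span_singleton_eq_top.mp h)
        ((mem_primeAt_vanishingPoint hu hud hs hd hus).mpr dvd_rfl)
    · rw [maximalIdeal_vanishingPoint hu hud hs hd hus, Ideal.span_singleton_le_iff_mem,
        Ideal.mem_comap, Ideal.mem_span_singleton]
      refine ⟨Localization.mk 1 ⟨s, slice_notMem_vanishingPoint hu hud hs hd hus⟩, ?_⟩
      refine (stalkToLocalization_localEquation hu hud hs hd hus).trans ?_
      rw [← Localization.mk_one_eq_algebraMap, Localization.mk_mul, mul_one, one_mul]
  rw [vanishingMultiplicity, h1, Module.length_eq_one_iff, isSimpleModule_iff_isCoatom]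
  exact (IsLocalRing.maximalIdeal.isMaximal _).out

variable [IsDomain R] [IsLocallyNoetherian (Proj 𝒜)]

open Classical in
/-- The zero locus of a homogeneous prime element, as a Weil divisor. -/
noncomputable def vanishingDivisor : WeilDivisor (Proj 𝒜) :=
  ⟨Function.locallyFinsuppWithin.single (vanishingPoint hu hud hs hd hus) 1, fun x hx => by
    rw [Function.locallyFinsuppWithin.single_apply, if_neg]
    rintro rfl
    exact hx (coheight_vanishingPoint hu hud hs hd hus)⟩

lemma vanishingDivisor_vanishingPoint :
    (vanishingDivisor hu hud hs hd hus).1 (vanishingPoint hu hud hs hd hus) = 1 := by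
  classical
  rw [vanishingDivisor, Function.locallyFinsuppWithin.single_apply, if_pos rfl]

lemma vanishingDivisor_of_notMem {x : Proj 𝒜} (hux : u ∉ primeAt 𝒜 x) :
    (vanishingDivisor hu hud hs hd hus).1 x = 0 := by
  classical
  rw [vanishingDivisor, Function.locallyFinsuppWithin.single_apply, if_neg]
  rintro rfl
  exact hux ((mem_primeAt_vanishingPoint hu hud hs hd hus).mpr dvd_rfl)

lemma isVanishingDivisor_vanishingDivisor :
    IsVanishingDivisor 𝒜 u (vanishingDivisor hu hud hs hd hus) := by
  intro x hx
  by_cases hux : u ∈ primeAt 𝒜 x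
  · obtain rfl := eq_vanishingPoint hu hud hs hd hus hx hux
    exact ⟨1, vanishingMultiplicity_vanishingPoint hu hud hs hd hus,
      vanishingDivisor_vanishingPoint hu hud hs hd hus⟩
  · exact ⟨0, vanishingMultiplicity_eq_zero hux, vanishingDivisor_of_notMem hu hud hs hd hus hux⟩

variable [IsIntegral (Proj 𝒜)] [IsNormal (Proj 𝒜)]

/-- At the vanishing point `(f / uⁿ) (u / s)ⁿ = f / sⁿ` is a unit and `u / s` has order one, so `f /
uⁿ` has order `-n`. At the other points both terms vanish. -/
lemma ord_fraction_add_vanishingDivisor_eq {n : ℕ} {f v : 𝒜 (n • d)} (hv : v.1 = u ^ n)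
    {x : Proj 𝒜} (hx : Order.coheight x = 1) (hf : f.1 ∉ primeAt 𝒜 x) :
    Scheme.ord (fraction f v) x + (n • vanishingDivisor hu hud hs hd hus).1 x = 0 := by
  have hn : (n • vanishingDivisor hu hud hs hd hus).1 x =
    n * (vanishingDivisor hu hud hs hd hus).1 x := by
    change n • (vanishingDivisor hu hud hs hd hus).1 x = _
    rw [nsmul_eq_mul]
  rw [hn]
  by_cases hux : u ∈ primeAt 𝒜 x
  · obtain rfl := eq_vanishingPoint hu hud hs hd hus hx hux
    have hs0 : s ≠ 0 := by rintro rfl; exact hus (dvd_zero u)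
    have hf0 : f.1 ≠ 0 := fun h => hf (h ▸ zero_mem _)
    have hv0 : v.1 ≠ 0 := hv ▸ pow_ne_zero _ hu.ne_zero
    have h1 := fraction_ne_zero (𝒜 := 𝒜) (a := ⟨u, hud⟩) (b := ⟨s, hs⟩) hu.ne_zero hs0
    have h2 : fraction (𝒜 := 𝒜) ⟨u, hud⟩ ⟨s, hs⟩ ^ n =
        fraction v ⟨s ^ n, SetLike.pow_mem_graded n hs⟩ := fraction_pow n hs0 hv rfl
    have h3 : fraction f v * fraction v ⟨s ^ n, SetLike.pow_mem_graded n hs⟩ =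
        fraction f ⟨s ^ n, SetLike.pow_mem_graded n hs⟩ :=
      fraction_mul hv0 (pow_ne_zero n hs0) (pow_ne_zero n hs0) (by ring)
    have h4 := Scheme.ord_mul (x := vanishingPoint hu hud hs hd hus) (fraction_ne_zero hf0 hv0)
      (pow_ne_zero n h1)
    have hsx : s ^ n ∉ primeAt 𝒜 (vanishingPoint hu hud hs hd hus) :=
      pow_notMem_primeAt (slice_notMem_vanishingPoint hu hud hs hd hus) n
    rw [ord_pow _ h1, ord_fraction_vanishingPoint hu hud hs hd hus, h2, h3,
      ord_fraction_eq_zero hf hsx] at h4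
    rw [vanishingDivisor_vanishingPoint]
    omega
  · rw [vanishingDivisor_of_notMem hu hud hs hd hus hux, ord_fraction_eq_zero hf, mul_zero,
      add_zero]
    rw [hv]
    exact pow_notMem_primeAt hux n

/-- Compare with some `w` of the same degree that does not vanish at `x`, either `sⁿ` or `uⁿ`: in `f
/ v = (f / w) (w / v)` the first factor is regular and the order of the second is known. -/
lemma ord_fraction_add_vanishingDivisor_nonneg {n : ℕ} {f v : 𝒜 (n • d)} (hv : v.1 = u ^ n)
    {x : Proj 𝒜} (hx : Order.coheight x = 1) (hf0 : f.1 ≠ 0) :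
    0 ≤ Scheme.ord (fraction f v) x + (n • vanishingDivisor hu hud hs hd hus).1 x := by
  have hv0 : v.1 ≠ 0 := hv ▸ pow_ne_zero _ hu.ne_zero
  obtain ⟨w, hw⟩ : ∃ w : 𝒜 (n • d), w.1 ∉ primeAt 𝒜 x := by
    by_cases hux : u ∈ primeAt 𝒜 x
    · obtain rfl := eq_vanishingPoint hu hud hs hd hus hx hux
      exact ⟨⟨s ^ n, SetLike.pow_mem_graded n hs⟩,
        pow_notMem_primeAt (slice_notMem_vanishingPoint hu hud hs hd hus) n⟩
    · exact ⟨⟨u ^ n, SetLike.pow_mem_graded n hud⟩, pow_notMem_primeAt hux n⟩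
  have hw0 : w.1 ≠ 0 := fun h => hw (h ▸ zero_mem _)
  have h1 : fraction f w * fraction w v = fraction f v := fraction_mul hw0 hv0 hv0 (by ring)
  have h2 := Scheme.ord_mul (x := x) (fraction_ne_zero hf0 hw0) (fraction_ne_zero hw0 hv0)
  have h3 := ord_fraction_add_vanishingDivisor_eq hu hud hs hd hus hv hx hw
  have h4 := ord_fraction_nonneg f w hw
  rw [h1] at h2
  omega

end VanishingDivisor

/-! ### Ampleness of the divisor -/

section Ample
open LinearPredicate

lemma isFrame_res_rationalSection {X : Scheme.{u}} [IsIntegral X] [IsLocallyNoetherian X]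
    [IsNormal X] {E : WeilDivisor X} {U V : X.Opens} (h : V ≤ U) {g : X.functionField} (hg0 : g ≠ 0)
    (hg : ∀ x ∈ U, Order.coheight x = 1 → 0 ≤ Scheme.ord g x + E.1 x)
    (hV : ∀ x ∈ V, Order.coheight x = 1 → Scheme.ord g x + E.1 x = 0) :
    IsFrame (res (divisorSheaf X E) h (rationalSection E U g hg)) :=
  isFrame_rationalSection hg0 hV

variable {R : Type u} [CommRing R] {σ : Type*} [SetLike σ R] [AddSubgroupClass σ R]
  {𝒜 : ℕ → σ} [GradedRing 𝒜] [IsDomain R] [IsLocallyNoetherian (Proj 𝒜)]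
  [IsIntegral (Proj 𝒜)] [IsNormal (Proj 𝒜)]

/-- A frame `f / v` gives `w / v = r (f / v)` with `r` regular. Hence `r (f / w) = 1`, so `f / w` is
a unit at `x`. -/
lemma notMem_primeAt_of_isFrame {E : WeilDivisor (Proj 𝒜)} {n : ℕ} {f w v : 𝒜 n}
    (hw0 : w.1 ≠ 0) (hv0 : v.1 ≠ 0) {U : (Proj 𝒜).Opens}
    (hf : ∀ x ∈ U, Order.coheight x = 1 → 0 ≤ Scheme.ord (fraction f v) x + E.1 x)
    (hw : ∀ x ∈ U, Order.coheight x = 1 → 0 ≤ Scheme.ord (fraction w v) x + E.1 x)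
    (hU : IsFrame (rationalSection E U (fraction f v) hf)) {x : Proj 𝒜} (hx : x ∈ U)
    (hwx : w.1 ∉ primeAt 𝒜 x) : f.1 ∉ primeAt 𝒜 x := by
  obtain ⟨r, hr⟩ := (hU U le_rfl).2 (rationalSection E U (fraction w v) hw)
  have h1 : algebraMap ((Proj 𝒜).presheaf.stalk x) (Proj 𝒜).functionField
      ((Proj 𝒜).presheaf.germ U x hx r) * fraction f v = fraction w v :=
    (Algebra.smul_def ((Proj 𝒜).presheaf.germ U x hx r) (fraction f v)).symm.trans
      (congrArg (fun s => (family s ⟨x, hx⟩ : (Proj 𝒜).functionField)) hr)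
  have h2 : fraction f v * fraction v w = fraction f w := fraction_mul hv0 hw0 hw0 (by ring)
  have h3 : algebraMap ((Proj 𝒜).presheaf.stalk x) (Proj 𝒜).functionField
      ((Proj 𝒜).presheaf.germ U x hx r) * fraction f w = 1 := by
    rw [← h2, ← mul_assoc, h1, fraction_mul_symm hw0 hv0]
  rw [← algebraMap_germ_fractionSection f w (x := x) hwx, ← map_mul] at h3
  refine (isUnit_germ_iff (a := f) (b := w) hwx).mp (IsUnit.of_mul_eq_one _ ((mul_comm _ _).trans
    (IsFractionRing.injective ((Proj 𝒜).presheaf.stalk x) (Proj 𝒜).functionField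
      (h3.trans (map_one _).symm))))

variable {u s : R} {d : ℕ} (hu : Prime u) (hud : u ∈ 𝒜 d) (hs : s ∈ 𝒜 d) (hd : 0 < d)
  (hus : ¬ u ∣ s)

/-- On `D₊(f)` the order formula makes the section a frame. Conversely, where it is a frame,
comparison with an element `w` not vanishing at the given point shows that `f` does not vanish
there; this is where `hcov` enters. -/
lemma nonvanishingLocus_rationalSection {n : ℕ} {f v : 𝒜 (n • d)} (hv : v.1 = u ^ n)
    (hf0 : f.1 ≠ 0) (hcov : ∀ x : Proj 𝒜, ∃ w : 𝒜 (n • d), w.1 ∉ primeAt 𝒜 x) :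
    nonvanishingLocus (rationalSection (n • vanishingDivisor hu hud hs hd hus) ⊤ (fraction f v)
      fun _ _ hx => ord_fraction_add_vanishingDivisor_nonneg hu hud hs hd hus hv hx hf0) =
      Proj.basicOpen 𝒜 f.1 := by
  have hv0 : v.1 ≠ 0 := hv ▸ pow_ne_zero _ hu.ne_zero
  apply le_antisymm
  · refine sSup_le fun U hU x hx => ?_
    obtain ⟨w, hw⟩ := hcov x
    have hw0 : w.1 ≠ 0 := fun h => hw (h ▸ zero_mem _)
    exact notMem_primeAt_of_isFrame hw0 hv0
      (fun x _ hx => ord_fraction_add_vanishingDivisor_nonneg hu hud hs hd hus hv hx hf0)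
      (fun x _ hx => ord_fraction_add_vanishingDivisor_nonneg hu hud hs hd hus hv hx hw0) hU hx hw
  · refine le_sSup (isFrame_res_rationalSection le_top (fraction_ne_zero hf0 hv0) _
      fun x hx h => ord_fraction_add_vanishingDivisor_eq hu hud hs hd hus hv h hx)

lemma isAmple_vanishingDivisor [CompactSpace (Proj 𝒜)] {n : ℕ} (hn : 0 < n)
    (hcov : ∀ x : Proj 𝒜, ∃ w : 𝒜 (n • d), w.1 ∉ primeAt 𝒜 x) :
    IsAmple (vanishingDivisor hu hud hs hd hus) := by
  refine ⟨inferInstance, n, hn, fun x => ?_, fun x => ?_⟩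
  all_goals
    obtain ⟨f, hf⟩ := hcov x
    have hf0 : f.1 ≠ 0 := fun h => hf (h ▸ zero_mem _)
    let v : 𝒜 (n • d) := ⟨u ^ n, SetLike.pow_mem_graded n hud⟩
    have hv0 : v.1 ≠ 0 := pow_ne_zero _ hu.ne_zero
  · exact ⟨Proj.basicOpen 𝒜 f.1, hf, _, isFrame_rationalSection (fraction_ne_zero hf0 hv0)
      fun x hx h => ord_fraction_add_vanishingDivisor_eq hu hud hs hd hus (v := v) rfl h hx⟩
  · refine ⟨1, one_pos, ?_⟩
    rw [one_smul]
    have h := nonvanishingLocus_rationalSection hu hud hs hd hus (v := v) rfl hf0 hcov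
    refine ⟨_, (le_of_eq h.symm) hf, ?_⟩
    rw [h]
    exact Proj.isAffineOpen_basicOpen 𝒜 f.1 f.2 (Nat.mul_pos hn hd)

end Ample

/-! ### Frames of the twisting sheaf -/

section Twist
open LinearPredicate
variable {R : Type u} [CommRing R] {σ : Type*} [SetLike σ R] [AddSubgroupClass σ R]
  {𝒜 : ℕ → σ} [GradedRing 𝒜]

lemma stalkToLocalization_germ_eq_val {U : (Proj 𝒜).Opens} (r : Γ(Proj 𝒜, U)) (x : Proj 𝒜)
    (hx : x ∈ U) : stalkToLocalization 𝒜 x ((Proj 𝒜).presheaf.germ U x hx r) =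
      (r.1 ⟨x, hx⟩).val :=
  congrArg HomogeneousLocalization.val (Proj.stalkIso'_germ 𝒜 U x hx r)

/-- A homogeneous element as a section of a twisting sheaf. -/
noncomputable def twistSection {d : ℕ} (f : 𝒜 d) (U : (Proj 𝒜).Opens) : Γ(serreTwist 𝒜 d, U) :=
  ofFamily (fun _ => Localization.mk f.1 1) (TopCat.PrelocalPredicate.sheafifyOf
    ⟨0, f.1, 1, (zero_add d).symm ▸ f.2, SetLike.GradedOne.one_mem, fun y =>
      ⟨(inferInstance : (primeAt 𝒜 y.1).IsPrime).one_notMem, rfl⟩⟩)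

lemma family_smul_twistSection {d : ℕ} (f : 𝒜 d) (U : (Proj 𝒜).Opens) (r : Γ(Proj 𝒜, U)) (x : U) :
    (family (r • twistSection f U) x : LocalizedAt 𝒜 x.1) =
      (r.1 x).val * Localization.mk f.1 1 :=
  congrArg (fun t : LocalizedAt 𝒜 x.1 => t * Localization.mk f.1 1)
    (stalkToLocalization_germ_eq_val r x.1 x.2)

lemma isUnit_mk {f : R} {x : Proj 𝒜} (hf : f ∉ primeAt 𝒜 x) :
    IsUnit (Localization.mk f 1 : LocalizedAt 𝒜 x) := by
  rw [Localization.mk_one_eq_algebraMap]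
  exact IsLocalization.map_units (LocalizedAt 𝒜 x) (⟨f, hf⟩ : (primeAt 𝒜 x).primeCompl)

lemma mk_one_eq_mul (a b : R) {x : Proj 𝒜} (hb : b ∉ primeAt 𝒜 x) :
    (Localization.mk a 1 : LocalizedAt 𝒜 x) = Localization.mk a ⟨b, hb⟩ * Localization.mk b 1 := by
  rw [Localization.mk_mul, Localization.mk_eq_mk_iff, Localization.r_iff_exists]
  refine ⟨1, ?_⟩
  change 1 * (b * 1 * a) = 1 * (1 * (a * b))
  ring

/-- Locally `t = a / b` has degree `d`, and `a / (b f)` has degree zero. These quotients are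
determined by `t`, since `f` is a unit in the localizations, so they form one regular function. -/
lemma exists_smul_twistSection {d : ℕ} {f : 𝒜 d} {V : (Proj 𝒜).Opens}
    (hV : V ≤ Proj.basicOpen 𝒜 f.1) (t : Γ(serreTwist 𝒜 d, V)) :
    ∃ r : Γ(Proj 𝒜, V), r • twistSection f V = t := by
  have hfV : ∀ x : V, f.1 ∉ primeAt 𝒜 x.1 := fun x => hV x.2
  have key : ∀ x : V, ∃ (W : (Proj 𝒜).Opens) (_ : x.1 ∈ W) (i : W ⟶ V) (n : ℕ) (a b : 𝒜 n)
      (hb : ∀ y : W, b.1 ∉ primeAt 𝒜 y.1), ∀ y : W, Localization.mk a.1 ⟨b.1, hb y⟩ *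
        Localization.mk f.1 1 = (family t ⟨y.1, i.le y.2⟩ : LocalizedAt 𝒜 y.1) := by
    intro x
    obtain ⟨W, hxW, i, n, a, b, ha, hb, h⟩ := pred_family t x
    have hy : ∀ y : W, b * f.1 ∉ primeAt 𝒜 y.1 := fun y =>
      ((primeAt 𝒜 y.1).primeCompl).mul_mem (h y).choose (hfV ⟨y.1, i.le y.2⟩)
    refine ⟨W, hxW, i, n + d, ⟨a, ha⟩, ⟨b * f.1, SetLike.mul_mem_graded hb f.2⟩, hy, fun y => ?_⟩
    obtain ⟨hb', e⟩ := h y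
    refine .trans ?_ e.symm
    rw [Localization.mk_mul, Localization.mk_eq_mk_iff, Localization.r_iff_exists]
    refine ⟨1, ?_⟩
    change 1 * (b * (a * f.1)) = 1 * (b * f.1 * 1 * a)
    ring
  have hq : ∀ x : V, ∃ q : HomogeneousLocalization.AtPrime 𝒜 (primeAt 𝒜 x.1),
      q.val * Localization.mk f.1 1 = (family t x : LocalizedAt 𝒜 x.1) := fun x => by
    obtain ⟨W, hxW, i, n, a, b, hb, h⟩ := key x
    exact ⟨HomogeneousLocalization.mk ⟨n, a, b, hb ⟨x.1, hxW⟩⟩, h ⟨x.1, hxW⟩⟩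
  choose q hq using hq
  refine ⟨⟨q, fun x => ?_⟩, family_ext (funext fun x =>
    (family_smul_twistSection f V _ x).trans (hq x))⟩
  obtain ⟨W, hxW, i, n, a, b, hb, h⟩ := key x
  refine ⟨W, hxW, i, n, a, b, hb, fun y => HomogeneousLocalization.val_injective _ ?_⟩
  exact (isUnit_mk (hfV ⟨y.1, i.le y.2⟩)).mul_right_cancel ((hq _).trans (h y).symm)

lemma isFrame_twistSection {d : ℕ} (f : 𝒜 d) {U : (Proj 𝒜).Opens}
    (hU : U ≤ Proj.basicOpen 𝒜 f.1) : IsFrame (twistSection f U) := by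
  intro V hVU
  refine ⟨fun r r' h => ?_, fun t => exists_smul_twistSection (hVU.trans hU) t⟩
  refine Subtype.ext (funext fun x => HomogeneousLocalization.val_injective _ ?_)
  refine (isUnit_mk (hU (hVU x.2))).mul_right_cancel
    ((family_smul_twistSection f V r x).symm.trans (.trans ?_ (family_smul_twistSection f V r' x)))
  exact congrArg (fun s => (family s x : LocalizedAt 𝒜 x.1)) h

end Twist

/-! ### Pullback of the sheaf of a divisor along a map of `Proj` -/

section PullbackOfDivisor
open LinearPredicate
variable {R S : Type u} [CommRing R] [CommRing S] {σ τ : Type u} [SetLike σ R]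
  [AddSubgroupClass σ R] [SetLike τ S] [AddSubgroupClass τ S] {𝒜 : ℕ → σ} [GradedRing 𝒜]
  {ℬ : ℕ → τ} [GradedRing ℬ]

lemma val_app_map_fractionSection (φ : 𝒜 →+*ᵍ ℬ)
    (hφ : HomogeneousIdeal.irrelevant ℬ ≤ (HomogeneousIdeal.irrelevant 𝒜).map φ) {n : ℕ}
    (a b : 𝒜 n) {V : (Proj 𝒜).Opens} (hV : V ≤ Proj.basicOpen 𝒜 b.1)
    (y : Proj ℬ) (hy : y ∈ Proj.map φ hφ ⁻¹ᵁ V) :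
    (((Proj.map φ hφ).app V (resO hV (fractionSection a b))).1 ⟨y, hy⟩).val =
      Localization.mk (φ a.1) ⟨φ b.1, hV hy⟩ := by
  have hc : primeAt 𝒜 (Proj.map φ hφ y) = (primeAt ℬ y).comap φ := rfl
  exact (HomogeneousLocalization.val_localRingHom (f := φ) (I := primeAt 𝒜 (Proj.map φ hφ y))
    (J := primeAt ℬ y) (hIJ := hc) (HomogeneousLocalization.mk ⟨n, a, b, hV hy⟩)).trans
    (Localization.localRingHom_mk _ _ _ _ _ _)

variable [IsDomain R] [IsLocallyNoetherian (Proj 𝒜)] [IsIntegral (Proj 𝒜)] [IsNormal (Proj 𝒜)]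
  {u s : R} {d : ℕ} (hu : Prime u) (hud : u ∈ 𝒜 d) (hs : s ∈ 𝒜 d) (hd : 0 < d)
  (hus : ¬ u ∣ s)

/-- The frames `f i / uⁿ` of `𝒪(nB)` have the transition functions `f i / f j`, and the frames `φ (f
i)` of the twist have their pullbacks. Only the sets `D₊(φ (f i))` must cover the source; the `f i`
may have common zeros on the target. -/
lemma nonempty_pullback_map_divisorSheaf_iso (φ : 𝒜 →+*ᵍ ℬ)
    (hφ : HomogeneousIdeal.irrelevant ℬ ≤ (HomogeneousIdeal.irrelevant 𝒜).map φ) {n : ℕ} {ι : Type*}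
    (f : ι → 𝒜 (n • d)) (hf0 : ∀ i, (f i).1 ≠ 0)
    (hf : ⨆ i, Proj.basicOpen ℬ (φ (f i).1) = ⊤) :
    Nonempty ((Scheme.Modules.pullback (Proj.map φ hφ)).obj
      (divisorSheaf (Proj 𝒜) (n • vanishingDivisor hu hud hs hd hus)) ≅ serreTwist ℬ (n • d)) := by
  let v : 𝒜 (n • d) := ⟨u ^ n, SetLike.pow_mem_graded n hud⟩
  have hv0 : v.1 ≠ 0 := pow_ne_zero n hu.ne_zero
  have hord : ∀ i, ∀ x ∈ Proj.basicOpen 𝒜 (f i).1, Order.coheight x = 1 →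
      Scheme.ord (fraction (f i) v) x + (n • vanishingDivisor hu hud hs hd hus).1 x = 0 :=
    fun i x hx h => ord_fraction_add_vanishingDivisor_eq hu hud hs hd hus (v := v) rfl h hx
  refine nonempty_pullback_iso_of_frames (U := fun i => Proj.basicOpen 𝒜 (f i).1)
    (s := fun i => rationalSection _ _ (fraction (f i) v) fun x hx h => (hord i x hx h).ge)
    (Proj.map φ hφ) (serreTwist ℬ (n • d)) hf
    (fun i => isFrame_rationalSection (fraction_ne_zero (hf0 i) hv0) (hord i))
    (fun i => twistSection ⟨φ (f i).1, φ.2 (f i).2⟩ _)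
    (fun i => isFrame_twistSection _ le_rfl) fun i j => ?_
  refine ⟨resO inf_le_right (fractionSection (f i) (f j)), family_ext (funext fun x => ?_),
    family_ext (funext fun y => ?_)⟩
  · have h1 := algebraMap_germ_fractionSection (f i) (f j) (x := x.1) x.2.2
    have h2 : (Proj 𝒜).presheaf.germ (Proj.basicOpen 𝒜 (f i).1 ⊓ Proj.basicOpen 𝒜 (f j).1) x.1 x.2
        (resO inf_le_right (fractionSection (f i) (f j))) =
        (Proj 𝒜).presheaf.germ _ x.1 x.2.2 (fractionSection (f i) (f j)) :=
      (Proj 𝒜).presheaf.germ_res_apply _ _ _ _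
    have h3 : fraction (f i) (f j) * fraction (f j) v = fraction (f i) v :=
      fraction_mul (hf0 j) hv0 hv0 (by ring)
    rw [← h1, ← h2] at h3
    exact h3.symm.trans (Algebra.smul_def ((Proj 𝒜).presheaf.germ
      (Proj.basicOpen 𝒜 (f i).1 ⊓ Proj.basicOpen 𝒜 (f j).1) x.1 x.2
        (resO inf_le_right (fractionSection (f i) (f j)))) (fraction (f j) v)).symm
  · refine .trans ?_ (family_smul_twistSection ⟨φ (f j).1, φ.2 (f j).2⟩ _
      ((Proj.map φ hφ).app _ (resO inf_le_right (fractionSection (f i) (f j)))) y).symm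
    refine .trans ?_ (congrArg (fun t => t * Localization.mk (φ (f j).1) 1)
      (val_app_map_fractionSection φ hφ (f i) (f j) inf_le_right y.1 y.2)).symm
    exact mk_one_eq_mul _ _ (x := y.1) y.2.2

end PullbackOfDivisor

/-! ### The divisor `V₊(υ)` and its restriction to the generic fiber -/

section Rees
attribute [local instance] MvPolynomial.gradedAlgebra
variable {k A : Type u} [Field k] [CommRing A] [Algebra k A] {δ : Derivation k A A}

lemma exists_pos_forall_exists_notMem_primeAt (hR : Algebra.FiniteType k (reesAlgebra δ)) :
    ∃ n > 0, ∀ x : Proj (reesGrading δ), ∃ w : reesGrading δ n, w.1 ∉ primeAt (reesGrading δ) x := by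
  have := finiteType_degreeZero hR
  obtain ⟨D, S, s, hD, hsS, hSD, hcov, -⟩ := exists_uniform_generators (reesGrading δ)
  refine ⟨D, hD, fun x => ?_⟩
  obtain ⟨g, hg⟩ := Opens.mem_iSup.mp (hcov.ge (Opens.mem_top x))
  exact ⟨⟨g.1, hSD _ (hsS g.2)⟩, hg⟩

variable [IsDomain A]

lemma compactSpace_reesProj (hR : Algebra.FiniteType k (reesAlgebra δ)) :
    CompactSpace (reesProj δ) := by
  have := (isVariety_reesProj hR).quasiCompact
  exact (quasiCompact_iff_compactSpace (f := reesProj.π δ ≫ _)).mp this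

namespace Trivialization
variable (τ : Trivialization δ)

/-- The divisor `V₊(υ)`. -/
noncomputable def infinityDivisor [IsLocallyNoetherian (Proj (reesGrading δ))] :
    WeilDivisor (Proj (reesGrading δ)) :=
  vanishingDivisor τ.prime_upsilon upsilon_mem τ.slice_mem one_pos τ.not_upsilon_dvd_slice

variable [IsLocallyNoetherian (Proj (reesGrading δ))] [IsIntegral (Proj (reesGrading δ))]
  [IsNormal (Proj (reesGrading δ))]

lemma isAmple_infinityDivisor (hR : Algebra.FiniteType k (reesAlgebra δ)) :
    IsAmple τ.infinityDivisor := by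
  have : CompactSpace (Proj (reesGrading δ)) := compactSpace_reesProj hR
  obtain ⟨n, hn, h⟩ := exists_pos_forall_exists_notMem_primeAt hR
  rw [← mul_one n] at h
  exact isAmple_vanishingDivisor _ _ _ _ _ hn h

/-- With `n = 1`, the slice and `υ` suffice: they map to the two coordinates of the line, which have
no common zero. -/
lemma nonempty_pullback_lineMap_iso :
    Nonempty ((Scheme.Modules.pullback τ.lineMap).obj (divisorSheaf (Proj (reesGrading δ)) τ.infinityDivisor) ≅
      ProjectiveSpace.twist 1 (FractionRing (kernel δ)) 1) := by
  have hs0 : τ.slice ≠ 0 := fun h => τ.not_upsilon_dvd_slice (h ▸ dvd_zero _)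
  have h := nonempty_pullback_map_divisorSheaf_iso τ.prime_upsilon upsilon_mem τ.slice_mem one_pos
    τ.not_upsilon_dvd_slice τ.hom τ.irrelevant_le (n := 1)
    ![⟨τ.slice, τ.slice_mem⟩, ⟨upsilon δ, upsilon_mem⟩] (by
      intro i
      fin_cases i
      · exact hs0
      · exact upsilon_ne_zero) (by
      refine Proj.iSup_basicOpen_eq_top _ _ (irrelevant_le_span_X.trans (le_of_eq ?_))
      congr 2
      funext i
      fin_cases i
      · exact τ.map_slice.symm
      · exact τ.map_upsilon.symm)
  rw [one_smul] at h
  exact h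

/-- The inclusion of the generic fiber is the identification with the line followed by `lineMap`, so
the pullback can be computed in two stages. -/
lemma exists_genericFiber_iso : ∃ e : genericFiber (reesProj.π δ) ≅
      ProjectiveSpace 1 (FractionRing (kernel δ)),
    e.hom ≫ ProjectiveSpace.toSpec 1 (FractionRing (kernel δ)) =
        genericFiber.toSpec (reesProj.π δ) ∧
      Nonempty ((Scheme.Modules.pullback (genericFiber.ι (reesProj.π δ))).obj
          (divisorSheaf (Proj (reesGrading δ)) τ.infinityDivisor) ≅
        (Scheme.Modules.pullback e.hom).obj
          (ProjectiveSpace.twist 1 (FractionRing (kernel δ)) 1)) := by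
  let e := τ.isPullback_lineMap.isoPullback.symm
  have hι : e.hom ≫ τ.lineMap = genericFiber.ι (reesProj.π δ) :=
    τ.isPullback_lineMap.isoPullback_inv_fst
  obtain ⟨i⟩ := τ.nonempty_pullback_lineMap_iso
  refine ⟨e, τ.isPullback_lineMap.isoPullback_inv_snd, ⟨?_⟩⟩
  exact (Scheme.Modules.pullbackCongr hι.symm).app _ ≪≫
    ((Scheme.Modules.pullbackComp e.hom τ.lineMap).app _).symm ≪≫
      (Scheme.Modules.pullback e.hom).mapIso i

end Trivialization
end Rees

end ReesFibration

theorem mainTheorem3 {k A : Type u} [Field k] [CharZero k] [CommRing A] [IsDomain A]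
    [IsIntegrallyClosed A] [Algebra k A] [Algebra.FiniteType k A] (δ : Derivation k A A)
    (hδ : IsLocallyNilpotent δ) (hδ0 : δ ≠ 0) (hR : Algebra.FiniteType k (reesAlgebra δ)) :
    (IsVariety (quotientVariety.structureMorphism δ) ∧ IsNormal (quotientVariety δ)) ∧
    ∃ (_ : AlgebraicGeometry.IsIntegral (reesProj δ)) (_ : IsLocallyNoetherian (reesProj δ))
      (_ : IsNormal (reesProj δ)),
      IsVariety (reesProj.π δ ≫ quotientVariety.structureMorphism δ) ∧
      IsP1Fibration (reesProj.π δ) ∧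
      ∃ B : WeilDivisor (reesProj δ),
        IsVanishingDivisor (reesGrading δ) (upsilon δ) B ∧ IsAmple B ∧
        ∃ e : genericFiber (reesProj.π δ) ≅ ProjectiveSpace 1 (FractionRing (kernel δ)),
          e.hom ≫ ProjectiveSpace.toSpec 1 (FractionRing (kernel δ)) =
            genericFiber.toSpec (reesProj.π δ) ∧
          Nonempty ((Scheme.Modules.pullback (genericFiber.ι (reesProj.π δ))).obj
              (divisorSheaf (reesProj δ) B) ≅
            (Scheme.Modules.pullback e.hom).obj
              (ProjectiveSpace.twist 1 (FractionRing (kernel δ)) 1)) := by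
  obtain ⟨τ⟩ := nonempty_trivialization hδ hδ0
  have := isIntegrallyClosed_kernel (δ := δ)
  have h1 : IsIntegrallyClosed (reesAlgebra δ) := τ.isIntegrallyClosed_rees
  have h2 : AlgebraicGeometry.IsIntegral (Proj (reesGrading δ)) := isIntegral_reesProj
  have h3 : IsLocallyNoetherian (Proj (reesGrading δ)) := isLocallyNoetherian_reesProj hR
  have h4 : IsNormal (Proj (reesGrading δ)) := isNormal_proj (reesGrading δ)
  have hπ := isProper_π hR
  obtain ⟨e, he, hB⟩ := τ.exists_genericFiber_iso
  exact ⟨⟨isVariety_quotient hR, isNormal_spec (kernel δ)⟩, h2, h3, h4, isVariety_reesProj hR,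
    ⟨surjective_π hR, isProjective_π hR, hπ.toLocallyOfFiniteType, inferInstance, e, he⟩,
    τ.infinityDivisor, isVanishingDivisor_vanishingDivisor _ _ _ _ _,
    τ.isAmple_infinityDivisor hR, e, he, hB⟩
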